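/- Let $d\ge 2$ ($d=3$ is physical space; $d=2$ is the planar problem, to which the motion of each single ray reduces). A spherically symmetric medium is given by an open set $D\subset(0,\infty)$ of radii and a positive, twice continuously differentiable refractive index $n:D\to(0,\infty)$; the point $x\in\mathbb R^d$ with $|x|\in D$ has index $n(|x|)$. Put $N(r)=r\,n(r)$. A light ray is a curve $\gamma$, parametrised by arc length and staying in the medium, with $\frac{d}{ds}\big(n(|\gamma|)\,\gamma'\big)=\nabla\big(n(|x|)\big)\big|_{x=\gamma(s)}$. A ray emerging from $A$ passes through $B$ if it reaches $B$ at some arc length $s>0$. A point $B$ is a *stigmatic image* of $A$ if, in some plane through the centre $0$ and $A$, all rays emerging from $A$ into some nonempty open interval of directions pass through $B$; it is a *strong* image if all rays emerging from $A$ into some nonempty open set of directions in the unit sphere of $\mathbb R^d$ pass through $B$. The medium is an *absolute instrument imaging $\Omega$ by $F$* if $\Omega\subset\mathbb R^d$ is a nonempty connected open set, $F:\Omega\to\mathbb R^d$ is continuously differentiable, and $F(A)$ is a stigmatic image of $A$ for each $A\in\Omega$. For $A\in\Omega$ write $B=F(A)$, $r_A=|A|$, $r_B=|B|$. For every spherically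 symmetric absolute instrument imaging $\Omega$ by $F$: 1. $N(r_A)=N(r_B)$ for all $A\in\Omega$. 2. There is a constant $k>0$ such that either $r_B=k\,r_A$ for all $A\in\Omega$ (first branch), or $r_B=k/r_A$ for all $A\in\Omega$ (second branch). 3. If the first branch holds with constant $k$, then $k=1$ in each of these two cases: (a) the constant is the same for all points imaged by the instrument, that is, whenever the same medium images a domain $\Omega'$ by a map $F'$ with $|F'(A)|=k'|A|$ on $\Omega'$, then $k'=k$; (b) for some $A\in\Omega$, a ray launched from $A$ tangentially (perpendicularly to the radius vector of $A$) passes through the image $F(A)$. 4. If moreover $F(A)$ is a strong image of $A$ for each $A\in\Omega$ (which is automatic when $d=2$), then there is a linear isometry $Q$ of $\mathbb R^d$ such that $F(A)=k\,QA$ on $\Omega$ for the first branch and $F(A)=\frac{k}{|A|^2}\,QA$ on $\Omega$ for the second. So on the first branch with $k=1$ the image is congruent to the object, and on the second branch it is the spherical inversion of the object up to an isometry. In addition, if $D=(0,\infty)$ and the second branch holds for all points and all rays on one side, that is, if for some $k>0$ each $A\ne0$ has a point $B$ with $r_B=k/r_A$ through which all rays pass that emerge from $A$ at an angle $\psi\in(0,\pi)$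 to the radius vector, towards one fixed side of it in some plane through $0$ and $A$, then the medium is a generalised Maxwell fish eye: there are $m>0$ and $L_0>0$ such that for all $r>0$ $$n(r)=\frac{2L_0}{r\left[(r/\sqrt k)^m+(\sqrt k/r)^m\right]}.$$ -/

import Mathlib

open Set
open scoped RealInnerProductSpace

/-- A spherically symmetric isotropic medium: the point `x` (with `‖x‖ ∈ region`) has refractive
index `index ‖x‖`. The region of radii is open and does not contain the centre of symmetry; the
index is positive and twice continuously differentiable there, so that a light ray is determined
by its initial point and direction. -/
structure RadialMedium where
  region : Set ℝ
  index : ℝ → ℝ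
  isOpen_region : IsOpen region
  region_pos : region ⊆ Ioi 0
  contDiffOn_index : ContDiffOn ℝ 2 index region
  index_pos : ∀ r ∈ region, 0 < index r

namespace RadialMedium

/-- The turning parameter `N(r) = r n(r)`. -/
def turningParameter (M : RadialMedium) (r : ℝ) : ℝ := r * M.index r

/-- `γ`, with velocity `v`, restricted to `[0, T]` is a light ray parametrised by arc length:
it satisfies the ray equation `d/ds (n dγ/ds) = ∇ n` of geometrical optics. -/
structure IsLightRay (M : RadialMedium) {d : ℕ} (T : ℝ)
    (γ v : ℝ → EuclideanSpace ℝ (Fin d)) : Prop where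
  mem_region : ∀ s ∈ Icc 0 T, ‖γ s‖ ∈ M.region
  hasDeriv : ∀ s ∈ Icc 0 T, HasDerivWithinAt γ (v s) (Icc 0 T) s
  unit_speed : ∀ s ∈ Icc 0 T, ‖v s‖ = 1
  ray_equation : ∀ s ∈ Icc 0 T,
    HasDerivWithinAt (fun σ => M.index ‖γ σ‖ • v σ)
      (gradient (fun x : EuclideanSpace ℝ (Fin d) => M.index ‖x‖) (γ s)) (Icc 0 T) s

/-- The light ray emerging from `A` in the direction `u` passes through `B`. -/
def RayJoins (M : RadialMedium) {d : ℕ} (A u B : EuclideanSpace ℝ (Fin d)) : Prop :=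
  ∃ (T : ℝ) (γ v : ℝ → EuclideanSpace ℝ (Fin d)),
    0 < T ∧ M.IsLightRay T γ v ∧ γ 0 = A ∧ v 0 = u ∧ γ T = B

/-- In some plane containing the centre `0` and the point `A`, all the rays that emerge from `A`
at an angle `ψ ∈ (α, β)` to the radius vector of `A` pass through `B`. -/
def IsFanImage (M : RadialMedium) {d : ℕ} (α β : ℝ) (A B : EuclideanSpace ℝ (Fin d)) : Prop :=
  ∃ b : EuclideanSpace ℝ (Fin d), ‖b‖ = 1 ∧ ⟪A, b⟫ = 0 ∧
    ∀ ψ ∈ Ioo α β, M.RayJoins A (Real.cos ψ • (‖A‖⁻¹ • A) + Real.sin ψ • b) B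

/-- `B` is a stigmatic image of `A`: it is met by all the rays that emerge from `A` into some
nonzero angle of a plane through `A` and the centre. (Every ray is contained in such a plane.) -/
def IsStigmaticImage (M : RadialMedium) {d : ℕ} (A B : EuclideanSpace ℝ (Fin d)) : Prop :=
  ∃ α β : ℝ, α < β ∧ M.IsFanImage α β A B

/-- `B` is a strong stigmatic image of `A`: it is met by all the rays that emerge from `A` into
some nonempty open set of directions (a nonzero solid angle when `d = 3`). -/
def IsStrongImage (M : RadialMedium) {d : ℕ} (A B : EuclideanSpace ℝ (Fin d)) : Prop :=
  ∃ U : Set (EuclideanSpace ℝ (Fin d)), IsOpen U ∧ (∃ u ∈ U, ‖u‖ = 1) ∧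
    ∀ u ∈ U, ‖u‖ = 1 → M.RayJoins A u B

/-- The medium is an absolute instrument imaging the domain `Ω`: every point `A` of `Ω` has the
stigmatic image `F A`, which depends on `A` in a continuously differentiable way. -/
structure Images (M : RadialMedium) {d : ℕ} (Ω : Set (EuclideanSpace ℝ (Fin d)))
    (F : EuclideanSpace ℝ (Fin d) → EuclideanSpace ℝ (Fin d)) : Prop where
  isOpen : IsOpen Ω
  isConnected : IsConnected Ω
  contDiffOn : ContDiffOn ℝ 1 F Ω
  stigmatic : ∀ A ∈ Ω, M.IsStigmaticImage A (F A)

end RadialMedium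

/-- The index of the generalised Maxwell fish eye whose circular ray has radius `r₀` and
angular momentum `L₀`. -/
noncomputable def fishEyeIndex (m L₀ r₀ r : ℝ) : ℝ :=
  2 * L₀ / (r * ((r / r₀) ^ m + (r₀ / r) ^ m))

/-! In the variables x = log r and u, where ds = n r² du, a ray is a one-dimensional Newtonian
motion: x' = w, w' = E'(x)/2 and w² + L² = E(x) with E = N², while its polar angle is exactly L u
(`IsLightRay.exists_orbit`, `rayJoins_of_isOrbit`). A stigmatic image thus means that motions from a
= log r_A reach b = log r_B at times U with one angle Θ = L U, modulo full turns, for a whole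
interval of momenta L.

Rigidity. Let a', b' belong to a neighbouring object and image. For equal L and equal directions at
the ends, the two motions are pieces of a single one, so everything between the ends cancels and Θ'
− Θ = L (τ ∫_b^{b'} dy/√(E − L²) − σ ∫_a^{a'} dy/√(E − L²)), with σ, τ = ±1 the directions of motion
at the ends. The left side does not involve L. Differentiating in the object point, L (τ db/√(E(b) −
L²) − σ da/√(E(a) − L²)) is constant in L, which forces τ db = σ da and, where da ≠ 0, E(a) = E(b);
then the angle is constant as well (`RadialPotential.exists_rigid`). The number of turns, the
directions and the range of the motions are not known to vary continuously; Baire's theorem makes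
them uniform, once over L (`FanJoined.exists_isFan`) and once over the object points. The
conclusions hold near some point of each open subset of Ω; since F is C¹ and Ω connected, they
spread to Ω.

First branch. Reversed rays form images with ratio 1/k (`exists_images_inv`), whence case (a). In
case (b) a tangential ray has turning points at both A and its image, with equal forces there
because N(kr) = N(r) near r_A; such turning points coincide. For strong images with d > 2, the rays
through an image off the line 0A fill only a plane, so F(A) is a multiple of A; for d = 2 the
oriented angle from A to F(A) is constant.

Fish eye. With origin at log √k, every motion leaving p outwards reaches −p. Hence E is even and
decreases away from 0, and L S, the angle from 0 to the first turning point, lies in a countable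
set; being continuous in L it is a constant c. Abel inversion of this condition gives √E(x) = N₀ /
cosh(πx/(2c)), where N₀ = √E(0). -/

/-- The potential governing the radial motion of light rays in the logarithmic radius: `energy` is
the square of the turning parameter and `force` is half its derivative. -/
structure RadialPotential where
  domain : Set ℝ
  energy : ℝ → ℝ
  force : ℝ → ℝ
  isOpen_domain : IsOpen domain
  hasDerivAt_energy : ∀ x ∈ domain, HasDerivAt energy (2 * force x) x
  contDiffOn_force : ContDiffOn ℝ 1 force domain

/-! ### Radial motions: symmetries, uniqueness, transit time -/

namespace RadialPotential

variable {P : RadialPotential}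

/-- `(x, w)` is a radial motion on `[0, U]` with angular momentum `L`. -/
structure IsOrbit (P : RadialPotential) (L U : ℝ) (x w : ℝ → ℝ) : Prop where
  mem_domain : ∀ u ∈ Icc 0 U, x u ∈ P.domain
  deriv_pos : ∀ u ∈ Icc 0 U, HasDerivWithinAt x (w u) (Icc 0 U) u
  deriv_mom : ∀ u ∈ Icc 0 U, HasDerivWithinAt w (P.force (x u)) (Icc 0 U) u
  conserved : ∀ u ∈ Icc 0 U, w u ^ 2 + L ^ 2 = P.energy (x u)

lemma continuousOn_energy : ContinuousOn P.energy P.domain := fun x hx =>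
  (P.hasDerivAt_energy x hx).continuousAt.continuousWithinAt

lemma continuousOn_force : ContinuousOn P.force P.domain := P.contDiffOn_force.continuousOn

lemma exists_lipschitzOnWith_force {K : Set ℝ} (hK : IsCompact K) (hKD : K ⊆ P.domain) :
    ∃ C, LipschitzOnWith C P.force K := by
  apply LocallyLipschitzOn.exists_lipschitzOnWith_of_compact hK
  intro x hx
  obtain ⟨C, t, ht, h⟩ := (P.contDiffOn_force.contDiffAt
    (P.isOpen_domain.mem_nhds (hKD hx))).exists_lipschitzOnWith
  exact ⟨C, t, mem_nhdsWithin_of_mem_nhds ht, h⟩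

namespace IsOrbit

variable {L L' U U' V s : ℝ} {x w x' w' : ℝ → ℝ}

lemma continuousOn_pos (h : P.IsOrbit L U x w) : ContinuousOn x (Icc 0 U) := fun u hu =>
  (h.deriv_pos u hu).continuousWithinAt

lemma continuousOn_mom (h : P.IsOrbit L U x w) : ContinuousOn w (Icc 0 U) := fun u hu =>
  (h.deriv_mom u hu).continuousWithinAt

lemma sub (h : P.IsOrbit L U x w) (hs : 0 ≤ s) (hV : s + V ≤ U) :
    P.IsOrbit L V (fun u => x (s + u)) (fun u => w (s + u)) := by
  have key : ∀ u ∈ Icc 0 V, s + u ∈ Icc 0 U := fun u hu => ⟨by linarith [hu.1], by linarith [hu.2]⟩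
  have aux : ∀ u, HasDerivWithinAt (fun u : ℝ => s + u) 1 (Icc 0 V) u := fun u =>
    ((hasDerivAt_id u).const_add s).hasDerivWithinAt
  refine ⟨fun u hu => h.mem_domain _ (key u hu), fun u hu => ?_, fun u hu => ?_,
    fun u hu => h.conserved _ (key u hu)⟩
  · exact ((h.deriv_pos _ (key u hu)).comp u (aux u) key).congr_deriv (by simp)
  · exact ((h.deriv_mom _ (key u hu)).comp u (aux u) key).congr_deriv (by simp)

lemma restrict (h : P.IsOrbit L U x w) (hV : V ≤ U) : P.IsOrbit L V x w := by
  simpa using h.sub (s := 0) le_rfl (by simpa using hV)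

lemma reverse (h : P.IsOrbit L U x w) :
    P.IsOrbit L U (fun u => x (U - u)) (fun u => -w (U - u)) := by
  have key : ∀ u ∈ Icc 0 U, U - u ∈ Icc 0 U := fun u hu => ⟨by linarith [hu.2], by linarith [hu.1]⟩
  have aux : ∀ u, HasDerivWithinAt (fun u : ℝ => U - u) (-1) (Icc 0 U) u := fun u =>
    ((hasDerivAt_id u).const_sub U).hasDerivWithinAt
  refine ⟨fun u hu => h.mem_domain _ (key u hu), fun u hu => ?_, fun u hu => ?_,
    fun u hu => by simpa using h.conserved _ (key u hu)⟩
  · exact ((h.deriv_pos _ (key u hu)).comp u (aux u) key).congr_deriv (by simp)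
  · exact ((h.deriv_mom _ (key u hu)).comp u (aux u) key).neg.congr_deriv (by simp)

lemma hasDerivWithinAt_Ici (h : P.IsOrbit L U x w) {u : ℝ} (hu : u ∈ Ico 0 U) :
    HasDerivWithinAt (fun u => (x u, w u)) (w u, P.force (x u)) (Ici u) u := by
  have hu' : u ∈ Icc 0 U := Ico_subset_Icc_self hu
  have : HasDerivWithinAt (fun u => (x u, w u)) (w u, P.force (x u)) (Icc 0 U) u :=
    (h.deriv_pos u hu').prodMk (h.deriv_mom u hu')
  refine (this.mono (Icc_subset_Icc_left hu.1)).mono_of_mem_nhdsWithin ?_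
  exact Icc_mem_nhdsGE hu.2

lemma hasDerivAt_pos (h : P.IsOrbit L U x w) {u : ℝ} (hu : u ∈ Ioo 0 U) :
    HasDerivAt x (w u) u :=
  (h.deriv_pos u (Ioo_subset_Icc_self hu)).hasDerivAt (Icc_mem_nhds hu.1 hu.2)

/-- The force is C¹, hence Lipschitz on the compact union of both trajectories, and ODE uniqueness
applies. The momenta L and L' do not enter Newton's equation and may be given separately. -/
lemma eqOn (h : P.IsOrbit L U x w) (h' : P.IsOrbit L' U x' w') (hx : x 0 = x' 0)
    (hw : w 0 = w' 0) : ∀ u ∈ Icc 0 U, x u = x' u ∧ w u = w' u := by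
  set K := x '' Icc 0 U ∪ x' '' Icc 0 U with hK
  have hKc : IsCompact K := (isCompact_Icc.image_of_continuousOn h.continuousOn_pos).union
    (isCompact_Icc.image_of_continuousOn h'.continuousOn_pos)
  obtain ⟨C, hC⟩ := exists_lipschitzOnWith_force (P := P) hKc (by
    rintro _ (⟨u, hu, rfl⟩ | ⟨u, hu, rfl⟩)
    exacts [h.mem_domain u hu, h'.mem_domain u hu])
  have hv : LipschitzOnWith (max 1 C) (fun y : ℝ × ℝ => (y.2, P.force y.1)) (K ×ˢ univ) := by
    refine LipschitzOnWith.prodMk (LipschitzWith.prod_snd.lipschitzOnWith) ?_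
    have := hC.comp (LipschitzWith.prod_fst.lipschitzOnWith (s := K ×ˢ (univ : Set ℝ)))
      (fun y hy => hy.1)
    rwa [mul_one] at this
  have := ODE_solution_unique_of_mem_Icc_right (v := fun _ => fun y : ℝ × ℝ => (y.2, P.force y.1))
    (s := fun _ => K ×ˢ univ) (a := 0) (b := U) (fun t _ => hv)
    (h.continuousOn_pos.prodMk h.continuousOn_mom) (fun t ht => h.hasDerivWithinAt_Ici ht)
    (fun t ht => ⟨Or.inl ⟨t, Ico_subset_Icc_self ht, rfl⟩, trivial⟩)
    (h'.continuousOn_pos.prodMk h'.continuousOn_mom) (fun t ht => h'.hasDerivWithinAt_Ici ht)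
    (fun t ht => ⟨Or.inr ⟨t, Ico_subset_Icc_self ht, rfl⟩, trivial⟩) (by simp [hx, hw])
  intro u hu
  simpa using this hu

/-- The time spent on a stretch of constant direction. -/
lemma time_eq (h : P.IsOrbit L U x w) (hU : 0 ≤ U) {τ : ℝ} (hτ : τ ^ 2 = 1)
    (hw : ∀ u ∈ Icc 0 U, 0 < τ * w u) :
    U = τ * ∫ y in x 0..x U, (√(P.energy y - L ^ 2))⁻¹ := by
  have hI : uIcc 0 U = Icc 0 U := uIcc_of_le hU
  have hsq : ∀ u ∈ Icc 0 U, √(P.energy (x u) - L ^ 2) = τ * w u := fun u hu => by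
    rw [← h.conserved u hu, show w u ^ 2 + L ^ 2 - L ^ 2 = (τ * w u) ^ 2 by
      rw [mul_pow, hτ]; ring, Real.sqrt_sq (hw u hu).le]
  -- Substitution y = x u: dy = w du and √(E − L²) = τ w, so τ times the integrand becomes 1.
  have := intervalIntegral.integral_comp_mul_deriv'' (a := 0) (b := U) (f := x) (f' := w)
    (g := fun y => (√(P.energy y - L ^ 2))⁻¹) (by rw [hI]; exact h.continuousOn_pos)
    (fun u hu => by
      rw [min_eq_left hU, max_eq_right hU] at hu
      exact (h.hasDerivAt_pos hu).hasDerivWithinAt)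
    (by rw [hI]; exact h.continuousOn_mom)
    (by
      rw [hI]
      have hE : ContinuousOn P.energy (x '' Icc 0 U) := P.continuousOn_energy.mono (by
        rintro _ ⟨u, hu, rfl⟩; exact h.mem_domain u hu)
      refine ContinuousOn.inv₀ (hE.sub continuousOn_const).sqrt ?_
      rintro _ ⟨u, hu, rfl⟩
      rw [hsq u hu]
      exact (hw u hu).ne')
  rw [← this, ← intervalIntegral.integral_const_mul]
  have e : ∀ u ∈ uIcc 0 U,
      τ * (((fun y => (√(P.energy y - L ^ 2))⁻¹) ∘ x) u * w u) = 1 := fun u hu => by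
    rw [hI] at hu
    have := hsq u hu
    simp only [Function.comp]
    rw [this]
    rw [mul_left_comm, inv_mul_cancel₀ (hw u hu).ne']
  rw [intervalIntegral.integral_congr e]
  simp

lemma abs_mom_sub_le (h : P.IsOrbit L U x w) {C : ℝ} (hC : ∀ u ∈ Icc 0 U, |P.force (x u)| ≤ C)
    {u v : ℝ} (hu : u ∈ Icc 0 U) (hv : v ∈ Icc 0 U) : |w v - w u| ≤ C * |v - u| := by
  simpa using (convex_Icc 0 U).norm_image_sub_le_of_norm_hasDerivWithin_le
    (fun y hy => h.deriv_mom y hy) (fun y hy => by simpa using hC y hy) hu hv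

/-- The range is a compact interval in an open set, so it can be enlarged slightly. Rational
endpoints leave only countably many windows, as the Baire argument requires. -/
lemma exists_Icc (h : P.IsOrbit L U x w) (hU : 0 ≤ U) :
    ∃ c d : ℚ, Icc (c : ℝ) d ⊆ P.domain ∧ ∀ u ∈ Icc 0 U, x u ∈ Icc (c : ℝ) d := by
  have h1 : IsConnected (x '' Icc 0 U) :=
    (isConnected_Icc hU).image _ h.continuousOn_pos
  have h2 : IsCompact (x '' Icc 0 U) := isCompact_Icc.image_of_continuousOn h.continuousOn_pos
  have h3 := eq_Icc_of_connected_compact h1 h2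
  set c := sInf (x '' Icc 0 U)
  set d := sSup (x '' Icc 0 U)
  have hcd : Icc c d ⊆ P.domain := by
    rw [← h3]; rintro _ ⟨u, hu, rfl⟩; exact h.mem_domain u hu
  have hle : c ≤ d := by
    rw [← nonempty_Icc, ← h3]; exact h1.nonempty
  obtain ⟨ε, hε, hc⟩ := Metric.isOpen_iff.1 P.isOpen_domain c (hcd ⟨le_rfl, hle⟩)
  obtain ⟨ε', hε', hd⟩ := Metric.isOpen_iff.1 P.isOpen_domain d (hcd ⟨hle, le_rfl⟩)
  obtain ⟨c', hc1, hc2⟩ := exists_rat_btwn (sub_lt_self c hε)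
  obtain ⟨d', hd1, hd2⟩ := exists_rat_btwn (lt_add_of_pos_right d hε')
  refine ⟨c', d', fun y hy => ?_, fun u hu => ?_⟩
  · rcases lt_or_ge y c with hy1 | hy1
    · apply hc; rw [Metric.mem_ball, Real.dist_eq, abs_lt]; constructor <;> linarith [hy.1]
    rcases lt_or_ge d y with hy2 | hy2
    · apply hd; rw [Metric.mem_ball, Real.dist_eq, abs_lt]; constructor <;> linarith [hy.2]
    · exact hcd ⟨hy1, hy2⟩
  · have : x u ∈ Icc c d := h3 ▸ mem_image_of_mem x hu
    exact ⟨by linarith [this.1], by linarith [this.2]⟩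

end IsOrbit

end RadialPotential

/-! ### Continuous flow and closed conditions on the momentum -/

lemma coe_projIcc_eq {c d : ℝ} (hcd : c ≤ d) {x : ℝ} (hx : x ∈ Icc c d) :
    (projIcc c d hcd x : ℝ) = x := by
  rw [projIcc_of_mem hcd hx]

lemma HasDerivWithinAt.prod_fst {y : ℝ → ℝ × ℝ} {y' : ℝ × ℝ} {s : Set ℝ} {t : ℝ}
    (h : HasDerivWithinAt y y' s t) : HasDerivWithinAt (fun t => (y t).1) y'.1 s t :=
  (ContinuousLinearMap.fst ℝ ℝ ℝ).hasFDerivAt.comp_hasDerivWithinAt t h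

lemma HasDerivWithinAt.prod_snd {y : ℝ → ℝ × ℝ} {y' : ℝ × ℝ} {s : Set ℝ} {t : ℝ}
    (h : HasDerivWithinAt y y' s t) : HasDerivWithinAt (fun t => (y t).2) y'.2 s t :=
  (ContinuousLinearMap.snd ℝ ℝ ℝ).hasFDerivAt.comp_hasDerivWithinAt t h

/-- Newton's equation `x'' = g x` with a bounded Lipschitz force has a continuous flow. -/
lemma exists_newton_flow {g : ℝ → ℝ} {C : NNReal} (hg : LipschitzWith C g) {F : ℝ}
    (hF : ∀ x, |g x| ≤ F) {R T : ℝ} (hR : 0 ≤ R) (hT : 0 ≤ T) :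
    ∃ Y : (ℝ × ℝ) × ℝ → ℝ × ℝ,
      (∀ y ∈ Metric.closedBall (0 : ℝ × ℝ) R, Y (y, 0) = y ∧
        ∀ t ∈ Icc 0 T, HasDerivWithinAt (fun t => Y (y, t)) ((Y (y, t)).2, g (Y (y, t)).1)
          (Icc 0 T) t) ∧
      ContinuousOn Y (Metric.closedBall 0 R ×ˢ Icc 0 T) := by
  have hF0 : 0 ≤ F := (abs_nonneg _).trans (hF 0)
  set R' := R + F * T with hR'
  have hR'0 : 0 ≤ R' := by positivity
  have hRR : -R' ≤ R' := by linarith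
  set M := max R' F with hM
  have hM0 : 0 ≤ M := hR'0.trans (le_max_left _ _)
  -- Picard–Lindelöf is used with a bounded field, so the velocity is clamped to [−R', R']. Up to
  -- time T the momentum grows by at most F T, hence stays below R' = R + F T and never feels the
  -- clamp.
  set v : ℝ × ℝ → ℝ × ℝ := fun y => ((projIcc (-R') R' hRR y.2 : ℝ), g y.1) with hv
  have hvL : LipschitzWith (max 1 C) v := by
    refine LipschitzWith.prodMk ?_ ?_
    · have := (LipschitzWith.subtype_val (Icc (-R') R')).comp
        ((LipschitzWith.projIcc hRR).comp (LipschitzWith.prod_snd (α := ℝ) (β := ℝ)))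
      rwa [mul_one, one_mul] at this
    · have := hg.comp (LipschitzWith.prod_fst (α := ℝ) (β := ℝ))
      rwa [mul_one] at this
  have hb : ∀ y, ‖v y‖ ≤ M := fun y => by
    rw [Prod.norm_def]
    refine max_le_max ?_ (hF _)
    have := (projIcc (-R') R' hRR y.2).2
    rw [Real.norm_eq_abs, abs_le]
    exact this
  have hpl : IsPicardLindelof (fun _ => v) (⟨0, le_rfl, hT⟩ : Icc (0 : ℝ) T) (0 : ℝ × ℝ)
      (⟨R + M * T, by positivity⟩ : NNReal) ⟨R, hR⟩ ⟨M, hM0⟩ (max 1 C) := by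
    refine IsPicardLindelof.of_time_independent (fun y _ => hb y) hvL.lipschitzOnWith ?_
    change M * max (T - 0) (0 - 0) ≤ R + M * T - R
    rw [sub_zero, sub_zero, max_eq_left hT]
    linarith
  obtain ⟨Y, hY, hYc⟩ :=
    hpl.exists_forall_mem_closedBall_eq_hasDerivWithinAt_continuousOn
  refine ⟨Y, fun y hy => ⟨(hY y hy).1, fun t ht => ?_⟩, hYc⟩
  have h2 := (hY y hy).2
  have hbound : |(Y (y, t)).2| ≤ R' := by
    have h3 := (convex_Icc 0 T).norm_image_sub_le_of_norm_hasDerivWithin_le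
      (f := fun t => (Y (y, t)).2) (f' := fun t => g (Y (y, t)).1) (C := F)
      (fun s hs => (h2 s hs).prod_snd) (fun s _ => hF _)
      (⟨le_rfl, hT⟩ : (0 : ℝ) ∈ Icc 0 T) ht
    have h4 : Y (y, 0) = y := (hY y hy).1
    rw [h4, sub_zero, Real.norm_eq_abs, Real.norm_eq_abs, abs_of_nonneg ht.1] at h3
    have h5 : |y.2| ≤ R := by
      have : ‖y‖ ≤ R := by simpa using hy
      exact (norm_snd_le y).trans this
    have h6 : F * t ≤ F * T := mul_le_mul_of_nonneg_left ht.2 hF0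
    rw [abs_le] at *
    constructor <;> linarith [h3.1, h3.2, h5.1, h5.2]
  refine (h2 t ht).congr_deriv ?_
  simp only [hv]
  rw [coe_projIcc_eq hRR (abs_le.1 hbound)]

namespace RadialPotential

variable {P : RadialPotential}

lemma conserved_of_newton {U L : ℝ} {x w : ℝ → ℝ}
    (hx : ∀ u ∈ Icc 0 U, HasDerivWithinAt x (w u) (Icc 0 U) u)
    (hw : ∀ u ∈ Icc 0 U, HasDerivWithinAt w (P.force (x u)) (Icc 0 U) u)
    (hD : ∀ u ∈ Icc 0 U, x u ∈ P.domain) (h0 : w 0 ^ 2 + L ^ 2 = P.energy (x 0)) :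
    P.IsOrbit L U x w := by
  refine ⟨hD, hx, hw, fun u hu => ?_⟩
  have key : ∀ u ∈ Icc 0 U, HasDerivWithinAt (fun u => w u ^ 2 - P.energy (x u)) 0 (Icc 0 U) u :=
    fun u hu => by
      have h1 := (hw u hu).pow 2
      have h2 := (P.hasDerivAt_energy _ (hD u hu)).comp_hasDerivWithinAt u (hx u hu)
      exact (h1.sub h2).congr_deriv (by simp; ring)
  have := (convex_Icc 0 U).norm_image_sub_le_of_norm_hasDerivWithin_le (C := 0) key (by simp)
    (⟨le_rfl, hu.1.trans hu.2⟩ : (0 : ℝ) ∈ Icc 0 U) hu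
  rw [zero_mul, norm_le_zero_iff] at this
  linarith

/-- The parameters for which a motion confined to a compact interval joins two prescribed states
form a closed set. -/
lemma isClosed_setOf_joins {c d : ℝ} (hD : Icc c d ⊆ P.domain) {K : Set ℝ} (hK : IsCompact K)
    {U : ℝ → ℝ} {y z : ℝ → ℝ × ℝ} (hU : ContinuousOn U K) (hU0 : ∀ L ∈ K, 0 ≤ U L)
    (hy : ContinuousOn y K) (hz : ContinuousOn z K)
    (hE : ∀ L ∈ K, (y L).2 ^ 2 + L ^ 2 = P.energy (y L).1) :
    IsClosed {L | L ∈ K ∧ ∃ x w, P.IsOrbit L (U L) x w ∧ (∀ u ∈ Icc 0 (U L), x u ∈ Icc c d) ∧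
      (x 0, w 0) = y L ∧ (x (U L), w (U L)) = z L} := by
  rcases lt_or_ge d c with hcd | hcd
  · convert isClosed_empty (X := ℝ)
    ext L
    simp only [mem_ofPred_eq, mem_empty_iff_false, iff_false, not_and]
    rintro hL ⟨x, w, -, h, -⟩
    have := h 0 ⟨le_rfl, hU0 L hL⟩
    rw [Icc_eq_empty (not_le.2 hcd)] at this
    exact this
  obtain ⟨C, hC⟩ := exists_lipschitzOnWith_force (P := P) (isCompact_Icc (a := c) (b := d)) hD
  obtain ⟨F, hF⟩ := isCompact_Icc.exists_bound_of_continuousOn (P.continuousOn_force.mono hD)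
  -- Clamping the position makes the force bounded and globally Lipschitz; motions confined to [c,
  -- d] do not notice it.
  set g : ℝ → ℝ := fun x => P.force (projIcc c d hcd x) with hgdef
  have hg : LipschitzWith C g := by
    have := (lipschitzOnWith_iff_restrict.1 hC).comp (LipschitzWith.projIcc hcd)
    rwa [mul_one] at this
  have hgF : ∀ x, |g x| ≤ F := fun x => hF _ (projIcc c d hcd x).2
  have hgf : ∀ x ∈ Icc c d, g x = P.force x := fun x hx => by
    simp only [hgdef]; rw [coe_projIcc_eq hcd hx]
  obtain ⟨R, hR⟩ := hK.exists_bound_of_continuousOn hy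
  obtain ⟨T, hT⟩ := hK.exists_bound_of_continuousOn hU
  obtain ⟨Y, hY, hYc⟩ := exists_newton_flow hg hgF (le_max_right R 0) (le_max_right T 0)
  have hUT : ∀ L ∈ K, U L ≤ max T 0 := fun L hL =>
    ((le_abs_self _).trans (hT L hL)).trans (le_max_left _ _)
  have hyR : ∀ L ∈ K, y L ∈ Metric.closedBall (0 : ℝ × ℝ) (max R 0) := fun L hL => by
    simpa using Or.inl (hR L hL)
  have hcont : ∀ s ∈ Icc (0 : ℝ) 1, ContinuousOn (fun L => Y (y L, s * U L)) K := fun s hs =>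
    hYc.comp (hy.prodMk (continuousOn_const.mul hU)) (fun L hL => ⟨hyR L hL,
      mul_nonneg hs.1 (hU0 L hL), (mul_le_of_le_one_left (hU0 L hL) hs.2).trans (hUT L hL)⟩)
  -- Rescaling time by s ∈ [0, 1] turns confinement into an intersection over a fixed index set of
  -- conditions closed in L.
  have hset : {L | L ∈ K ∧ ∃ x w, P.IsOrbit L (U L) x w ∧ (∀ u ∈ Icc 0 (U L), x u ∈ Icc c d) ∧
      (x 0, w 0) = y L ∧ (x (U L), w (U L)) = z L} =
      (⋂ s ∈ Icc (0 : ℝ) 1, K ∩ (fun L => Y (y L, s * U L)) ⁻¹' (Prod.fst ⁻¹' Icc c d)) ∩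
        (K ∩ (fun L => Y (y L, 1 * U L) - z L) ⁻¹' {0}) := by
    ext L
    simp only [mem_ofPred_eq, mem_inter_iff, mem_iInter, mem_preimage, mem_singleton_iff, one_mul,
      sub_eq_zero]
    constructor
    · rintro ⟨hL, x, w, ho, hcdx, h0, h1⟩
      have heq : ∀ u ∈ Icc 0 (U L), (x u, w u) = Y (y L, u) := by
        have hv : LipschitzWith (max 1 C) (fun y : ℝ × ℝ => (y.2, g y.1)) := by
          refine LipschitzWith.prodMk (LipschitzWith.prod_snd) ?_
          have := hg.comp (LipschitzWith.prod_fst (α := ℝ) (β := ℝ))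
          rwa [mul_one] at this
        have hsub : Icc 0 (U L) ⊆ Icc 0 (max T 0) := Icc_subset_Icc_right (hUT L hL)
        refine ODE_solution_unique (v := fun _ => fun y : ℝ × ℝ => (y.2, g y.1))
          (fun _ => hv) (ho.continuousOn_pos.prodMk ho.continuousOn_mom) (fun t ht => ?_)
          (fun t ht => ((hY _ (hyR L hL)).2 t (hsub ht)).continuousWithinAt.mono hsub)
          (fun t ht => ?_) ?_
        · rw [hgf _ (hcdx t (Ico_subset_Icc_self ht))]
          exact ho.hasDerivWithinAt_Ici ht
        · refine (((hY _ (hyR L hL)).2 t (hsub (Ico_subset_Icc_self ht))).mono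
            (Icc_subset_Icc_left ht.1)).mono_of_mem_nhdsWithin (Icc_mem_nhdsGE ?_)
          exact ht.2.trans_le (hUT L hL)
        · simp only [h0]; exact ((hY _ (hyR L hL)).1).symm
      refine ⟨fun s hs => ⟨hL, ?_⟩, hL, ?_⟩
      · have hm : s * U L ∈ Icc 0 (U L) :=
          ⟨mul_nonneg hs.1 (hU0 L hL), mul_le_of_le_one_left (hU0 L hL) hs.2⟩
        rw [← heq _ hm]
        exact hcdx _ hm
      · rw [← heq _ ⟨hU0 L hL, le_rfl⟩, h1]
    · rintro ⟨h1, hL, h2⟩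
      have hin : ∀ u ∈ Icc 0 (U L), (Y (y L, u)).1 ∈ Icc c d := fun u hu => by
        rcases (hU0 L hL).eq_or_lt with h0 | h0
        · have hu0 : u = 0 * U L := by rw [← h0] at hu ⊢; simpa using hu
          rw [hu0]
          exact (h1 0 ⟨le_rfl, zero_le_one⟩).2
        · have := (h1 (u / U L) ⟨div_nonneg hu.1 h0.le, (div_le_one h0).2 hu.2⟩).2
          rwa [div_mul_cancel₀ _ h0.ne'] at this
      have hsub : Icc 0 (U L) ⊆ Icc 0 (max T 0) := Icc_subset_Icc_right (hUT L hL)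
      refine ⟨hL, fun u => (Y (y L, u)).1, fun u => (Y (y L, u)).2,
        conserved_of_newton (fun u hu => ?_) (fun u hu => ?_) (fun u hu => hD (hin u hu)) ?_, hin,
        (hY _ (hyR L hL)).1, h2⟩
      · exact ((hY _ (hyR L hL)).2 u (hsub hu)).prod_fst.mono hsub
      · have := ((hY _ (hyR L hL)).2 u (hsub hu)).prod_snd.mono hsub
        rw [← hgf _ (hin u hu)]
        exact this
      · have h4 : Y (y L, 0) = y L := (hY _ (hyR L hL)).1
        simp only [h4]
        exact hE L hL
  rw [hset]
  refine IsClosed.inter (isClosed_biInter fun s hs => ?_) ?_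
  · exact (hcont s hs).preimage_isClosed_of_isClosed hK.isClosed
      (isClosed_Icc.preimage continuous_fst)
  · exact ((hcont 1 ⟨zero_le_one, le_rfl⟩).sub hz).preimage_isClosed_of_isClosed hK.isClosed
      isClosed_singleton

end RadialPotential

/-! ### Baire category: fans with uniform bounds -/

/-- A countable cover of a nonempty open subset of a Baire space is somewhere dense. -/
lemma exists_isOpen_subset_closure_of_subset_iUnion {X ι : Type*} [TopologicalSpace X]
    [BaireSpace X] [Countable ι] {W : Set X} (hW : IsOpen W) (hne : W.Nonempty) {S : ι → Set X}
    (hS : W ⊆ ⋃ i, S i) :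
    ∃ i, ∃ V, IsOpen V ∧ V.Nonempty ∧ V ⊆ W ∧ V ⊆ closure (S i) := by
  -- The complement of W joins the family so that the closed sets cover the whole space.
  set f : Option ι → Set X := fun o => o.elim Wᶜ (fun i => closure (S i)) with hf
  have hd : Dense (⋃ o, interior (f o)) := by
    refine dense_iUnion_interior_of_closed (fun o => ?_) ?_
    · cases o
      exacts [hW.isClosed_compl, isClosed_closure]
    · refine eq_univ_of_forall fun z => mem_iUnion.2 ?_
      by_cases hz : z ∈ W
      · obtain ⟨i, hi⟩ := mem_iUnion.1 (hS hz)
        exact ⟨some i, subset_closure hi⟩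
      · exact ⟨none, hz⟩
  obtain ⟨z, hzW, hz⟩ := hd.inter_open_nonempty W hW hne
  obtain ⟨o, ho⟩ := mem_iUnion.1 hz
  cases o with
  | none => exact absurd hzW (interior_subset ho)
  | some i => exact ⟨i, W ∩ interior (closure (S i)), hW.inter isOpen_interior, ⟨z, hzW, ho⟩,
      inter_subset_left, inter_subset_right.trans interior_subset⟩

lemma exists_sq_eq_one_mul_pos {w : ℝ} (hw : w ≠ 0) : ∃ τ : ℚ, (τ : ℝ) ^ 2 = 1 ∧ 0 < τ * w := by
  rcases hw.lt_or_gt with h | h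
  · exact ⟨-1, by norm_num, by push_cast; linarith⟩
  · exact ⟨1, by norm_num, by push_cast; linarith⟩

namespace RadialPotential

variable {P : RadialPotential}

/-- The motions leaving `a` in one radial direction, with angular momenta from some interval, reach
`b` after turning about the centre by the angle `θ` (modulo full turns). -/
def FanJoined (P : RadialPotential) (a b θ : ℝ) : Prop :=
  ∃ L₁ L₂ σ : ℝ, 0 < L₁ ∧ L₁ < L₂ ∧ σ ^ 2 = 1 ∧ ∀ L ∈ Ioo L₁ L₂, ∃ U x w, 0 < U ∧
    P.IsOrbit L U x w ∧ x 0 = a ∧ 0 < σ * w 0 ∧ x U = b ∧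
    ∃ j : ℤ, L * U = θ + 2 * Real.pi * j

/-- A fan of motions from `a` to `b` sweeping the angle `Θ`, with bounds that are uniform over the
fan. -/
structure IsFan (P : RadialPotential) (c d L₁ L₂ T₁ T₂ δ σ τ a b Θ : ℝ) : Prop where
  subset_domain : Icc c d ⊆ P.domain
  L_pos : 0 < L₁
  L_lt : L₁ < L₂
  T_pos : 0 < T₁
  δ_pos : 0 < δ
  σ_sq : σ ^ 2 = 1
  τ_sq : τ ^ 2 = 1
  -- Transit times of two fans with these bounds differ by at most (T₂ − T₁)/L₁ for each L. In that
  -- time the momentum changes by at most δ/4, too little to turn a motion whose momentum is at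
  -- least δ.
  force_le : ∀ y ∈ Icc c d, |P.force y| * ((T₂ - T₁) / L₁) ≤ δ / 4
  le_start : δ ^ 2 ≤ P.energy a - L₂ ^ 2
  le_end : δ ^ 2 ≤ P.energy b - L₂ ^ 2
  mem_Icc : Θ ∈ Icc T₁ T₂
  exists_orbit : ∀ L ∈ Icc L₁ L₂, ∃ x w, P.IsOrbit L (Θ / L) x w ∧
    (∀ u ∈ Icc 0 (Θ / L), x u ∈ Icc c d) ∧ x 0 = a ∧ w 0 = σ * √(P.energy a - L ^ 2) ∧
    x (Θ / L) = b ∧ w (Θ / L) = τ * √(P.energy b - L ^ 2)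

lemma IsOrbit.mom_eq {L U : ℝ} {x w : ℝ → ℝ} (h : P.IsOrbit L U x w) {u : ℝ} (hu : u ∈ Icc 0 U)
    {τ : ℝ} (hτ : τ ^ 2 = 1) (hw : 0 ≤ τ * w u) : w u = τ * √(P.energy (x u) - L ^ 2) := by
  rw [← h.conserved u hu, show w u ^ 2 + L ^ 2 - L ^ 2 = (τ * w u) ^ 2 by
      rw [mul_pow, hτ]; ring, Real.sqrt_sq hw, ← mul_assoc, ← sq, hτ, one_mul]

/-- Baire's theorem in L: the momenta sharing a window, a number of turns and an exit direction form
a closed set, and countably many such sets cover an interval. One of them contains an interval, on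
which Θ is constant. All bounds are rational, so that fans fall into countably many classes. -/
lemma FanJoined.exists_isFan {a b θ : ℝ} (h : P.FanJoined a b θ) :
    ∃ c d L₁ L₂ T₁ T₂ δ σ τ : ℚ, ∃ j : ℤ,
      P.IsFan c d L₁ L₂ T₁ T₂ δ σ τ a b (θ + 2 * Real.pi * j) := by
  obtain ⟨L₁, L₂, σ', hL₁, hL₁₂, hσ', H⟩ := h
  obtain ⟨σ, hσ⟩ : ∃ σ : ℚ, (σ : ℝ) = σ' := by
    rcases mul_self_eq_one_iff.1 ((sq σ').symm.trans hσ') with h | h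
    exacts [⟨1, by simp [h]⟩, ⟨-1, by simp [h]⟩]
  subst hσ
  -- L₁ < L₃ < L₄ < L₅ < L₂. The fan is kept inside [L₃, L₄]; the motion with the larger momentum L₅
  -- shows that E is at least L₅² at a and b, which leaves the gap δ.
  obtain ⟨L₄, h41, h42⟩ := exists_between hL₁₂
  obtain ⟨L₅, h51, h52⟩ := exists_between h42
  obtain ⟨L₃, h31, h34⟩ := exists_between h41
  have hEa : ∀ L ∈ Icc L₃ L₅, L ^ 2 < P.energy a := fun L hL => by
    obtain ⟨U, x, w, hU, ho, hx0, hw0, -⟩ := H L ⟨h31.trans_le hL.1, hL.2.trans_lt h52⟩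
    have := ho.conserved 0 ⟨le_rfl, hU.le⟩
    have hw : w 0 ≠ 0 := fun h0 => by simp [h0] at hw0
    rw [hx0] at this
    have := sq_pos_of_ne_zero hw
    linarith
  have hEb : L₅ ^ 2 ≤ P.energy b := by
    obtain ⟨U, x, w, hU, ho, -, -, hxU, -⟩ := H L₅ ⟨h41.trans h51, h52⟩
    have := ho.conserved U ⟨hU.le, le_rfl⟩
    rw [hxU] at this
    nlinarith [sq_nonneg (w U)]
  have h3pos : 0 < L₃ := hL₁.trans h31
  have hgap : 0 < L₅ ^ 2 - L₄ ^ 2 := by nlinarith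
  obtain ⟨δ, hδ0, hδ⟩ : ∃ δ : ℚ, (0 : ℝ) < δ ∧ (δ : ℝ) ^ 2 ≤ L₅ ^ 2 - L₄ ^ 2 := by
    obtain ⟨δ, h1, h2⟩ := exists_rat_btwn (Real.sqrt_pos.2 hgap)
    exact ⟨δ, h1, by rw [← Real.sq_sqrt hgap.le]; gcongr⟩
  -- The index consists of the window, the number of turns and the exit direction. The side
  -- conditions are built in, so that a bad index gives the empty, hence closed, set.
  set S : ℚ × ℚ × ℤ × ℚ → Set ℝ := fun i => {L | (Icc (i.1 : ℝ) i.2.1 ⊆ P.domain ∧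
    0 < θ + 2 * Real.pi * i.2.2.1 ∧ (i.2.2.2 : ℝ) ^ 2 = 1) ∧ L ∈ Icc L₃ L₄ ∧ ∃ x w,
    P.IsOrbit L ((θ + 2 * Real.pi * i.2.2.1) / L) x w ∧
    (∀ u ∈ Icc 0 ((θ + 2 * Real.pi * i.2.2.1) / L), x u ∈ Icc (i.1 : ℝ) i.2.1) ∧
    (x 0, w 0) = (a, σ * √(P.energy a - L ^ 2)) ∧
    (x ((θ + 2 * Real.pi * i.2.2.1) / L), w ((θ + 2 * Real.pi * i.2.2.1) / L)) =
      (b, i.2.2.2 * √(P.energy b - L ^ 2))} with hSdef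
  have hSclosed : ∀ i, IsClosed (S i) := fun i => by
    by_cases hi : Icc (i.1 : ℝ) i.2.1 ⊆ P.domain ∧
      0 < θ + 2 * Real.pi * i.2.2.1 ∧ (i.2.2.2 : ℝ) ^ 2 = 1
    · simp only [hSdef, hi, and_self, true_and]
      refine isClosed_setOf_joins (c := i.1) (d := i.2.1) hi.1 isCompact_Icc
        (U := fun L => (θ + 2 * Real.pi * i.2.2.1) / L)
        (y := fun L => (a, σ * √(P.energy a - L ^ 2)))
        (z := fun L => (b, i.2.2.2 * √(P.energy b - L ^ 2)))
        ?_ (fun L hL => (div_pos hi.2.1 (h3pos.trans_le hL.1)).le) ?_ ?_ ?_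
      · exact continuousOn_const.div continuousOn_id fun L hL => (h3pos.trans_le hL.1).ne'
      · fun_prop
      · fun_prop
      · intro L hL
        simp only
        rw [mul_pow, hσ', Real.sq_sqrt (sub_nonneg.2 (hEa L ⟨hL.1, hL.2.trans h51.le⟩).le)]
        ring
    · simp only [hSdef, hi, false_and, ofPred_false, isClosed_empty]
  have hcov : Ioo L₃ L₄ ⊆ ⋃ i, S i := fun L hL => by
    obtain ⟨U, x, w, hU, ho, hx0, hw0, hxU, j, hj⟩ :=
      H L ⟨h31.trans hL.1, hL.2.trans h42⟩
    obtain ⟨c, d, hcd, hx⟩ := ho.exists_Icc hU.le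
    have hL0 : 0 < L := h3pos.trans hL.1
    have hwU : w U ≠ 0 := fun h0 => by
      have := ho.conserved U ⟨hU.le, le_rfl⟩
      rw [hxU, h0] at this
      nlinarith [hL.2]
    obtain ⟨τ, hτ, hτw⟩ := exists_sq_eq_one_mul_pos hwU
    have hUL : (θ + 2 * Real.pi * j) / L = U := by rw [← hj]; field_simp
    refine mem_iUnion.2 ⟨(c, d, j, τ), ⟨hcd, ?_, hτ⟩, ⟨hL.1.le, hL.2.le⟩, x, w, ?_⟩
    · simp only; rw [← hj]; positivity
    · simp only [hUL]
      refine ⟨ho, hx, ?_, ?_⟩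
      · rw [hx0, ho.mom_eq ⟨le_rfl, hU.le⟩ hσ' hw0.le, hx0]
      · rw [hxU, ho.mom_eq ⟨hU.le, le_rfl⟩ hτ hτw.le, hxU]
  obtain ⟨⟨c, d, j, τ⟩, V, hVo, ⟨L, hLV⟩, hVW, hVS⟩ :=
    exists_isOpen_subset_closure_of_subset_iUnion isOpen_Ioo (nonempty_Ioo.2 h34) hcov
  rw [(hSclosed _).closure_eq] at hVS
  obtain ⟨ε, hε, hball⟩ := Metric.isOpen_iff.1 hVo L hLV
  obtain ⟨M₁, hM1, hM1'⟩ := exists_rat_btwn (sub_lt_self L hε)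
  obtain ⟨M₂, hM2, hM2'⟩ := exists_rat_btwn (lt_add_of_pos_right L hε)
  have hM : Icc (M₁ : ℝ) M₂ ⊆ V := fun y hy => hball (by
    rw [Metric.mem_ball, Real.dist_eq, abs_lt]
    constructor <;> linarith [hy.1, hy.2])
  obtain ⟨⟨hcd, hΘ, hτ⟩, -⟩ := hVS hLV
  simp only at hcd hΘ hτ
  obtain ⟨F, hF⟩ := isCompact_Icc.exists_bound_of_continuousOn (P.continuousOn_force.mono hcd)
  have hM12 : (M₁ : ℝ) < M₂ := hM1'.trans hM2
  have hM1m := hVW (hM ⟨le_rfl, hM12.le⟩)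
  have hM2m := hVW (hM ⟨hM12.le, le_rfl⟩)
  have hM10 : (0 : ℝ) < M₁ := h3pos.trans hM1m.1
  set Θ := θ + 2 * Real.pi * j
  -- Chosen so that (|F| + 1) · 2η / M₁ = δ/4, with 2η bounding T₂ − T₁.
  set η := δ * M₁ / (8 * (|F| + 1)) with hη
  have hη0 : 0 < η := by positivity
  obtain ⟨T₁, hT1, hT1'⟩ := exists_rat_btwn (show max 0 (Θ - η) < Θ from
    max_lt hΘ (by linarith))
  obtain ⟨T₂, hT2, hT2'⟩ := exists_rat_btwn (show Θ < Θ + η by linarith)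
  have hsq : (M₂ : ℝ) ^ 2 ≤ L₄ ^ 2 := by
    have := hM2m.2
    have : (0 : ℝ) < M₂ := hM10.trans hM12
    gcongr
  refine ⟨c, d, M₁, M₂, T₁, T₂, δ, σ, τ, j, ⟨hcd, hM10, hM12, (le_max_left _ _).trans_lt hT1, hδ0,
    hσ', hτ, fun y hy => ?_, ?_, ?_, ⟨hT1'.le, hT2.le⟩, fun L hL => ?_⟩⟩
  · have h1 : |P.force y| ≤ |F| + 1 := ((hF y hy).trans (le_abs_self F)).trans (by linarith)
    have h2 : (T₂ : ℝ) - T₁ ≤ 2 * η := by linarith [(le_max_right 0 (Θ - η)).trans_lt hT1]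
    have h3 : (0 : ℝ) ≤ T₂ - T₁ := by linarith
    calc |P.force y| * ((T₂ - T₁) / M₁) ≤ (|F| + 1) * (2 * η / M₁) := by gcongr
      _ = δ / 4 := by rw [hη]; field_simp; ring
  · linarith [hEa L₅ ⟨(h34.trans h51).le, le_rfl⟩]
  · linarith
  · obtain ⟨-, -, x, w, ho, hx, h0, h1⟩ := hVS (hM hL)
    simp only [Prod.mk.injEq] at h0 h1
    exact ⟨x, w, ho, hx, h0.1, h0.2, h1.1, h1.2⟩

end RadialPotential

/-! ### Comparison of neighbouring fans -/

lemma abs_eq_one_of_sq_eq_one {σ : ℝ} (h : σ ^ 2 = 1) : |σ| = 1 :=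
  (pow_eq_one_iff_of_nonneg (abs_nonneg σ) two_ne_zero).1 (by rw [sq_abs, h])

namespace RadialPotential

variable {P : RadialPotential}

lemma IsOrbit.exists_reach {L U : ℝ} {x w : ℝ → ℝ} (h : P.IsOrbit L U x w) {ρ δ σ a' : ℝ}
    (hρ0 : 0 ≤ ρ) (hρ : ρ ≤ U) (hσ : σ ^ 2 = 1) (hw : ∀ u ∈ Icc 0 ρ, δ ≤ σ * w u)
    (h0 : 0 ≤ σ * (a' - x 0)) (h1 : σ * (a' - x 0) ≤ δ * ρ) : ∃ u ∈ Icc 0 ρ, x u = a' := by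
  have h' := h.restrict hρ
  have hgrow : δ * (ρ - 0) ≤ σ * x ρ - σ * x 0 := by
    refine (convex_Icc 0 ρ).mul_sub_le_image_sub_of_le_deriv (f := fun u => σ * x u)
      (continuousOn_const.mul h'.continuousOn_pos) ?_ ?_ 0 ⟨le_rfl, hρ0⟩ ρ ⟨hρ0, le_rfl⟩ hρ0
    · rw [interior_Icc]
      exact fun u hu => ((h'.hasDerivAt_pos hu).const_mul σ).differentiableAt.differentiableWithinAt
    · rw [interior_Icc]
      intro u hu
      rw [((h'.hasDerivAt_pos hu).const_mul σ).deriv]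
      exact hw u (Ioo_subset_Icc_self hu)
  obtain ⟨u, hu, hux⟩ := intermediate_value_Icc hρ0
    (f := fun u => σ * x u) (continuousOn_const.mul h'.continuousOn_pos)
    (show σ * a' ∈ Icc (σ * x 0) (σ * x ρ) by constructor <;> nlinarith)
  refine ⟨u, hu, mul_left_cancel₀ (fun hs => ?_) hux⟩
  simp [hs] at hσ

lemma IsOrbit.le_mul_mom {L U : ℝ} {x w : ℝ → ℝ} (h : P.IsOrbit L U x w) {C δ σ s : ℝ}
    (hC : ∀ u ∈ Icc 0 U, |P.force (x u)| ≤ C) (hσ : σ ^ 2 = 1) (hs : s ∈ Icc 0 U)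
    (hw : δ ≤ σ * w s) {u : ℝ} (hu : u ∈ Icc 0 U) (hsu : C * |u - s| ≤ δ / 2) :
    δ / 2 ≤ σ * w u := by
  have h1 := (h.abs_mom_sub_le hC hs hu).trans hsu
  have h2 : |σ * w u - σ * w s| ≤ δ / 2 := by
    rw [← mul_sub, abs_mul, abs_eq_one_of_sq_eq_one hσ, one_mul]
    exact h1
  linarith [(abs_le.1 h2).1]

variable {c d L₁ L₂ T₁ T₂ δ σ τ a b Θ a' b' Θ' : ℝ}

lemma IsFan.le_sqrt_start (h : P.IsFan c d L₁ L₂ T₁ T₂ δ σ τ a b Θ) {L : ℝ}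
    (hL : L ∈ Icc L₁ L₂) : δ ≤ √(P.energy a - L ^ 2) := by
  apply Real.le_sqrt_of_sq_le
  have h1 := h.le_start
  have h2 := h.L_pos
  nlinarith [hL.1, hL.2]

lemma IsFan.le_sqrt_end (h : P.IsFan c d L₁ L₂ T₁ T₂ δ σ τ a b Θ) {L : ℝ}
    (hL : L ∈ Icc L₁ L₂) : δ ≤ √(P.energy b - L ^ 2) := by
  apply Real.le_sqrt_of_sq_le
  have h1 := h.le_end
  have h2 := h.L_pos
  nlinarith [hL.1, hL.2]

/-- Comparison of two fans with the same bounds, the second object point lying ahead of the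
first one. -/
lemma IsFan.angle_sub_of_le (h : P.IsFan c d L₁ L₂ T₁ T₂ δ σ τ a b Θ)
    (h' : P.IsFan c d L₁ L₂ T₁ T₂ δ σ τ a' b' Θ') {C ρ : ℝ}
    (hC : ∀ y ∈ Icc c d, |P.force y| ≤ C) (hCT : C * ((T₂ - T₁) / L₁) ≤ δ / 4)
    (hρ0 : 0 ≤ ρ) (hρ : ρ ≤ T₁ / L₂) (hCρ : C * ρ ≤ δ / 4)
    (h0 : 0 ≤ σ * (a' - a)) (h1 : σ * (a' - a) ≤ δ / 2 * ρ) {L : ℝ} (hL : L ∈ Icc L₁ L₂) :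
    Θ' - Θ = L * (τ * (∫ y in b..b', (√(P.energy y - L ^ 2))⁻¹)
      - σ * ∫ y in a..a', (√(P.energy y - L ^ 2))⁻¹) := by
  obtain ⟨x, w, ho, hcd, hx0, hw0, hxU, hwU⟩ := h.exists_orbit L hL
  obtain ⟨x', w', ho', hcd', hx0', hw0', hxU', hwU'⟩ := h'.exists_orbit L hL
  have hL0 : 0 < L := h.L_pos.trans_le hL.1
  have hσ := h.σ_sq
  have hτ := h.τ_sq
  have hδ := h.δ_pos
  have hστ : ∀ {ε : ℝ}, ε ^ 2 = 1 → ∀ r : ℝ, ε * (ε * r) = r := fun hε r => by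
    rw [← mul_assoc, ← sq, hε, one_mul]
  set U := Θ / L with hU
  set U' := Θ' / L with hU'
  have hC0 : 0 ≤ C := (abs_nonneg _).trans (hC (x 0) (hcd 0 ⟨le_rfl, by
    have := h.T_pos.trans_le h.mem_Icc.1; positivity⟩))
  have hLU : ∀ {t : ℝ}, t ∈ Icc T₁ T₂ → T₁ / L₂ ≤ t / L := fun {t} ht => by
    have := h.T_pos
    have := ht.1
    have := hL.2
    gcongr
    linarith
  have hdiff : ∀ {t t' : ℝ}, t ∈ Icc T₁ T₂ → t' ∈ Icc T₁ T₂ → C * (t / L - t' / L) ≤ δ / 4 :=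
    fun {t t'} ht ht' => by
      refine le_trans ?_ hCT
      rw [← sub_div]
      have : t - t' ≤ T₂ - T₁ := by linarith [ht.2, ht'.1]
      have h3 : 0 ≤ T₂ - T₁ := by linarith [ht.1, ht.2]
      have := h.L_pos
      gcongr
      exact hL.1
  have hρU : ρ ≤ U := hρ.trans (hLU h.mem_Icc)
  have hρU' : ρ ≤ U' := hρ.trans (hLU h'.mem_Icc)
  have hU0 : 0 ≤ U := hρ0.trans hρU
  have hU0' : 0 ≤ U' := hρ0.trans hρU'
  have hCo : ∀ u ∈ Icc 0 U, |P.force (x u)| ≤ C := fun u hu => hC _ (hcd u hu)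
  have hCo' : ∀ u ∈ Icc 0 U', |P.force (x' u)| ≤ C := fun u hu => hC _ (hcd' u hu)
  have hstart : ∀ u ∈ Icc 0 ρ, δ / 2 ≤ σ * w u := fun u hu => by
    refine ho.le_mul_mom hCo hσ ⟨le_rfl, hU0⟩ ?_ ⟨hu.1, hu.2.trans hρU⟩ ?_
    · rw [hw0, hστ hσ]; exact h.le_sqrt_start hL
    · rw [sub_zero, abs_of_nonneg hu.1]
      have := mul_le_mul_of_nonneg_left hu.2 hC0
      linarith
  -- The first motion passes a' at time s. There it has the position and, by conservation and equal
  -- direction, the momentum of the second motion, so the two coincide from then on.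
  obtain ⟨s, hs, hxs⟩ := ho.exists_reach hρ0 hρU hσ hstart (by rwa [hx0]) (by rwa [hx0])
  have hsU : s ≤ U := hs.2.trans hρU
  have hCs : C * s ≤ δ / 4 := (mul_le_mul_of_nonneg_left hs.2 hC0).trans hCρ
  have hts : s = σ * ∫ y in a..a', (√(P.energy y - L ^ 2))⁻¹ := by
    have := (ho.restrict hsU).time_eq hs.1 hσ fun u hu => by
      linarith [hstart u ⟨hu.1, hu.2.trans hs.2⟩]
    rwa [hx0, hxs] at this
  have hws : w s = w' 0 := by
    rw [ho.mom_eq ⟨hs.1, hsU⟩ hσ (by linarith [hstart s hs]), hxs, hw0']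
  -- The second motion, delayed by s, ends after or before the first. Either way the excess is too
  -- short for a turning point, and it is the transit time between b and b' in the direction τ.
  have hdouble : U' - U = τ * (∫ y in b..b', (√(P.energy y - L ^ 2))⁻¹) - s := by
    rcases le_total (U - s) U' with hc | hc
    · have heq := (ho.sub (s := s) (V := U - s) hs.1 (by linarith)).eqOn (ho'.restrict hc)
        (by simp only [add_zero]; rw [hxs, hx0']) (by simpa using hws) (U - s)
        ⟨by linarith, le_rfl⟩
      simp only [add_sub_cancel] at heq
      have hend : ∀ u ∈ Icc (U - s) U', δ / 2 ≤ τ * w' u := fun u hu => by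
        refine ho'.le_mul_mom hCo' hτ (s := U - s) ⟨by linarith, hc⟩ ?_
          ⟨by linarith [hu.1], hu.2⟩ ?_
        · rw [← heq.2, hwU, hστ hτ]; exact h.le_sqrt_end hL
        · rw [abs_of_nonneg (by linarith [hu.1])]
          have h5 := hdiff h'.mem_Icc h.mem_Icc
          have : C * (u - (U - s)) ≤ C * (U' - U) + C * s := by
            rw [← mul_add]; apply mul_le_mul_of_nonneg_left _ hC0; linarith [hu.2]
          linarith
      have := (ho'.sub (s := U - s) (V := U' - (U - s)) (by linarith) (by linarith)).time_eq
        (by linarith) hτ fun u hu => by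
          linarith [hend (U - s + u) ⟨by linarith [hu.1], by linarith [hu.2]⟩]
      simp only [add_zero, add_sub_cancel] at this
      rw [← heq.1, hxU, hxU'] at this
      linarith
    · have heq := (ho.sub (s := s) (V := U') hs.1 (by linarith)).eqOn ho'
        (by simp only [add_zero]; rw [hxs, hx0']) (by simpa using hws) U' ⟨hU0', le_rfl⟩
      have hend : ∀ u ∈ Icc (s + U') U, δ / 2 ≤ τ * w u := fun u hu => by
        refine ho.le_mul_mom hCo hτ (s := s + U') ⟨by linarith [hs.1], by linarith⟩ ?_
          ⟨by linarith [hu.1, hs.1], hu.2⟩ ?_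
        · rw [heq.2, hwU', hστ hτ]; exact h'.le_sqrt_end hL
        · rw [abs_of_nonneg (by linarith [hu.1])]
          have h5 := hdiff h.mem_Icc h'.mem_Icc
          have : C * (u - (s + U')) ≤ C * (U - U') := by
            apply mul_le_mul_of_nonneg_left _ hC0; linarith [hu.2, hs.1]
          linarith
      have := (ho.sub (s := s + U') (V := U - (s + U')) (by linarith [hs.1]) (by linarith)).time_eq
        (by linarith) hτ fun u hu => by
          linarith [hend (s + U' + u) ⟨by linarith [hu.1], by linarith [hu.2]⟩]
      simp only [add_zero, add_sub_cancel] at this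
      rw [heq.1, hxU, hxU', intervalIntegral.integral_symm] at this
      linarith
  rw [← hts, ← hdouble, hU, hU']
  field_simp

/-- Comparison of two fans with the same bounds. -/
lemma IsFan.exists_angle_sub (h : P.IsFan c d L₁ L₂ T₁ T₂ δ σ τ a b Θ) :
    ∃ η > 0, ∀ a' b' Θ', P.IsFan c d L₁ L₂ T₁ T₂ δ σ τ a' b' Θ' → |a' - a| < η →
      ∀ L ∈ Icc L₁ L₂, Θ' - Θ = L * (τ * (∫ y in b..b', (√(P.energy y - L ^ 2))⁻¹)
        - σ * ∫ y in a..a', (√(P.energy y - L ^ 2))⁻¹) := by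
  have hL1 := h.L_pos
  have hL2 := h.L_pos.trans h.L_lt
  have hT := h.T_pos
  have hδ := h.δ_pos
  obtain ⟨F, hF⟩ := isCompact_Icc.exists_bound_of_continuousOn
    (P.continuousOn_force.mono h.subset_domain)
  -- If T₁ < T₂ the largest C allowed by the smallness condition bounds the force; if T₁ = T₂ that
  -- condition is void and any bound will do.
  have hex : ∃ C, 0 ≤ C ∧ (∀ y ∈ Icc c d, |P.force y| ≤ C) ∧
      C * ((T₂ - T₁) / L₁) ≤ δ / 4 := by
    rcases (h.mem_Icc.1.trans h.mem_Icc.2).eq_or_lt with he | hlt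
    · exact ⟨|F|, abs_nonneg _, fun y hy => (hF y hy).trans (le_abs_self _), by
        rw [he]; simp; positivity⟩
    · have h3 : 0 < (T₂ - T₁) / L₁ := div_pos (sub_pos.2 hlt) hL1
      refine ⟨δ / 4 / ((T₂ - T₁) / L₁), by positivity, fun y hy => ?_, ?_⟩
      · rw [le_div_iff₀ h3]; exact h.force_le y hy
      · rw [div_mul_cancel₀ _ h3.ne']
  obtain ⟨C, hC0, hC, hCT⟩ := hex
  set ρ := min (T₁ / L₂) (δ / (4 * (C + 1))) with hρ
  have hρ0 : 0 < ρ := lt_min (by positivity) (by positivity)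
  have hCρ : C * ρ ≤ δ / 4 := calc
    C * ρ ≤ (C + 1) * (δ / (4 * (C + 1))) := by
      gcongr
      · linarith
      · exact min_le_right _ _
    _ = δ / 4 := by field_simp
  refine ⟨δ / 2 * ρ, by positivity, fun a' b' Θ' h' hη L hL => ?_⟩
  have hab : |σ * (a' - a)| = |a' - a| := by
    rw [abs_mul, abs_eq_one_of_sq_eq_one h.σ_sq, one_mul]
  rw [← hab] at hη
  -- If a' lies behind a, the two fans exchange roles.
  rcases le_total 0 (σ * (a' - a)) with h0 | h0
  · exact h.angle_sub_of_le h' hC hCT hρ0.le (min_le_left _ _) hCρ h0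
      ((le_abs_self _).trans hη.le) hL
  · have := h'.angle_sub_of_le h hC hCT hρ0.le (min_le_left _ _) hCρ (by linarith)
      (by linarith [neg_abs_le (σ * (a' - a))]) hL
    rw [intervalIntegral.integral_symm b b', intervalIntegral.integral_symm a a'] at this
    linarith

end RadialPotential

/-! ### Rigidity of images -/

/-- Rigidity of the elementary angle functions `L ↦ L / √(A - L ^ 2)`. -/
lemma eq_of_sub_eq_const {A B α β e L₁ L₂ : ℝ} (h1 : 0 < L₁) (h12 : L₁ < L₂) (hA : L₂ ^ 2 < A)
    (hB : L₂ ^ 2 < B)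
    (h : ∀ L ∈ Icc L₁ L₂, L * (β * (√(B - L ^ 2))⁻¹ - α * (√(A - L ^ 2))⁻¹) = e) :
    β = α ∧ (α ≠ 0 → A = B) := by
  have hlt : ∀ {K L : ℝ}, L₂ ^ 2 < K → L ∈ Ioo L₁ L₂ → 0 < K - L ^ 2 := fun {K L} hK hL => by
    have : L ^ 2 ≤ L₂ ^ 2 := pow_le_pow_left₀ (h1.trans hL.1).le hL.2.le 2
    linarith
  have hd : ∀ {K L : ℝ}, L₂ ^ 2 < K → L ∈ Ioo L₁ L₂ →
      HasDerivAt (fun L => L * (√(K - L ^ 2))⁻¹) (K * (√(K - L ^ 2))⁻¹ ^ 3) L :=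
    fun {K L} hK hL => by
      have h0 := hlt hK hL
      have hs : 0 < √(K - L ^ 2) := Real.sqrt_pos.2 h0
      have e1 : HasDerivAt (fun L : ℝ => K - L ^ 2) (-(2 * L)) L := by
        simpa using ((hasDerivAt_pow 2 L).const_sub K)
      have e2 := (e1.sqrt h0.ne').inv hs.ne'
      refine ((hasDerivAt_id L).mul e2).congr_deriv ?_
      have hsq : √(K - L ^ 2) ^ 2 = K - L ^ 2 := Real.sq_sqrt h0.le
      simp only [id, Pi.inv_apply]
      field_simp
      rw [hsq]
      ring
  have hder : ∀ L ∈ Ioo L₁ L₂, β * (B * (√(B - L ^ 2))⁻¹ ^ 3) = α * (A * (√(A - L ^ 2))⁻¹ ^ 3) :=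
    fun L hL => by
      have e1 := ((hd hB hL).const_mul β).sub ((hd hA hL).const_mul α)
      have e2 : HasDerivAt (fun _ : ℝ => e) 0 L := hasDerivAt_const L e
      have e3 := e1.congr_of_eventuallyEq (show (fun _ : ℝ => e) =ᶠ[nhds L] _ by
        filter_upwards [Ioo_mem_nhds hL.1 hL.2] with y hy
        rw [← h y ⟨hy.1.le, hy.2.le⟩]
        simp only [Pi.sub_apply]
        ring)
      linarith [e3.unique e2]
  have hA0 : 0 < A := (sq_nonneg L₂).trans_lt hA
  have hB0 : 0 < B := (sq_nonneg L₂).trans_lt hB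
  obtain ⟨M, hM1, hM2⟩ := exists_between h12
  obtain ⟨M', hM1', hM2'⟩ := exists_between hM2
  have hsM : ∀ {K L : ℝ}, L₂ ^ 2 < K → L ∈ Ioo L₁ L₂ → 0 < (√(K - L ^ 2))⁻¹ := fun hK hL =>
    inv_pos.2 (Real.sqrt_pos.2 (hlt hK hL))
  have hm : M ∈ Ioo L₁ L₂ := ⟨hM1, hM2⟩
  have hm' : M' ∈ Ioo L₁ L₂ := ⟨hM1.trans hM1', hM2'⟩
  have hAB : α ≠ 0 → A = B := fun hα => by
    have e1 := hder M hm
    have e2 := hder M' hm'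
    have p1 := hsM hA hm
    have p2 := hsM hB hm
    have p3 := hsM hA hm'
    have p4 := hsM hB hm'
    have hβ : β ≠ 0 := by
      rintro rfl
      rw [zero_mul] at e1
      have : α * (A * (√(A - M ^ 2))⁻¹ ^ 3) ≠ 0 := by positivity
      exact this e1.symm
    -- The differentiated relation at two momenta M, M' eliminates α and β, leaving (B − M²)(A −
    -- M'²) = (B − M'²)(A − M²) after cube roots and squares.
    have e3 : (√(B - M ^ 2))⁻¹ ^ 3 * (√(A - M' ^ 2))⁻¹ ^ 3 =
        (√(B - M' ^ 2))⁻¹ ^ 3 * (√(A - M ^ 2))⁻¹ ^ 3 := by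
      have hne : α * A * (β * B) ≠ 0 := by positivity
      apply mul_left_cancel₀ hne
      linear_combination (α * A * (√(A - M' ^ 2))⁻¹ ^ 3) * e1 -
        (α * A * (√(A - M ^ 2))⁻¹ ^ 3) * e2
    rw [← mul_pow, ← mul_pow] at e3
    have e4 := (pow_left_inj₀ (by positivity) (by positivity) (by norm_num)).1 e3
    rw [← mul_inv, ← mul_inv, inv_inj, ← Real.sqrt_mul (hlt hB hm).le,
      ← Real.sqrt_mul (hlt hB hm').le, Real.sqrt_inj
      (mul_nonneg (hlt hB hm).le (hlt hA hm').le) (mul_nonneg (hlt hB hm').le (hlt hA hm).le)] at e4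
    have hne : M' ^ 2 - M ^ 2 ≠ 0 := by
      have : 0 < M := h1.trans hM1
      nlinarith
    apply mul_left_cancel₀ hne
    linarith
  refine ⟨?_, hAB⟩
  have e1 := hder M hm
  have p2 := hsM hB hm
  by_cases hα : α = 0
  · rw [hα, zero_mul] at e1
    rw [hα]
    exact (mul_eq_zero.1 e1).resolve_right (by positivity)
  · rw [hAB hα] at e1
    exact mul_right_cancel₀ (by positivity) e1

lemma hasDerivAt_integral_of_continuousOn_ball {f : ℝ → ℝ} {y₀ r y : ℝ}
    (hf : ContinuousOn f (Metric.ball y₀ r)) (hy : y ∈ Metric.ball y₀ r) :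
    HasDerivAt (fun y => ∫ t in y₀..y, f t) (f y) y := by
  have hr : 0 < r := dist_nonneg.trans_lt hy
  refine intervalIntegral.integral_hasDerivAt_right ?_
    (hf.stronglyMeasurableAtFilter Metric.isOpen_ball y hy)
    (hf.continuousAt (Metric.isOpen_ball.mem_nhds hy))
  refine (hf.mono ?_).intervalIntegrable
  have := (convex_ball y₀ r).ordConnected.uIcc_subset (Metric.mem_ball_self hr) hy
  exact this

lemma eqOn_of_subset_closure {X Y : Type*} [TopologicalSpace X] [TopologicalSpace Y] [T2Space Y]
    {V S : Set X} (hV : IsOpen V) (hS : V ⊆ closure S) {f g : X → Y} (hf : ContinuousOn f V)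
    (hg : ContinuousOn g V) (h : ∀ z ∈ V ∩ S, f z = g z) : ∀ z ∈ V, f z = g z := by
  have hsub : V ⊆ closure (V ∩ S) := fun z hz => hV.inter_closure ⟨hz, hS hz⟩
  exact EqOn.of_subset_closure (s := V ∩ S) h hf hg inter_subset_left hsub

namespace RadialPotential

variable {P : RadialPotential}

lemma FanJoined.mem_domain {a b θ : ℝ} (h : P.FanJoined a b θ) : a ∈ P.domain ∧ b ∈ P.domain := by
  obtain ⟨L₁, L₂, σ, -, h12, -, H⟩ := h
  obtain ⟨L, hL⟩ := nonempty_Ioo.2 h12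
  obtain ⟨U, x, w, hU, ho, h0, -, h1, -⟩ := H L hL
  exact ⟨h0 ▸ ho.mem_domain 0 ⟨le_rfl, hU.le⟩, h1 ▸ ho.mem_domain U ⟨hU.le, le_rfl⟩⟩

lemma exists_ball_inv_sqrt {y₀ L₂ r₀ : ℝ} (hy : y₀ ∈ P.domain) (hE : L₂ ^ 2 < P.energy y₀)
    (hr₀ : 0 < r₀) :
    ∃ r, 0 < r ∧ r ≤ r₀ ∧ (∀ y ∈ Metric.ball y₀ r, L₂ ^ 2 < P.energy y) ∧
      ∀ L, 0 < L → L ≤ L₂ → ContinuousOn (fun y => (√(P.energy y - L ^ 2))⁻¹)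
        (Metric.ball y₀ r) := by
  have h1 : ∀ᶠ y in nhds y₀, y ∈ P.domain ∧ L₂ ^ 2 < P.energy y :=
    (P.isOpen_domain.eventually_mem hy).and
      ((P.hasDerivAt_energy y₀ hy).continuousAt.eventually (lt_mem_nhds hE))
  obtain ⟨r, hr, h2⟩ := Metric.eventually_nhds_iff_ball.1 h1
  refine ⟨min r r₀, lt_min hr hr₀, min_le_right _ _, fun y hy =>
    (h2 y (Metric.ball_subset_ball (min_le_left _ _) hy)).2, fun L hL0 hL => ?_⟩
  refine ContinuousOn.inv₀ ((P.continuousOn_energy.mono fun y hy =>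
    (h2 y (Metric.ball_subset_ball (min_le_left _ _) hy)).1).sub continuousOn_const).sqrt ?_
  intro y hy
  have := (h2 y (Metric.ball_subset_ball (min_le_left _ _) hy)).2
  have : L ^ 2 ≤ L₂ ^ 2 := by gcongr
  exact (Real.sqrt_pos.2 (by linarith)).ne'

variable {X : Type*} [NormedAddCommGroup X] [NormedSpace ℝ X] [CompleteSpace X]

/-- Rigidity of a family of images: near some point of any open set, the logarithmic radii of
object and image have the same differential up to sign, the turning parameters agree, and the
angle between object and image is constant. -/
lemma exists_rigid {W : Set X} (hW : IsOpen W) (hne : W.Nonempty) {a b θ : X → ℝ}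
    (ha : ContDiffOn ℝ 1 a W) (hb : ContDiffOn ℝ 1 b W)
    (h : ∀ z ∈ W, P.FanJoined (a z) (b z) (θ z)) :
    ∃ V ⊆ W, IsOpen V ∧ V.Nonempty ∧
      (∃ ε : ℝ, ε ^ 2 = 1 ∧ ∀ z ∈ V, fderiv ℝ b z = ε • fderiv ℝ a z) ∧
      (∀ z ∈ V, fderiv ℝ a z ≠ 0 → P.energy (a z) = P.energy (b z)) ∧
      ∃ c, V ⊆ closure {z | Real.cos (θ z) = c} := by
  -- Second use of Baire's theorem, now over object points. The number of turns j may still vary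
  -- from point to point, and θ need not be continuous; one class of fans is only dense in an open
  -- set.
  set S : ℚ × ℚ × ℚ × ℚ × ℚ × ℚ × ℚ × ℚ × ℚ → Set X := fun ⟨c, d, L₁, L₂, T₁, T₂, δ, σ, τ⟩ =>
    {z | ∃ j : ℤ, P.IsFan c d L₁ L₂ T₁ T₂ δ σ τ (a z) (b z) (θ z + 2 * Real.pi * j)} with hS
  have hcov : W ⊆ ⋃ i, S i := fun z hz => by
    obtain ⟨c, d, L₁, L₂, T₁, T₂, δ, σ, τ, j, hj⟩ := (h z hz).exists_isFan
    exact mem_iUnion.2 ⟨(c, d, L₁, L₂, T₁, T₂, δ, σ, τ), j, hj⟩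
  obtain ⟨⟨c, d, L₁, L₂, T₁, T₂, δ, σ, τ⟩, V₀, hV₀, hV₀ne, hV₀W, hV₀S⟩ :=
    exists_isOpen_subset_closure_of_subset_iUnion hW hne hcov
  set S₀ := S (c, d, L₁, L₂, T₁, T₂, δ, σ, τ) with hS₀
  obtain ⟨z₁, hz₁⟩ := hV₀ne
  obtain ⟨z₀, hz₀V, hz₀⟩ := mem_closure_iff.1 (hV₀S hz₁) V₀ hV₀ hz₁
  obtain ⟨j₀, hf⟩ := hz₀
  have hdiff : ∀ {f : X → ℝ}, ContDiffOn ℝ 1 f W → ∀ z ∈ W, DifferentiableAt ℝ f z :=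
    fun {f} hf z hz => (hf.contDiffAt (hW.mem_nhds hz)).differentiableAt one_ne_zero
  obtain ⟨η, hη, hpair⟩ := hf.exists_angle_sub
  have hδ2 : (0 : ℝ) < (δ : ℝ) ^ 2 := pow_pos hf.δ_pos 2
  obtain ⟨ra, hra, hraη, hEa, hka⟩ := exists_ball_inv_sqrt (h z₀ (hV₀W hz₀V)).mem_domain.1
    (L₂ := L₂) (by linarith [hf.le_start]) hη
  obtain ⟨rb, hrb, -, hEb, hkb⟩ := exists_ball_inv_sqrt (h z₀ (hV₀W hz₀V)).mem_domain.2
    (L₂ := L₂) (by linarith [hf.le_end]) hη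
  have hnear : ∀ᶠ z in nhds z₀, z ∈ V₀ ∧ a z ∈ Metric.ball (a z₀) ra ∧
      b z ∈ Metric.ball (b z₀) rb :=
    (hV₀.eventually_mem hz₀V).and (((hdiff ha z₀ (hV₀W hz₀V)).continuousAt.eventually
      (Metric.ball_mem_nhds _ hra)).and ((hdiff hb z₀ (hV₀W hz₀V)).continuousAt.eventually
      (Metric.ball_mem_nhds _ hrb)))
  obtain ⟨r, hr, hball⟩ := Metric.eventually_nhds_iff_ball.1 hnear
  set V := Metric.ball z₀ r with hV
  have hVW : V ⊆ W := fun z hz => hV₀W (hball z hz).1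
  have hVS : V ⊆ closure S₀ := fun z hz => hV₀S (hball z hz).1
  -- The change of angle predicted by the comparison of fans. Unlike θ it is differentiable on all
  -- of V. On the dense class it is an actual angle difference, free of L, and by continuity it is
  -- free of L everywhere.
  set G : ℝ → X → ℝ := fun L z => L * (τ * (∫ y in b z₀..b z, (√(P.energy y - L ^ 2))⁻¹)
        - σ * ∫ y in a z₀..a z, (√(P.energy y - L ^ 2))⁻¹) with hG
  have hL1 := hf.L_pos
  have hL12 := hf.L_lt
  have hGd : ∀ L ∈ Icc (L₁ : ℝ) L₂, ∀ z ∈ V, HasFDerivAt (G L)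
      (L • ((τ : ℝ) • ((√(P.energy (b z) - L ^ 2))⁻¹ • fderiv ℝ b z) -
        (σ : ℝ) • ((√(P.energy (a z) - L ^ 2))⁻¹ • fderiv ℝ a z))) z := fun L hL z hz => by
    have hL0 := hL1.trans_le hL.1
    have e1 := (hasDerivAt_integral_of_continuousOn_ball (hkb L hL0 hL.2)
      (hball z hz).2.2).comp_hasFDerivAt z (hdiff hb z (hVW hz)).hasFDerivAt
    have e2 := (hasDerivAt_integral_of_continuousOn_ball (hka L hL0 hL.2)
      (hball z hz).2.1).comp_hasFDerivAt z (hdiff ha z (hVW hz)).hasFDerivAt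
    exact ((e1.const_mul (τ : ℝ)).sub (e2.const_mul (σ : ℝ))).const_mul L
  have hGS : ∀ z ∈ V ∩ S₀, ∃ j : ℤ, ∀ L ∈ Icc (L₁ : ℝ) L₂,
      θ z + 2 * Real.pi * j - (θ z₀ + 2 * Real.pi * j₀) = G L z := fun z ⟨hz, j, hj⟩ =>
    ⟨j, fun L hL => hpair _ _ _ hj ((hball z hz).2.1.trans_le hraη) L hL⟩
  have hGeq : ∀ L ∈ Icc (L₁ : ℝ) L₂, ∀ z ∈ V, G L z = G L₁ z := fun L hL =>
    eqOn_of_subset_closure Metric.isOpen_ball hVS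
      (fun z hz => (hGd L hL z hz).continuousAt.continuousWithinAt)
      (fun z hz => (hGd L₁ ⟨le_rfl, hL12.le⟩ z hz).continuousAt.continuousWithinAt)
      (fun z hz => by
        obtain ⟨j, hj⟩ := hGS z hz
        rw [← hj L hL, ← hj L₁ ⟨le_rfl, hL12.le⟩])
  have hpt : ∀ z ∈ V, ∀ v : X, (τ * fderiv ℝ b z v = σ * fderiv ℝ a z v) ∧
      ((σ : ℝ) * fderiv ℝ a z v ≠ 0 → P.energy (a z) = P.energy (b z)) := fun z hz v => by
    refine eq_of_sub_eq_const (e := L₁ * (τ * fderiv ℝ b z v * (√(P.energy (b z) - L₁ ^ 2))⁻¹ -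
      σ * fderiv ℝ a z v * (√(P.energy (a z) - L₁ ^ 2))⁻¹)) hL1 hL12
      (hEa _ (hball z hz).2.1) (hEb _ (hball z hz).2.2) (fun L hL => ?_)
    have e1 := (hGd L hL z hz).congr_of_eventuallyEq
      (show G L₁ =ᶠ[nhds z] G L by
        filter_upwards [Metric.isOpen_ball.mem_nhds hz] with y hy using (hGeq L hL y hy).symm)
    have e2 := congrArg (fun f : X →L[ℝ] ℝ => f v)
      (e1.unique (hGd L₁ ⟨le_rfl, hL12.le⟩ z hz))
    simp only [smul_apply, sub_apply, smul_eq_mul] at e2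
    linarith
  have hσ := hf.σ_sq
  have hτ := hf.τ_sq
  have hσ0 : (σ : ℝ) ≠ 0 := fun h0 => by simp [h0] at hσ
  -- τ db = σ da and equal energies annihilate the derivative of G; in directions with da = 0 both
  -- of its terms vanish separately. On a ball G is therefore constant, with value 0 at z₀.
  have hGz : ∀ z ∈ V, G L₁ z = 0 := by
    have hz0 : z₀ ∈ V := Metric.mem_ball_self hr
    intro z hz
    have := (convex_ball z₀ r).is_const_of_fderivWithin_eq_zero (𝕜 := ℝ) (f := G L₁)
      (fun z hz => (hGd L₁ ⟨le_rfl, hL12.le⟩ z hz).differentiableAt.differentiableWithinAt)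
      (fun z hz => by
        rw [fderivWithin_of_isOpen Metric.isOpen_ball hz,
          (hGd L₁ ⟨le_rfl, hL12.le⟩ z hz).fderiv]
        ext v
        obtain ⟨h1, h2⟩ := hpt z hz v
        simp only [smul_apply, sub_apply, smul_eq_mul,
          zero_apply]
        by_cases h3 : (σ : ℝ) * fderiv ℝ a z v = 0
        · linear_combination L₁ * (√(P.energy (b z) - L₁ ^ 2))⁻¹ * (h1.trans h3) -
            L₁ * (√(P.energy (a z) - L₁ ^ 2))⁻¹ * h3
        · rw [h2 h3]
          linear_combination L₁ * (√(P.energy (b z) - L₁ ^ 2))⁻¹ * h1) hz hz0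
    rw [this]
    simp [hG]
  refine ⟨V, hVW, Metric.isOpen_ball, ⟨z₀, Metric.mem_ball_self hr⟩,
    ⟨σ * τ, by rw [mul_pow, hσ, hτ, one_mul], fun z hz => ?_⟩, fun z hz hne => ?_,
    Real.cos (θ z₀), fun z hz => ?_⟩
  · ext v
    have := (hpt z hz v).1
    simp only [smul_apply, smul_eq_mul]
    linear_combination τ * this - fderiv ℝ b z v * hτ
  · obtain ⟨v, hv⟩ : ∃ v, fderiv ℝ a z v ≠ 0 := by
      by_contra! hcon
      exact hne (by ext v; exact hcon v)
    exact (hpt z hz v).2 (mul_ne_zero hσ0 hv)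
  · refine closure_mono ?_ (Metric.isOpen_ball.inter_closure ⟨hz, hVS hz⟩)
    rintro y hy
    obtain ⟨j, hj⟩ := hGS y hy
    have e := hj L₁ ⟨le_rfl, hL12.le⟩
    rw [hGz y hy.1] at e
    -- Since G vanishes, θ differs from its value at z₀ by full turns only, which the cosine
    -- ignores.
    have : θ y = θ z₀ + (j₀ - j : ℤ) * (2 * Real.pi) := by push_cast; linarith
    simp only [mem_ofPred_eq]
    rw [this, Real.cos_add_int_mul_two_pi]

end RadialPotential

/-- Time reversal: the uniform exit direction τ supplied by `exists_isFan` becomes the common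
initial direction of the reversed motions. -/
lemma RadialPotential.FanJoined.symm {P : RadialPotential} {a b θ : ℝ} (h : P.FanJoined a b θ) :
    P.FanJoined b a θ := by
  obtain ⟨c, d, L₁, L₂, T₁, T₂, δ, σ, τ, j, hf⟩ := h.exists_isFan
  refine ⟨L₁, L₂, -τ, hf.L_pos, hf.L_lt, by rw [neg_sq, hf.τ_sq], fun L hL => ?_⟩
  have hL' := Ioo_subset_Icc_self hL
  obtain ⟨x, w, ho, -, h0, -, h1, h1'⟩ := hf.exists_orbit L hL'
  have hL0 : 0 < L := hf.L_pos.trans hL.1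
  have hΘ := hf.T_pos.trans_le hf.mem_Icc.1
  refine ⟨_, _, _, div_pos hΘ hL0, ho.reverse, ?_, ?_, ?_, j, ?_⟩
  · simpa using h1
  · simp only [sub_zero, h1']
    have := hf.δ_pos.trans_le (hf.le_sqrt_end hL')
    have hτ := hf.τ_sq
    rw [show -(τ : ℝ) * -(τ * √(P.energy b - L ^ 2)) = (τ : ℝ) ^ 2 * √(P.energy b - L ^ 2) by ring,
      hτ, one_mul]
    exact this
  · simpa using h0
  · field_simp

/-! ### Light rays as radial motions -/

/-- A change of time with a prescribed positive rate. -/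
lemma exists_time_change {η : ℝ → ℝ} {T : ℝ} (hT : 0 < T) (hη : ContinuousOn η (Icc 0 T))
    (hpos : ∀ s ∈ Icc 0 T, 0 < η s) :
    ∃ (U : ℝ) (S : ℝ → ℝ), 0 < U ∧ S 0 = 0 ∧ S U = T ∧ (∀ u ∈ Icc 0 U, S u ∈ Icc 0 T) ∧
      ∀ u ∈ Icc 0 U, HasDerivWithinAt S (η (S u))⁻¹ (Icc 0 U) u := by
  -- The constant extension of the rate is bounded below by a positive number, so its primitive is a
  -- bijection of the line; S is the inverse.
  set e : ℝ → ℝ := IccExtend hT.le ((Icc 0 T).domRestrict η) with he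
  have hec : Continuous e := (continuousOn_iff_continuous_domRestrict.1 hη).Icc_extend'
  have heq : ∀ s ∈ Icc 0 T, e s = η s := fun s hs => IccExtend_of_mem hT.le _ hs
  have hepos : ∀ s, 0 < e s := fun s => hpos _ (projIcc 0 T hT.le s).2
  obtain ⟨m, hm, hmin⟩ : ∃ m > 0, ∀ s, m ≤ e s := by
    obtain ⟨s₀, hs₀, h⟩ := isCompact_Icc.exists_isMinOn (nonempty_Icc.2 hT.le) hη
    exact ⟨η s₀, hpos s₀ hs₀, fun s => h (projIcc 0 T hT.le s).2⟩
  set g : ℝ → ℝ := fun s => ∫ t in 0..s, e t with hg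
  have hgd : ∀ s, HasDerivAt g (e s) s := fun s => hec.integral_hasStrictDerivAt 0 s |>.hasDerivAt
  have hmono : StrictMono g := strictMono_of_hasDerivAt_pos hgd hepos
  have hg0 : g 0 = 0 := by simp [hg]
  have hgc : Continuous g := continuous_iff_continuousAt.2 fun s => (hgd s).continuousAt
  have hlow : ∀ {s t : ℝ}, s ≤ t → m * (t - s) ≤ g t - g s := fun {s t} hst =>
    (convex_univ).mul_sub_le_image_sub_of_le_deriv hgc.continuousOn
      (fun s _ => (hgd s).differentiableAt.differentiableWithinAt)
      (fun s _ => by rw [(hgd s).deriv]; exact hmin s) s trivial t trivial hst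
  have hsurj : Function.Surjective g := fun y => by
    have h1 : y ∈ Icc (g (-(|y| / m))) (g (|y| / m)) := by
      have h2 : 0 ≤ |y| / m := by positivity
      have h3 := hlow h2
      have h4 := hlow (show -(|y| / m) ≤ 0 by linarith)
      have h5 : m * (|y| / m) = |y| := by field_simp
      rw [hg0] at h3 h4
      constructor <;> nlinarith [neg_abs_le y, le_abs_self y]
    obtain ⟨s, -, hs⟩ := intermediate_value_Icc
      (by have : 0 ≤ |y| / m := by positivity
          linarith) hgc.continuousOn h1
    exact ⟨s, hs⟩
  set O := StrictMono.orderIsoOfSurjective g hmono hsurj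
  have hO : ∀ u, g (O.symm u) = u := fun u => O.apply_symm_apply u
  have hO' : ∀ s, O.symm (g s) = s := fun s => O.symm_apply_apply s
  have hin : ∀ u ∈ Icc 0 (g T), O.symm u ∈ Icc 0 T := fun u hu => by
    constructor
    · rw [← hO' 0, hg0]; exact O.symm.monotone hu.1
    · rw [← hO' T]; exact O.symm.monotone hu.2
  refine ⟨g T, O.symm, by rw [← hg0]; exact hmono hT, by rw [← hg0, hO', hg0], hO' T, hin,
    fun u hu => ?_⟩
  rw [← heq _ (hin u hu)]
  exact (HasDerivAt.of_local_left_inverse O.symm.continuous.continuousAt (hgd _) (hepos _).ne'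
    (Filter.Eventually.of_forall hO)).hasDerivWithinAt

namespace RadialMedium

variable (M : RadialMedium)

lemma differentiableAt_index {r : ℝ} (hr : r ∈ M.region) : DifferentiableAt ℝ M.index r :=
  (M.contDiffOn_index.contDiffAt (M.isOpen_region.mem_nhds hr)).differentiableAt two_ne_zero

/-- The radial potential of a spherically symmetric medium. -/
noncomputable def radialPotential : RadialPotential where
  domain := Real.exp ⁻¹' M.region
  energy x := (Real.exp x * M.index (Real.exp x)) ^ 2
  force x := (Real.exp x * M.index (Real.exp x)) ^ 2 +
    Real.exp x ^ 3 * M.index (Real.exp x) * deriv M.index (Real.exp x)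
  isOpen_domain := M.isOpen_region.preimage Real.continuous_exp
  hasDerivAt_energy x hx := by
    have h1 := (M.differentiableAt_index hx).hasDerivAt.comp x (Real.hasDerivAt_exp x)
    refine (((Real.hasDerivAt_exp x).mul h1).pow 2).congr_deriv ?_
    simp only [Pi.mul_apply, Function.comp, Nat.cast_ofNat]
    ring
  contDiffOn_force := by
    have h0 : ContDiffOn ℝ 1 Real.exp (Real.exp ⁻¹' M.region) := Real.contDiff_exp.contDiffOn
    have h1 : ContDiffOn ℝ 1 (fun x => M.index (Real.exp x)) (Real.exp ⁻¹' M.region) :=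
      (M.contDiffOn_index.of_le one_le_two).comp h0 fun x hx => hx
    have h2 : ContDiffOn ℝ 1 (fun x => deriv M.index (Real.exp x)) (Real.exp ⁻¹' M.region) :=
      (M.contDiffOn_index.deriv_of_isOpen M.isOpen_region (by norm_num)).comp h0 fun x hx => hx
    exact ((h0.mul h1).pow 2).add (((h0.pow 3).mul h1).mul h2)

variable {M} {d : ℕ}

lemma gradient_index_norm {x : EuclideanSpace ℝ (Fin d)} (hx : ‖x‖ ∈ M.region) :
    gradient (fun x : EuclideanSpace ℝ (Fin d) => M.index ‖x‖) x =
      (deriv M.index ‖x‖ / ‖x‖) • x := by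
  have h0 : 0 < ‖x‖ := M.region_pos hx
  have hn : HasFDerivAt (fun y : EuclideanSpace ℝ (Fin d) => ‖y‖) (‖x‖⁻¹ • innerSL ℝ x) x := by
    have h1 := (hasStrictFDerivAt_norm_sq x).hasFDerivAt.sqrt (by positivity)
    have h2 : (fun y : EuclideanSpace ℝ (Fin d) => √(‖y‖ ^ 2)) = fun y => ‖y‖ := by
      ext y; exact Real.sqrt_sq (norm_nonneg y)
    rw [h2, Real.sqrt_sq h0.le] at h1
    refine h1.congr_fderiv ?_
    ext y
    simp only [smul_apply, innerSL_apply_apply, smul_eq_mul, nsmul_eq_mul]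
    push_cast
    field_simp
  have h3 := (M.differentiableAt_index hx).hasDerivAt.comp_hasFDerivAt x hn
  refine HasGradientAt.gradient ?_
  rw [hasGradientAt_iff_hasFDerivAt]
  refine h3.congr_fderiv ?_
  ext y
  simp only [smul_apply, innerSL_apply_apply, smul_eq_mul, InnerProductSpace.toDual_apply_apply,
    inner_smul_left, RCLike.conj_to_real]
  field_simp

variable {γ v : ℝ → EuclideanSpace ℝ (Fin d)} {T : ℝ}

/-- A light ray stays in the plane of its initial position and velocity, where its logarithmic
radius performs a radial motion and its polar angle grows at a constant rate. -/
lemma IsLightRay.exists_orbit (h : M.IsLightRay T γ v) (hT : 0 < T)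
    {b : EuclideanSpace ℝ (Fin d)} (hb : ‖b‖ = 1) (hAb : ⟪γ 0, b⟫ = 0) {ψ : ℝ}
    (hv : v 0 = Real.cos ψ • (‖γ 0‖⁻¹ • γ 0) + Real.sin ψ • b) :
    ∃ U x w, 0 < U ∧ M.radialPotential.IsOrbit (M.turningParameter ‖γ 0‖ * Real.sin ψ) U x w ∧
      x 0 = Real.log ‖γ 0‖ ∧ w 0 = M.turningParameter ‖γ 0‖ * Real.cos ψ ∧
      x U = Real.log ‖γ T‖ ∧
      γ T = ‖γ T‖ • (Real.cos (M.turningParameter ‖γ 0‖ * Real.sin ψ * U) • (‖γ 0‖⁻¹ • γ 0) +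
        Real.sin (M.turningParameter ‖γ 0‖ * Real.sin ψ * U) • b) := by
  have hI0 : (0 : ℝ) ∈ Icc 0 T := ⟨le_rfl, hT.le⟩
  have hr : ∀ s ∈ Icc 0 T, 0 < ‖γ s‖ := fun s hs => M.region_pos (h.mem_region s hs)
  have hn : ∀ s ∈ Icc 0 T, 0 < M.index ‖γ s‖ := fun s hs => M.index_pos _ (h.mem_region s hs)
  set a := ‖γ 0‖⁻¹ • γ 0 with ha
  have ha1 : ‖a‖ = 1 := by rw [ha, norm_smul, norm_inv, norm_norm, inv_mul_cancel₀ (hr 0 hI0).ne']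
  have hab : ⟪a, b⟫ = 0 := by rw [ha, inner_smul_left, hAb, mul_zero]
  have hγ0 : γ 0 = ‖γ 0‖ • a := by rw [ha, smul_smul, mul_inv_cancel₀ (hr 0 hI0).ne', one_smul]
  set L := M.turningParameter ‖γ 0‖ * Real.sin ψ with hL
  set q : ℝ → EuclideanSpace ℝ (Fin d) := fun s => M.index ‖γ s‖ • v s with hq
  have hqd : ∀ s ∈ Icc 0 T, HasDerivWithinAt q ((deriv M.index ‖γ s‖ / ‖γ s‖) • γ s) (Icc 0 T) s :=
    fun s hs => by
      rw [← gradient_index_norm (h.mem_region s hs)]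
      exact h.ray_equation s hs
  have hrd : ∀ s ∈ Icc 0 T, HasDerivWithinAt (fun s => ‖γ s‖) (⟪γ s, v s⟫ / ‖γ s‖) (Icc 0 T) s :=
    fun s hs => by
      have h1 := ((h.hasDeriv s hs).norm_sq).sqrt (by have := hr s hs; positivity)
      simp only [Real.sqrt_sq (norm_nonneg _)] at h1
      refine h1.congr_deriv ?_
      have := (hr s hs).ne'
      field_simp
  -- Angular momentum in any dimension: the bivector γ ∧ q keeps its initial value L (a ∧ b), the
  -- force being central.
  have hmom : ∀ e f : EuclideanSpace ℝ (Fin d), ∀ s ∈ Icc 0 T,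
      ⟪γ s, e⟫ * ⟪q s, f⟫ - ⟪γ s, f⟫ * ⟪q s, e⟫ = L * (⟪a, e⟫ * ⟪b, f⟫ - ⟪a, f⟫ * ⟪b, e⟫) :=
    fun e f s hs => by
      have hd : ∀ s ∈ Icc 0 T, HasDerivWithinAt
          (fun s => ⟪γ s, e⟫ * ⟪q s, f⟫ - ⟪γ s, f⟫ * ⟪q s, e⟫) 0 (Icc 0 T) s := fun s hs => by
        have e1 := (h.hasDeriv s hs).inner ℝ (hasDerivWithinAt_const s (Icc 0 T) e)
        have e2 := (h.hasDeriv s hs).inner ℝ (hasDerivWithinAt_const s (Icc 0 T) f)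
        have e3 := (hqd s hs).inner ℝ (hasDerivWithinAt_const s (Icc 0 T) e)
        have e4 := (hqd s hs).inner ℝ (hasDerivWithinAt_const s (Icc 0 T) f)
        refine ((e1.mul e4).sub (e2.mul e3)).congr_deriv ?_
        simp only [hq, inner_smul_left, inner_zero_right, zero_add]
        simp
        ring
      have h1 := (convex_Icc 0 T).norm_image_sub_le_of_norm_hasDerivWithin_le (C := 0) hd (by simp)
        hI0 hs
      rw [zero_mul, norm_le_zero_iff, sub_eq_zero] at h1
      rw [h1]
      simp only [hq]
      rw [hv, hγ0, hL, turningParameter]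
      simp only [inner_smul_left, inner_add_left, norm_smul, ha1, norm_norm, mul_one]
      simp
      ring
  -- The quarter turn of the plane of a and b, zero on the orthogonal complement. Contracting the
  -- bivector identity with γ expresses the transverse part of q through J γ.
  set J : EuclideanSpace ℝ (Fin d) → EuclideanSpace ℝ (Fin d) :=
    fun y => ⟪a, y⟫ • b - ⟪b, y⟫ • a with hJ
  have hmom' : ∀ s ∈ Icc 0 T, ‖γ s‖ ^ 2 • q s - ⟪γ s, q s⟫ • γ s = L • J (γ s) := fun s hs => by
    refine ext_inner_right ℝ fun f => ?_
    have := hmom (γ s) f s hs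
    rw [real_inner_self_eq_norm_sq] at this
    simp only [hJ, inner_sub_left, inner_smul_left, RCLike.conj_to_real]
    rw [real_inner_comm (q s) (γ s)] at *
    linarith
  -- The rate du/ds = 1/(n r²), for which log r obeys Newton's equation and the polar angle grows at
  -- the constant rate L.
  set η : ℝ → ℝ := fun s => (M.index ‖γ s‖ * ‖γ s‖ ^ 2)⁻¹ with hη
  have hrc : ContinuousOn (fun s => ‖γ s‖) (Icc 0 T) := fun s hs =>
    (hrd s hs).continuousWithinAt
  have hηc : ContinuousOn η (Icc 0 T) := by
    refine ContinuousOn.inv₀ ((M.contDiffOn_index.continuousOn.comp hrc h.mem_region).mul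
      (hrc.pow 2)) fun s hs => ?_
    have h1 := hr s hs
    have h2 := hn s hs
    positivity
  obtain ⟨U, S, hU, hS0, hSU, hSin, hSd⟩ := exists_time_change hT hηc fun s hs => by
    have h1 := hr s hs
    have h2 := hn s hs
    simp only [hη]
    positivity
  simp only [hη, inv_inv] at hSd
  have hexp : ∀ u ∈ Icc 0 U, Real.exp (Real.log ‖γ (S u)‖) = ‖γ (S u)‖ := fun u hu =>
    Real.exp_log (hr _ (hSin u hu))
  have hxd : ∀ u ∈ Icc 0 U, HasDerivWithinAt (fun u => Real.log ‖γ (S u)‖)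
      ⟪γ (S u), q (S u)⟫ (Icc 0 U) u := fun u hu => by
    have h1 := hr _ (hSin u hu)
    refine ((((hrd _ (hSin u hu)).comp u (hSd u hu) hSin)).log h1.ne').congr_deriv ?_
    simp only [hq, inner_smul_right, Function.comp]
    field_simp
  have hwd : ∀ u ∈ Icc 0 U, HasDerivWithinAt (fun u => ⟪γ (S u), q (S u)⟫)
      (M.radialPotential.force (Real.log ‖γ (S u)‖)) (Icc 0 U) u := fun u hu => by
    have h1 := hr _ (hSin u hu)
    have h2 := h.unit_speed _ (hSin u hu)
    refine ((((h.hasDeriv _ (hSin u hu)).inner ℝ (hqd _ (hSin u hu))).scomp u (hSd u hu)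
      hSin)).congr_deriv ?_
    simp only [radialPotential, hexp u hu, hq, inner_smul_right, real_inner_self_eq_norm_sq, h2,
      smul_eq_mul]
    field_simp
    ring
  have ho : M.radialPotential.IsOrbit L U (fun u => Real.log ‖γ (S u)‖)
      (fun u => ⟪γ (S u), q (S u)⟫) := by
    refine RadialPotential.conserved_of_newton hxd hwd (fun u hu => ?_) ?_
    · change Real.exp _ ∈ M.region
      rw [hexp u hu]
      exact h.mem_region _ (hSin u hu)
    · simp only [radialPotential]
      rw [hexp 0 ⟨le_rfl, hU.le⟩, hS0]
      simp only [hq, hL, turningParameter]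
      rw [hv]
      simp only [inner_smul_right, inner_add_right]
      rw [hAb, ha, inner_smul_right, real_inner_self_eq_norm_sq]
      have h3 := (hr 0 hI0).ne'
      have h4 := Real.sin_sq_add_cos_sq ψ
      field_simp
      linear_combination (‖γ 0‖ ^ 2 * M.index ‖γ 0‖ ^ 2) * h4
  refine ⟨U, _, _, hU, ho, by simp [hS0], ?_, by simp [hSU], ?_⟩
  · simp only [hS0, hq, turningParameter]
    rw [hv]
    simp only [inner_smul_right, inner_add_right]
    rw [hAb, ha, inner_smul_right, real_inner_self_eq_norm_sq]
    have h3 := (hr 0 hI0).ne'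
    field_simp
    ring
  set E : ℝ → EuclideanSpace ℝ (Fin d) := fun u => Real.cos (L * u) • a + Real.sin (L * u) • b
    with hE
  have hEd : ∀ u, HasDerivWithinAt E (L • J (E u)) (Icc 0 U) u := fun u => by
    have e0 : HasDerivAt (fun u : ℝ => L * u) L u := by simpa using (hasDerivAt_id u).const_mul L
    refine ((e0.cos.smul_const a).add (e0.sin.smul_const b)).hasDerivWithinAt.congr_deriv ?_
    simp only [hJ, hE, inner_add_right, inner_smul_right, real_inner_self_eq_norm_sq, ha1, hb, hab,
      real_inner_comm a b]
    module
  have hed : ∀ u ∈ Icc 0 U, HasDerivWithinAt (fun u => ‖γ (S u)‖⁻¹ • γ (S u))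
      (L • J (‖γ (S u)‖⁻¹ • γ (S u))) (Icc 0 U) u := fun u hu => by
    have h1 := (hr _ (hSin u hu)).ne'
    refine ((((hrd _ (hSin u hu)).inv h1).smul (h.hasDeriv _ (hSin u hu))).scomp u (hSd u hu)
      hSin).congr_deriv ?_
    have h2 : L • J (‖γ (S u)‖⁻¹ • γ (S u)) = ‖γ (S u)‖⁻¹ • (L • J (γ (S u))) := by
      simp only [hJ, inner_smul_right]
      module
    rw [h2, ← hmom' _ (hSin u hu)]
    simp only [hq, inner_smul_right, smul_sub, smul_add, smul_smul, Pi.inv_apply]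
    field_simp
    rw [neg_smul, ← sub_eq_add_neg]
  -- γ/‖γ‖ and E both solve e' = L J e with J skew, so their inner product keeps its initial value
  -- 1; unit vectors with inner product 1 are equal.
  have hinner : ∀ u ∈ Icc 0 U, HasDerivWithinAt (fun u => ⟪‖γ (S u)‖⁻¹ • γ (S u), E u⟫) 0
      (Icc 0 U) u := fun u hu => by
    refine ((hed u hu).inner ℝ (hEd u)).congr_deriv ?_
    simp only [hJ, inner_smul_right, inner_smul_left, inner_sub_left, inner_sub_right,
      RCLike.conj_to_real, real_inner_comm a, real_inner_comm b]
    ring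
  have h1 := (convex_Icc 0 U).norm_image_sub_le_of_norm_hasDerivWithin_le (C := 0) hinner (by simp)
        (⟨le_rfl, hU.le⟩ : (0 : ℝ) ∈ Icc 0 U) ⟨hU.le, le_rfl⟩
  rw [zero_mul, norm_le_zero_iff, sub_eq_zero, hS0, hSU] at h1
  have hE0 : E 0 = a := by simp [hE]
  have hEU : ‖E U‖ = 1 := by
    have : ‖E U‖ ^ 2 = 1 := by
      rw [← real_inner_self_eq_norm_sq]
      simp only [hE, inner_add_right, inner_add_left, inner_smul_right, inner_smul_left,
        real_inner_self_eq_norm_sq, ha1, hb, hab, real_inner_comm a b, RCLike.conj_to_real]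
      linear_combination Real.sin_sq_add_cos_sq (L * U)
    exact (pow_eq_one_iff_of_nonneg (norm_nonneg _) two_ne_zero).1 this
  have hIT : T ∈ Icc 0 T := ⟨hT.le, le_rfl⟩
  have hT1 : ‖‖γ T‖⁻¹ • γ T‖ = 1 := by
    rw [norm_smul, norm_inv, norm_norm, inv_mul_cancel₀ (hr T hIT).ne']
  rw [hE0, ← ha, real_inner_self_eq_norm_sq, ha1, one_pow] at h1
  have h2 := (inner_eq_one_iff_of_norm_eq_one hT1 hEU).1 h1
  change γ T = ‖γ T‖ • E U
  rw [← h2, smul_smul, mul_inv_cancel₀ (hr T hIT).ne', one_smul]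

end RadialMedium

lemma exists_cos_sin_eq {x y : ℝ} (h : x ^ 2 + y ^ 2 = 1) :
    ∃ θ : ℝ, Real.cos θ = x ∧ Real.sin θ = y := by
  have h1 : ‖(⟨x, y⟩ : ℂ)‖ = 1 := by
    have h2 := Complex.sq_norm (⟨x, y⟩ : ℂ)
    rw [Complex.normSq_mk, ← sq, ← sq, h] at h2
    exact (pow_eq_one_iff_of_nonneg (norm_nonneg _) two_ne_zero).1 h2
  obtain ⟨θ, hθ⟩ := (Complex.norm_eq_one_iff _).1 h1
  refine ⟨θ, ?_, ?_⟩
  · rw [← Complex.exp_ofReal_mul_I_re, hθ]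
  · rw [← Complex.exp_ofReal_mul_I_im, hθ]

lemma exists_eq_add_two_pi_mul {α β : ℝ} (hc : Real.cos α = Real.cos β)
    (hs : Real.sin α = Real.sin β) : ∃ j : ℤ, α = β + 2 * Real.pi * j := by
  obtain ⟨k, hk⟩ := Real.Angle.angle_eq_iff_two_pi_dvd_sub.1 (Real.Angle.cos_sin_inj hc hs)
  exact ⟨k, by linarith⟩

lemma exists_eq_add_two_pi_mul_of_polar {d : ℕ} {A b B : EuclideanSpace ℝ (Fin d)} {α β : ℝ}
    (hA : ‖A‖ ≠ 0) (hB : ‖B‖ ≠ 0) (hb : ‖b‖ = 1) (hAb : ⟪A, b⟫ = 0)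
    (hα : B = ‖B‖ • (Real.cos α • (‖A‖⁻¹ • A) + Real.sin α • b))
    (hβ : B = ‖B‖ • (Real.cos β • (‖A‖⁻¹ • A) + Real.sin β • b)) :
    ∃ j : ℤ, α = β + 2 * Real.pi * j := by
  have hinner : ∀ φ : ℝ, B = ‖B‖ • (Real.cos φ • (‖A‖⁻¹ • A) + Real.sin φ • b) →
      Real.cos φ = ⟪A, B⟫ / (‖A‖ * ‖B‖) ∧ Real.sin φ = ⟪b, B⟫ / ‖B‖ := fun φ hφ => by
    have e1 := congrArg (fun y => ⟪A, y⟫) hφ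
    have e2 := congrArg (fun y => ⟪b, y⟫) hφ
    simp only [inner_smul_right, inner_add_right, real_inner_self_eq_norm_sq, hAb, hb,
      real_inner_comm A b] at e1 e2
    rw [e1, e2]
    constructor
    · field_simp
      ring
    · field_simp
      ring
  exact exists_eq_add_two_pi_mul ((hinner α hα).1.trans (hinner β hβ).1.symm)
    ((hinner α hα).2.trans (hinner β hβ).2.symm)

namespace RadialMedium

variable {M : RadialMedium} {d : ℕ}

lemma RayJoins.norm_mem {A u B : EuclideanSpace ℝ (Fin d)} (h : M.RayJoins A u B) :
    ‖A‖ ∈ M.region ∧ ‖B‖ ∈ M.region := by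
  obtain ⟨T, γ, v, hT, hl, rfl, -, rfl⟩ := h
  exact ⟨hl.mem_region 0 ⟨le_rfl, hT.le⟩, hl.mem_region T ⟨hT.le, le_rfl⟩⟩

lemma RayJoins.exists_orbit {A b B : EuclideanSpace ℝ (Fin d)} {ψ : ℝ}
    (h : M.RayJoins A (Real.cos ψ • (‖A‖⁻¹ • A) + Real.sin ψ • b) B) (hb : ‖b‖ = 1)
    (hAb : ⟪A, b⟫ = 0) :
    ∃ U x w, 0 < U ∧ M.radialPotential.IsOrbit (M.turningParameter ‖A‖ * Real.sin ψ) U x w ∧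
      x 0 = Real.log ‖A‖ ∧ w 0 = M.turningParameter ‖A‖ * Real.cos ψ ∧ x U = Real.log ‖B‖ ∧
      B = ‖B‖ • (Real.cos (M.turningParameter ‖A‖ * Real.sin ψ * U) • (‖A‖⁻¹ • A) +
        Real.sin (M.turningParameter ‖A‖ * Real.sin ψ * U) • b) := by
  obtain ⟨T, γ, v, hT, hl, rfl, hv, rfl⟩ := h
  exact hl.exists_orbit hT hb hAb hv

/-- Radial motions give rise to light rays in every plane through the centre. -/
lemma rayJoins_of_isOrbit {L U : ℝ} {x w : ℝ → ℝ} (ho : M.radialPotential.IsOrbit L U x w)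
    (hU : 0 < U) {a b : EuclideanSpace ℝ (Fin d)} (ha : ‖a‖ = 1) (hb : ‖b‖ = 1)
    (hab : ⟪a, b⟫ = 0) :
    M.RayJoins (Real.exp (x 0) • a)
      ((M.turningParameter (Real.exp (x 0)))⁻¹ • (w 0 • a + L • b))
      (Real.exp (x U) • (Real.cos (L * U) • a + Real.sin (L * U) • b)) := by
  have hD : ∀ u ∈ Icc 0 U, Real.exp (x u) ∈ M.region := ho.mem_domain
  have hn : ∀ u ∈ Icc 0 U, 0 < M.index (Real.exp (x u)) := fun u hu => M.index_pos _ (hD u hu)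
  have hex : ContinuousOn (fun u => Real.exp (x u)) (Icc 0 U) := ho.continuousOn_pos.rexp
  have hηc : ContinuousOn (fun u => Real.exp (x u) ^ 2 * M.index (Real.exp (x u))) (Icc 0 U) :=
    (hex.pow 2).mul (M.contDiffOn_index.continuousOn.comp hex hD)
  obtain ⟨T, S, hT, hS0, hST, hSin, hSd⟩ := exists_time_change hU hηc fun u hu => by
    have := hn u hu
    positivity
  set E : ℝ → EuclideanSpace ℝ (Fin d) := fun u => Real.cos (L * u) • a + Real.sin (L * u) • b
    with hE
  set F : ℝ → EuclideanSpace ℝ (Fin d) := fun u => -Real.sin (L * u) • a + Real.cos (L * u) • b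
    with hF
  have e0 : ∀ u, HasDerivAt (fun u : ℝ => L * u) L u := fun u => by
    simpa using (hasDerivAt_id u).const_mul L
  have hEd : ∀ u, HasDerivAt E (L • F u) u := fun u => by
    refine (((e0 u).cos.smul_const a).add ((e0 u).sin.smul_const b)).congr_deriv ?_
    simp only [hF]
    module
  have hFd : ∀ u, HasDerivAt F (-L • E u) u := fun u => by
    refine (((e0 u).sin.neg.smul_const a).add ((e0 u).cos.smul_const b)).congr_deriv ?_
    simp only [hE]
    module
  have hnorm : ∀ (p q u : ℝ), ‖p • E u + q • F u‖ ^ 2 = p ^ 2 + q ^ 2 := fun p q u => by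
    rw [← real_inner_self_eq_norm_sq]
    simp only [hE, hF, inner_add_right, inner_add_left, inner_smul_right, inner_smul_left,
      real_inner_self_eq_norm_sq, ha, hb, hab, real_inner_comm a b, RCLike.conj_to_real]
    linear_combination (p ^ 2 + q ^ 2) * Real.sin_sq_add_cos_sq (L * u)
  have hE1 : ∀ u, ‖E u‖ = 1 := fun u => by
    have := hnorm 1 0 u
    simp only [one_smul, zero_smul, add_zero] at this
    exact (pow_eq_one_iff_of_nonneg (norm_nonneg _) two_ne_zero).1 (by rw [this]; norm_num)
  have hγn : ∀ u, ‖Real.exp (x u) • E u‖ = Real.exp (x u) := fun u => by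
    rw [norm_smul, hE1, mul_one, Real.norm_eq_abs, Real.abs_exp]
  have hcons : ∀ u ∈ Icc 0 U, w u ^ 2 + L ^ 2 =
      (Real.exp (x u) * M.index (Real.exp (x u))) ^ 2 := ho.conserved
  refine ⟨T, fun s => Real.exp (x (S s)) • E (S s), fun s =>
    (Real.exp (x (S s)) * M.index (Real.exp (x (S s))))⁻¹ • (w (S s) • E (S s) + L • F (S s)),
    hT, ⟨fun s hs => ?_, fun s hs => ?_, fun s hs => ?_, fun s hs => ?_⟩, ?_, ?_, ?_⟩
  · simp only [hγn]
    exact hD _ (hSin s hs)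
  · have h1 := (((ho.deriv_pos _ (hSin s hs)).exp.smul
      (hEd (S s)).hasDerivWithinAt)).scomp s (hSd s hs) hSin
    refine h1.congr_deriv ?_
    have := (hn _ (hSin s hs)).ne'
    simp only [smul_add, smul_smul]
    rw [add_comm]
    congr 2 <;> field_simp
  · have h2 := hnorm (w (S s)) L (S s)
    rw [hcons _ (hSin s hs)] at h2
    have h3 := hn _ (hSin s hs)
    have h4 : 0 < Real.exp (x (S s)) * M.index (Real.exp (x (S s))) := by positivity
    rw [norm_smul, (pow_left_inj₀ (norm_nonneg _) h4.le two_ne_zero).1 h2, norm_inv,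
      Real.norm_of_nonneg h4.le, inv_mul_cancel₀ h4.ne']
  · rw [gradient_index_norm (by rw [hγn]; exact hD _ (hSin s hs)), hγn]
    have h1 : HasDerivWithinAt (fun u => Real.exp (-x u) • (w u • E u + L • F u))
        (Real.exp (-x (S s)) • (((M.radialPotential.force (x (S s)) -
          (w (S s) ^ 2 + L ^ 2)) • E (S s)))) (Icc 0 U) (S s) := by
      have e1 := (ho.deriv_pos _ (hSin s hs)).neg.exp
      have e2 := (ho.deriv_mom _ (hSin s hs)).smul (hEd (S s)).hasDerivWithinAt
      have e3 := ((hFd (S s)).const_smul L).hasDerivWithinAt (s := Icc 0 U)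
      refine (e1.smul (e2.add e3)).congr_deriv ?_
      simp only [Pi.add_apply, Pi.smul_apply, Pi.neg_apply, Pi.smul_apply']
      module
    have h2 := (h1.scomp s (hSd s hs) hSin).congr_of_mem (f₁ := fun σ =>
      M.index ‖Real.exp (x (S σ)) • E (S σ)‖ • (Real.exp (x (S σ)) *
        M.index (Real.exp (x (S σ))))⁻¹ • (w (S σ) • E (S σ) + L • F (S σ))) (fun σ hσ => by
        have := (hn _ (hSin σ hσ)).ne'
        simp only [Function.comp, hγn, smul_smul]
        congr 1
        rw [Real.exp_neg]
        field_simp) hs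
    refine h2.congr_deriv ?_
    rw [hcons _ (hSin s hs)]
    simp only [radialPotential, smul_smul]
    congr 1
    have := (hn _ (hSin s hs)).ne'
    rw [Real.exp_neg]
    field_simp
    ring
  · simp [hS0, hE]
  · simp [hS0, hE, hF, turningParameter]
  · simp only [hST, hE]

lemma turningParameter_pos {r : ℝ} (hr : r ∈ M.region) : 0 < M.turningParameter r :=
  mul_pos (M.region_pos hr) (M.index_pos r hr)

lemma energy_log {r : ℝ} (hr : r ∈ M.region) :
    M.radialPotential.energy (Real.log r) = M.turningParameter r ^ 2 := by
  simp only [radialPotential, turningParameter]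
  rw [Real.exp_log (M.region_pos hr)]

/-- A stigmatic image arises from a fan of radial motions. -/
lemma IsStigmaticImage.exists_fanJoined {A B : EuclideanSpace ℝ (Fin d)}
    (h : M.IsStigmaticImage A B) :
    ‖A‖ ∈ M.region ∧ ‖B‖ ∈ M.region ∧ ∃ θ : ℝ,
      M.radialPotential.FanJoined (Real.log ‖A‖) (Real.log ‖B‖) θ ∧
      ∃ b : EuclideanSpace ℝ (Fin d), ‖b‖ = 1 ∧ ⟪A, b⟫ = 0 ∧
        B = ‖B‖ • (Real.cos θ • (‖A‖⁻¹ • A) + Real.sin θ • b) := by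
  obtain ⟨α, β, hαβ, b, hb, hAb, hray⟩ := h
  obtain ⟨m, hm⟩ := nonempty_Ioo.2 hαβ
  have hAr := (hray m hm).norm_mem.1
  have hBr := (hray m hm).norm_mem.2
  refine ⟨hAr, hBr, ?_⟩
  have hN := turningParameter_pos hAr
  set N := M.turningParameter ‖A‖
  -- Otherwise sin 2ψ would vanish on an interval, and its derivative 2 cos 2ψ with it.
  have hψ : ∃ ψ ∈ Ioo α β, Real.sin ψ ≠ 0 ∧ Real.cos ψ ≠ 0 := by
    by_contra! hcon
    have h0 : ∀ ψ ∈ Ioo α β, Real.sin (2 * ψ) = 0 := fun ψ hψ => by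
      rw [Real.sin_two_mul]
      by_cases hs : Real.sin ψ = 0
      · simp [hs]
      · simp [hcon ψ hψ hs]
    have h1 : HasDerivAt (fun ψ : ℝ => Real.sin (2 * ψ)) (Real.cos (2 * m) * 2) m := by
      have : HasDerivAt (fun ψ : ℝ => 2 * ψ) 2 m := by simpa using (hasDerivAt_id m).const_mul 2
      exact this.sin
    have h2 : HasDerivAt (fun _ : ℝ => (0 : ℝ)) (Real.cos (2 * m) * 2) m :=
      h1.congr_of_eventuallyEq (by
        filter_upwards [Ioo_mem_nhds hm.1 hm.2] with ψ hψ using (h0 ψ hψ).symm)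
    have h3 := h2.unique (hasDerivAt_const m (0 : ℝ))
    have h4 := Real.sin_sq_add_cos_sq (2 * m)
    rw [h0 m hm] at h4
    nlinarith
  obtain ⟨α, β, b, ψ₀, hψ₀, hs0, hc0, hb, hAb, hray⟩ : ∃ α β b, ∃ ψ₀ ∈ Ioo α β,
      0 < Real.sin ψ₀ ∧ Real.cos ψ₀ ≠ 0 ∧ ‖b‖ = 1 ∧ ⟪A, b⟫ = 0 ∧ ∀ ψ ∈ Ioo α β,
      M.RayJoins A (Real.cos ψ • (‖A‖⁻¹ • A) + Real.sin ψ • b) B := by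
    obtain ⟨ψ, hψm, hs, hc⟩ := hψ
    rcases hs.lt_or_gt with hs | hs
    -- Replacing b by −b and ψ by −ψ leaves the directions of the rays unchanged and makes the
    -- angular momentum positive.
    · refine ⟨-β, -α, -b, -ψ, ⟨by linarith [hψm.2], by linarith [hψm.1]⟩,
        by rw [Real.sin_neg]; linarith, by rwa [Real.cos_neg], by rwa [norm_neg],
        by rw [inner_neg_right, hAb, neg_zero], fun φ hφ => ?_⟩
      have := hray (-φ) ⟨by linarith [hφ.2], by linarith [hφ.1]⟩
      rwa [Real.cos_neg, Real.sin_neg, neg_smul, ← smul_neg] at this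
    · exact ⟨α, β, b, ψ, hψm, hs, hc, hb, hAb, hray⟩
  obtain ⟨σ, hσ, hσc⟩ := exists_sq_eq_one_mul_pos hc0
  have hopen : ∀ᶠ ψ in nhds ψ₀, ψ ∈ Ioo α β ∧ 0 < Real.sin ψ ∧ 0 < σ * Real.cos ψ :=
    (isOpen_Ioo.eventually_mem hψ₀).and
      ((Real.continuous_sin.continuousAt.eventually (lt_mem_nhds hs0)).and
      ((Real.continuous_cos.const_mul (σ : ℝ)).continuousAt.eventually (lt_mem_nhds hσc)))
  obtain ⟨r, hr, hball⟩ := Metric.eventually_nhds_iff_ball.1 hopen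
  set ε := min (r / 2) 1 with hε
  have hε0 : 0 < ε := lt_min (by linarith) one_pos
  have hεr : ε < r := (min_le_left _ _).trans_lt (by linarith)
  have hIcc : ∀ ψ ∈ uIcc (ψ₀ - ε) (ψ₀ + ε), ψ ∈ Ioo α β ∧ 0 < Real.sin ψ ∧ 0 < σ * Real.cos ψ :=
    fun ψ hψ => by
      rw [uIcc_of_le (by linarith)] at hψ
      refine hball ψ ?_
      rw [Metric.mem_ball, Real.dist_eq, abs_lt]
      constructor <;> linarith [hψ.1, hψ.2]
  -- The difference of the sines is 2 cos ψ₀ sin ε in absolute value, nonzero because cos ψ₀ ≠ 0;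
  -- hence L = N sin ψ sweeps a genuine interval.
  have hne : Real.sin (ψ₀ - ε) ≠ Real.sin (ψ₀ + ε) := by
    rw [Real.sin_sub, Real.sin_add]
    have : 0 < Real.sin ε := Real.sin_pos_of_pos_of_lt_pi hε0
      ((min_le_right _ _).trans_lt (by linarith [Real.pi_gt_three]))
    have h2 := mul_ne_zero hc0 this.ne'
    intro h
    apply h2
    linarith
  have hnB : 0 < ‖B‖ := M.region_pos hBr
  have hnA : 0 < ‖A‖ := M.region_pos hAr
  obtain ⟨U₀, x₀, w₀, hU₀, ho₀, -, -, -, hB₀⟩ := (hray ψ₀ hψ₀).exists_orbit hb hAb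
  refine ⟨_, ⟨N * min (Real.sin (ψ₀ - ε)) (Real.sin (ψ₀ + ε)),
    N * max (Real.sin (ψ₀ - ε)) (Real.sin (ψ₀ + ε)), σ, mul_pos hN (lt_min
    (hIcc _ left_mem_uIcc).2.1 (hIcc _ right_mem_uIcc).2.1), ?_, hσ, fun L hL => ?_⟩,
    b, hb, hAb, hB₀⟩
  · exact mul_lt_mul_of_pos_left (min_lt_max.2 hne) hN
  · have hm : L / N ∈ uIcc (Real.sin (ψ₀ - ε)) (Real.sin (ψ₀ + ε)) := by
      constructor
      · rw [le_div_iff₀ hN, mul_comm]; exact hL.1.le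
      · rw [div_le_iff₀ hN, mul_comm]; exact hL.2.le
    obtain ⟨ψ, hψ, hψL⟩ := intermediate_value_uIcc Real.continuous_sin.continuousOn hm
    obtain ⟨h1, h2, h3⟩ := hIcc ψ hψ
    have hNL : N * Real.sin ψ = L := by rw [hψL]; field_simp
    obtain ⟨U, x, w, hU, ho, hx0, hw0, hxU, hB⟩ := (hray ψ h1).exists_orbit hb hAb
    rw [hNL] at ho hB
    refine ⟨U, x, w, hU, ho, hx0, ?_, hxU, ?_⟩
    · rw [hw0, mul_left_comm]
      exact mul_pos hN h3
    · exact exists_eq_add_two_pi_mul_of_polar hnA.ne' hnB.ne' hb hAb hB hB₀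

/-- A fan of radial motions gives rise to a stigmatic image in every plane. -/
lemma isStigmaticImage_of_fanJoined {p q θ : ℝ} (h : M.radialPotential.FanJoined p q θ)
    {a b : EuclideanSpace ℝ (Fin d)} (ha : ‖a‖ = 1) (hb : ‖b‖ = 1) (hab : ⟪a, b⟫ = 0) :
    M.IsStigmaticImage (Real.exp p • a)
      (Real.exp q • (Real.cos θ • a + Real.sin θ • b)) := by
  have hp : Real.exp p ∈ M.region := h.mem_domain.1
  obtain ⟨L₁, L₂, σ, hL₁, hL₁₂, hσ, H⟩ := h
  have hN := turningParameter_pos hp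
  set N := M.turningParameter (Real.exp p) with hNdef
  have hE : M.radialPotential.energy p = N ^ 2 := rfl
  obtain ⟨L₀, hL₀⟩ := nonempty_Ioo.2 hL₁₂
  obtain ⟨U₀, x₀, w₀, hU₀, ho₀, hx₀, hw₀, -⟩ := H L₀ hL₀
  have hc₀ := ho₀.conserved 0 ⟨le_rfl, hU₀.le⟩
  rw [hx₀, hE] at hc₀
  obtain ⟨ψ₀, hcos, hsin⟩ := exists_cos_sin_eq (x := w₀ 0 / N) (y := L₀ / N) (by
    field_simp; exact hc₀)
  have hopen : ∀ᶠ ψ in nhds ψ₀, N * Real.sin ψ ∈ Ioo L₁ L₂ ∧ 0 < σ * Real.cos ψ := by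
    refine ((Real.continuous_sin.const_mul N).continuousAt.eventually
      (isOpen_Ioo.eventually_mem ⟨?_, ?_⟩)).and
      ((Real.continuous_cos.const_mul σ).continuousAt.eventually (lt_mem_nhds ?_))
    · simp only; rw [hsin, mul_div_cancel₀ _ hN.ne']; exact hL₀.1
    · simp only; rw [hsin, mul_div_cancel₀ _ hN.ne']; exact hL₀.2
    · simp only; rw [hcos, ← mul_div_assoc]; positivity
  obtain ⟨r, hr, hball⟩ := Metric.eventually_nhds_iff_ball.1 hopen
  have hnorm : ‖Real.exp p • a‖ = Real.exp p := by
    rw [norm_smul, ha, mul_one, Real.norm_eq_abs, Real.abs_exp]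
  refine ⟨ψ₀ - r, ψ₀ + r, by linarith, b, hb, by rw [inner_smul_left, hab, mul_zero],
    fun ψ hψ => ?_⟩
  rw [← Real.ball_eq_Ioo] at hψ
  obtain ⟨hL, hσc⟩ := hball ψ hψ
  obtain ⟨U, x, w, hU, ho, hx, hw, hxU, j, hj⟩ := H _ hL
  have hray := rayJoins_of_isOrbit ho hU ha hb hab
  have hw0 : w 0 = N * Real.cos ψ := by
    have e1 := ho.mom_eq (u := 0) ⟨le_rfl, hU.le⟩ hσ hw.le
    rw [hx, hE, show N ^ 2 - (N * Real.sin ψ) ^ 2 = (σ * (N * Real.cos ψ)) ^ 2 by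
      rw [mul_pow σ, hσ]; linear_combination -(N ^ 2) * Real.sin_sq_add_cos_sq ψ,
      Real.sqrt_sq (by rw [mul_left_comm]; positivity), ← mul_assoc, ← sq, hσ, one_mul] at e1
    exact e1
  rw [hx, hxU, hj, mul_comm (2 * Real.pi), Real.cos_add_int_mul_two_pi,
    Real.sin_add_int_mul_two_pi, hw0, ← hNdef] at hray
  convert hray using 1
  rw [hnorm, smul_smul (Real.exp p)⁻¹, inv_mul_cancel₀ (Real.exp_pos p).ne', one_smul, smul_add, smul_smul,
    smul_smul, inv_mul_cancel_left₀ hN.ne', inv_mul_cancel_left₀ hN.ne']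

end RadialMedium

/-! ### Equal turning parameters and the two branches -/

/-- Since log ‖t z‖ = log t + log ‖z‖, the derivative in the direction z itself is 1. -/
lemma fderiv_log_norm_ne_zero {H : Type*} [NormedAddCommGroup H] [InnerProductSpace ℝ H]
    {z : H} (hz : z ≠ 0) : fderiv ℝ (fun z : H => Real.log ‖z‖) z ≠ 0 := by
  have hz' : 0 < ‖z‖ := norm_pos_iff.2 hz
  have hd : DifferentiableAt ℝ (fun z : H => Real.log ‖z‖) z :=
    ((contDiffAt_norm ℝ hz).differentiableAt one_ne_zero).log hz'.ne'
  intro h0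
  have e1 : HasDerivAt (fun t : ℝ => t • z) z 1 := by
    simpa using (hasDerivAt_id (1 : ℝ)).smul_const z
  have e2 : HasDerivAt (fun t : ℝ => Real.log ‖t • z‖) 0 1 := by
    have hd' : HasFDerivAt (fun z : H => Real.log ‖z‖) (0 : H →L[ℝ] ℝ) ((1 : ℝ) • z) := by
      rw [one_smul, ← h0]; exact hd.hasFDerivAt
    exact hd'.comp_hasDerivAt (1 : ℝ) e1
  have e3 : HasDerivAt (fun t : ℝ => Real.log t + Real.log ‖z‖) 1 1 := by
    simpa using (Real.hasDerivAt_log one_ne_zero).add_const (Real.log ‖z‖)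
  have e4 := e3.congr_of_eventuallyEq (show (fun t : ℝ => Real.log ‖t • z‖) =ᶠ[nhds 1] _ by
    filter_upwards [lt_mem_nhds one_pos] with t ht
    rw [norm_smul, Real.norm_of_nonneg ht.le, Real.log_mul ht.ne' hz'.ne'])
  exact zero_ne_one (e2.unique e4)

namespace RadialMedium

variable {M : RadialMedium} {d : ℕ} {Ω : Set (EuclideanSpace ℝ (Fin d))}
  {F : EuclideanSpace ℝ (Fin d) → EuclideanSpace ℝ (Fin d)}

namespace Images

lemma norm_mem (h : M.Images Ω F) {A : EuclideanSpace ℝ (Fin d)} (hA : A ∈ Ω) :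
    ‖A‖ ∈ M.region ∧ ‖F A‖ ∈ M.region :=
  ⟨(h.stigmatic A hA).exists_fanJoined.1, (h.stigmatic A hA).exists_fanJoined.2.1⟩

lemma norm_pos (h : M.Images Ω F) {A : EuclideanSpace ℝ (Fin d)} (hA : A ∈ Ω) :
    0 < ‖A‖ ∧ 0 < ‖F A‖ :=
  ⟨M.region_pos (h.norm_mem hA).1, M.region_pos (h.norm_mem hA).2⟩

lemma contDiffOn_log_norm (h : M.Images Ω F) : ContDiffOn ℝ 1 (fun z => Real.log ‖z‖) Ω :=
  (contDiffOn_id.norm ℝ fun _ hz => norm_pos_iff.1 (h.norm_pos hz).1).log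
    fun _ hz => (h.norm_pos hz).1.ne'

lemma contDiffOn_log_norm_image (h : M.Images Ω F) :
    ContDiffOn ℝ 1 (fun z => Real.log ‖F z‖) Ω :=
  (h.contDiffOn.norm ℝ fun _ hz => norm_pos_iff.1 (h.norm_pos hz).2).log
    fun _ hz => (h.norm_pos hz).2.ne'

/-- Near some point of any open subset of the imaged domain the image is rigid. -/
lemma exists_rigid (h : M.Images Ω F) {W : Set (EuclideanSpace ℝ (Fin d))} (hW : IsOpen W)
    (hne : W.Nonempty) (hWΩ : W ⊆ Ω) :
    ∃ V ⊆ W, IsOpen V ∧ V.Nonempty ∧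
      (∃ ε : ℝ, ε ^ 2 = 1 ∧ ∀ z ∈ V, fderiv ℝ (fun z => Real.log ‖F z‖) z =
        ε • fderiv ℝ (fun z => Real.log ‖z‖) z) ∧
      (∀ z ∈ V, M.turningParameter ‖z‖ = M.turningParameter ‖F z‖) ∧
      ∃ c, ∀ z ∈ V, ⟪z, F z⟫ / (‖z‖ * ‖F z‖) = c := by
  have hfan : ∀ A ∈ W, ∃ θ, M.radialPotential.FanJoined (Real.log ‖A‖) (Real.log ‖F A‖) θ ∧
      ⟪A, F A⟫ / (‖A‖ * ‖F A‖) = Real.cos θ := fun A hA => by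
    obtain ⟨-, -, θ, hf, b, hb, hAb, hB⟩ := (h.stigmatic A (hWΩ hA)).exists_fanJoined
    refine ⟨θ, hf, ?_⟩
    have e1 := congrArg (fun y => ⟪A, y⟫) hB
    simp only [inner_smul_right, inner_add_right, real_inner_self_eq_norm_sq, hAb] at e1
    have h1 := (h.norm_pos (hWΩ hA)).1
    have h2 := (h.norm_pos (hWΩ hA)).2
    rw [e1]
    field_simp
    ring
  choose! θ hθ hcos using hfan
  obtain ⟨V, hVW, hVo, hVne, hε, hE, c, hc⟩ := RadialPotential.exists_rigid hW hne
    (h.contDiffOn_log_norm.mono hWΩ) (h.contDiffOn_log_norm_image.mono hWΩ) hθ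
  refine ⟨V, hVW, hVo, hVne, hε, fun z hz => ?_, c, ?_⟩
  · have hzΩ := hWΩ (hVW hz)
    have := hE z hz (fderiv_log_norm_ne_zero (norm_pos_iff.1 (h.norm_pos hzΩ).1))
    rw [energy_log (h.norm_mem hzΩ).1, energy_log (h.norm_mem hzΩ).2] at this
    exact (pow_left_inj₀ (turningParameter_pos (h.norm_mem hzΩ).1).le
      (turningParameter_pos (h.norm_mem hzΩ).2).le two_ne_zero).1 this
  · refine eqOn_of_subset_closure hVo hc ?_ continuousOn_const fun z hz => ?_
    · have hsub := hVW.trans hWΩ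
      have hFc := h.contDiffOn.continuousOn.mono hsub
      exact (continuousOn_id.inner hFc).div (continuousOn_id.norm.mul hFc.norm)
        fun z hz => (mul_pos (h.norm_pos (hsub hz)).1 (h.norm_pos (hsub hz)).2).ne'
    · rw [hcos z (hVW hz.1)]
      exact hz.2

/-- A violation would persist on an open subset of Ω, but `exists_rigid` finds points of equality in
every such subset. -/
lemma turningParameter_eq (h : M.Images Ω F) {A : EuclideanSpace ℝ (Fin d)} (hA : A ∈ Ω) :
    M.turningParameter ‖A‖ = M.turningParameter ‖F A‖ := by
  have hN : ContinuousOn M.turningParameter M.region :=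
    continuousOn_id.mul M.contDiffOn_index.continuousOn
  have hc : ContinuousOn (fun z => M.turningParameter ‖z‖ - M.turningParameter ‖F z‖) Ω :=
    (hN.comp continuousOn_id.norm fun z hz => (h.norm_mem hz).1).sub
      (hN.comp h.contDiffOn.continuousOn.norm fun z hz => (h.norm_mem hz).2)
  by_contra hne
  obtain ⟨V, hVW, -, ⟨z, hz⟩, -, hV, -⟩ := h.exists_rigid
    (hc.isOpen_inter_preimage h.isOpen isOpen_ne) ⟨A, hA, sub_ne_zero.2 hne⟩ inter_subset_left
  exact (hVW hz).2 (sub_eq_zero.2 (hV z hz))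

/-- The angle between object and image is the same for all points. -/
lemma exists_inner_eq (h : M.Images Ω F) :
    ∃ c, ∀ z ∈ Ω, ⟪z, F z⟫ / (‖z‖ * ‖F z‖) = c := by
  have hcd : ContDiffOn ℝ 1 (fun z => ⟪z, F z⟫ / (‖z‖ * ‖F z‖)) Ω :=
    (contDiffOn_id.inner ℝ h.contDiffOn).div ((contDiffOn_id.norm ℝ fun z hz =>
      norm_pos_iff.1 (h.norm_pos hz).1).mul (h.contDiffOn.norm ℝ fun z hz =>
      norm_pos_iff.1 (h.norm_pos hz).2))
      fun z hz => (mul_pos (h.norm_pos hz).1 (h.norm_pos hz).2).ne'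
  refine h.isOpen.exists_is_const_of_fderiv_eq_zero h.isConnected.isPreconnected
    (hcd.differentiableOn one_ne_zero) fun A hA => ?_
  by_contra hne
  obtain ⟨V, hVW, hVo, ⟨z, hz⟩, -, -, c, hc⟩ := h.exists_rigid
    ((hcd.continuousOn_fderiv_of_isOpen h.isOpen le_rfl).isOpen_inter_preimage h.isOpen isOpen_ne)
    ⟨A, hA, hne⟩ inter_subset_left
  refine (hVW hz).2 ?_
  have : (fun z => ⟪z, F z⟫ / (‖z‖ * ‖F z‖)) =ᶠ[nhds z] fun _ => c := by
    filter_upwards [hVo.mem_nhds hz] with y hy using hc y hy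
  rw [this.fderiv_eq]
  simp

/-- The two branches. -/
lemma exists_norm_eq (h : M.Images Ω F) : ∃ k : ℝ, 0 < k ∧
    ((∀ A ∈ Ω, ‖F A‖ = k * ‖A‖) ∨ (∀ A ∈ Ω, ‖F A‖ = k / ‖A‖)) := by
  set a : EuclideanSpace ℝ (Fin d) → ℝ := fun z => Real.log ‖z‖
  set b : EuclideanSpace ℝ (Fin d) → ℝ := fun z => Real.log ‖F z‖
  have hac := h.contDiffOn_log_norm.continuousOn_fderiv_of_isOpen h.isOpen le_rfl
  have hbc := h.contDiffOn_log_norm_image.continuousOn_fderiv_of_isOpen h.isOpen le_rfl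
  -- Wp and Wm are where db ≠ −da and db ≠ da. They are open because F is C¹, disjoint by rigidity,
  -- and cover Ω because da ≠ 0; connectedness selects one branch.
  set Wp := Ω ∩ (fun z => fderiv ℝ b z + fderiv ℝ a z) ⁻¹' {0}ᶜ with hWp
  set Wm := Ω ∩ (fun z => fderiv ℝ b z - fderiv ℝ a z) ⁻¹' {0}ᶜ with hWm
  have hWpo : IsOpen Wp := (hbc.add hac).isOpen_inter_preimage h.isOpen isOpen_compl_singleton
  have hWmo : IsOpen Wm := (hbc.sub hac).isOpen_inter_preimage h.isOpen isOpen_compl_singleton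
  have hdisj : Wp ∩ Wm = ∅ := by
    by_contra hne
    obtain ⟨V, hVW, -, ⟨z, hz⟩, ⟨ε, hε, hV⟩, -⟩ := h.exists_rigid (hWpo.inter hWmo)
      (nonempty_iff_ne_empty.2 hne) fun z hz => hz.1.1
    have hz' := hV z hz
    obtain ⟨⟨-, h1⟩, ⟨-, h2⟩⟩ := hVW hz
    rcases mul_self_eq_one_iff.1 ((sq ε).symm.trans hε) with rfl | rfl
    · exact h2 (by simpa [sub_eq_zero] using! hz')
    · exact h1 (by simpa [add_eq_zero_iff_eq_neg] using! hz')
  have hcov : Ω ⊆ Wp ∪ Wm := fun z hz => by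
    by_contra hcon
    simp only [hWp, hWm, mem_union, mem_inter_iff, hz, true_and, mem_preimage, mem_compl_iff,
      mem_singleton_iff, not_or, not_not] at hcon
    refine fderiv_log_norm_ne_zero (norm_pos_iff.1 (h.norm_pos hz).1) ?_
    have h2 : (2 : ℝ) • fderiv ℝ a z = 0 := by
      rw [two_smul, ← sub_add_cancel (fderiv ℝ a z) (fderiv ℝ b z)]
      have e1 := hcon.1
      have e2 := hcon.2
      rw [sub_eq_zero] at e2
      rw [e2] at e1 ⊢
      simpa using e1
    exact (smul_eq_zero.1 h2).resolve_left two_ne_zero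
  have had := h.contDiffOn_log_norm.differentiableOn one_ne_zero
  have hbd := h.contDiffOn_log_norm_image.differentiableOn one_ne_zero
  have hdat : ∀ {f : EuclideanSpace ℝ (Fin d) → ℝ}, DifferentiableOn ℝ f Ω → ∀ z ∈ Ω,
    DifferentiableAt ℝ f z := fun hf z hz => hf.differentiableAt (h.isOpen.mem_nhds hz)
  rcases h.isConnected.isPreconnected.subset_or_subset hWpo hWmo
    (disjoint_iff_inter_eq_empty.2 hdisj) hcov with hs | hs
  · obtain ⟨κ, hκ⟩ := h.isOpen.exists_is_const_of_fderiv_eq_zero h.isConnected.isPreconnected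
      (hbd.sub had) fun z hz => by
        by_contra hne
        have : z ∈ Wp ∩ Wm := ⟨hs hz, hz, by
          rw [fderiv_sub (hdat hbd z hz) (hdat had z hz)] at hne
          exact hne⟩
        rw [hdisj] at this
        exact this
    refine ⟨Real.exp κ, Real.exp_pos κ, Or.inl fun A hA => ?_⟩
    have h1 : b A - a A = κ := hκ A hA
    have h2 := (h.norm_pos hA)
    rw [← Real.exp_log h2.2, ← Real.exp_log h2.1, ← Real.exp_add]
    congr 1
    linarith
  · obtain ⟨κ, hκ⟩ := h.isOpen.exists_is_const_of_fderiv_eq_zero h.isConnected.isPreconnected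
      (hbd.add had) fun z hz => by
        by_contra hne
        have : z ∈ Wp ∩ Wm := ⟨⟨hz, by
          rw [fderiv_add (hdat hbd z hz) (hdat had z hz)] at hne
          exact hne⟩, hs hz⟩
        rw [hdisj] at this
        exact this
    refine ⟨Real.exp κ, Real.exp_pos κ, Or.inr fun A hA => ?_⟩
    have h1 : b A + a A = κ := hκ A hA
    have h2 := (h.norm_pos hA)
    rw [← Real.exp_log h2.2, ← Real.exp_log h2.1, ← Real.exp_sub]
    congr 1
    linarith

end Images

end RadialMedium

/-! ### First branch: turning points and reversed rays -/

namespace RadialPotential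

variable {P : RadialPotential}

/-- A motion cannot cross a point at which it is turned back by the force. -/
lemma IsOrbit.mul_sub_nonneg {L U : ℝ} {x w : ℝ → ℝ} (h : P.IsOrbit L U x w) {s u σ : ℝ}
    (hs : s ∈ Icc 0 U) (hu : u ∈ Icc 0 U) (hE : P.energy (x s) = L ^ 2)
    (hσ : 0 < σ * P.force (x s)) : 0 ≤ σ * (x u - x s) := by
  by_contra! hneg
  -- Towards x u the energy has negative slope at x s, so it drops below L² at points the motion
  -- must cross, contrary to w² + L² = E.
  set g : ℝ → ℝ := fun t => P.energy (x s + t * (x u - x s)) with hg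
  have hd : HasDerivAt g (2 * P.force (x s) * (x u - x s)) 0 := by
    have e1 : HasDerivAt (fun t : ℝ => x s + t * (x u - x s)) (x u - x s) 0 := by
      simpa using ((hasDerivAt_id (0 : ℝ)).mul_const (x u - x s)).const_add (x s)
    have e2 := P.hasDerivAt_energy (x s) (h.mem_domain s hs)
    have e3 : HasDerivAt P.energy (2 * P.force (x s)) (x s + 0 * (x u - x s)) := by simpa using e2
    exact e3.comp 0 e1
  have hneg' : 2 * P.force (x s) * (x u - x s) < 0 := by
    have h1 : σ * P.force (x s) * (σ * (x u - x s)) < 0 := mul_neg_of_pos_of_neg hσ hneg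
    have h2 : σ ^ 2 * (P.force (x s) * (x u - x s)) < 0 := by linarith
    have h3 := neg_of_mul_neg_right h2 (sq_nonneg σ)
    linarith
  have hslope := hasDerivAt_iff_tendsto_slope_zero.1 hd
  have hev : ∀ᶠ t in nhdsWithin (0 : ℝ) (Ioi 0), g t < g 0 ∧ t < 1 := by
    have h1 := (hslope.eventually (gt_mem_nhds hneg')).filter_mono
      (nhdsWithin_mono 0 (fun t (ht : 0 < t) => ht.ne'))
    filter_upwards [h1, self_mem_nhdsWithin, mem_nhdsWithin_of_mem_nhds (gt_mem_nhds one_pos)]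
      with t ht ht0 ht1
    refine ⟨?_, ht1⟩
    rw [zero_add, smul_eq_mul] at ht
    have := neg_of_mul_neg_right ht (inv_pos.2 ht0).le
    linarith
  obtain ⟨t, ⟨ht, ht1⟩, ht0⟩ := (hev.and self_mem_nhdsWithin).exists
  have hmem : x s + t * (x u - x s) ∈ uIcc (x s) (x u) := by
    rw [mem_uIcc]
    have ht0' : 0 < t := ht0
    rcases le_total 0 (x u - x s) with hc | hc
    · left; constructor <;> nlinarith
    · right; constructor <;> nlinarith
  have hsub : uIcc s u ⊆ Icc 0 U := ordConnected_Icc.uIcc_subset hs hu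
  obtain ⟨v, hv, hvx⟩ := intermediate_value_uIcc (h.continuousOn_pos.mono hsub) hmem
  have h1 := h.conserved v (hsub hv)
  rw [hvx] at h1
  simp only [hg, zero_mul, add_zero, hE] at ht
  nlinarith [sq_nonneg (w v)]

/-- Two turning points with the same force coincide. -/
lemma IsOrbit.eq_of_turning {L U : ℝ} {x w : ℝ → ℝ} (h : P.IsOrbit L U x w) (hU : 0 ≤ U)
    (h0 : w 0 = 0) (h1 : w U = 0) (hf : P.force (x U) = P.force (x 0)) : x U = x 0 := by
  have m0 : (0 : ℝ) ∈ Icc 0 U := ⟨le_rfl, hU⟩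
  have m1 : U ∈ Icc 0 U := ⟨hU, le_rfl⟩
  have hE0 : P.energy (x 0) = L ^ 2 := by rw [← h.conserved 0 m0, h0]; ring
  have hE1 : P.energy (x U) = L ^ 2 := by rw [← h.conserved U m1, h1]; ring
  by_cases hz : P.force (x 0) = 0
  -- At an equilibrium the motion at rest is the only one.
  · have hc : P.IsOrbit L U (fun _ => x 0) (fun _ => 0) :=
      ⟨fun u _ => h.mem_domain 0 m0, fun u _ => hasDerivWithinAt_const _ _ _, fun u _ => by
        rw [hz]; exact hasDerivWithinAt_const _ _ _, fun u _ => by rw [hE0]; ring⟩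
    exact (h.eqOn hc rfl h0 U m1).1
  -- With forces of the same sign, each turning point lies on the allowed side of the other.
  · have hσ : 0 < P.force (x 0) * P.force (x 0) := mul_self_pos.2 hz
    have e1 := h.mul_sub_nonneg m0 m1 hE0 hσ
    have e2 := h.mul_sub_nonneg m1 m0 hE1 (by rwa [hf])
    have e3 : P.force (x 0) * (x U - x 0) = 0 := by linarith
    linarith [(mul_eq_zero.1 e3).resolve_left hz]

end RadialPotential

lemma exists_norm_eq_one_forall_inner_eq_zero {d : ℕ} (s : Finset (EuclideanSpace ℝ (Fin d)))
    (hs : s.card < d) :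
    ∃ c : EuclideanSpace ℝ (Fin d), ‖c‖ = 1 ∧ ∀ y ∈ s, ⟪y, c⟫ = 0 := by
  set K := Submodule.span ℝ (s : Set (EuclideanSpace ℝ (Fin d)))
  have h1 : Module.finrank ℝ K < d := (finrank_span_finset_le_card s).trans_lt hs
  have h2 := K.finrank_add_finrank_orthogonal
  rw [finrank_euclideanSpace_fin] at h2
  have h3 : 0 < Module.finrank ℝ Kᗮ := by omega
  obtain ⟨⟨c, hc⟩, hne⟩ := Module.finrank_pos_iff_exists_ne_zero.1 h3
  have hc0 : c ≠ 0 := fun h => hne (Subtype.ext h)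
  refine ⟨‖c‖⁻¹ • c, by rw [norm_smul, norm_inv, norm_norm, inv_mul_cancel₀ (norm_ne_zero_iff.2 hc0)],
    fun y hy => ?_⟩
  rw [inner_smul_right, (Submodule.mem_orthogonal K c).1 hc y (Submodule.subset_span hy), mul_zero]

namespace RadialMedium

variable {M : RadialMedium} {d : ℕ} {Ω : Set (EuclideanSpace ℝ (Fin d))}
  {F : EuclideanSpace ℝ (Fin d) → EuclideanSpace ℝ (Fin d)}

namespace Images

/-- A tangential launch is a turning point with L = N(r_A), and N(r_B) = N(r_A) makes the arrival
one too. As N(kr) = N(r) near r_A, the forces at both agree, and `eq_of_turning` gives log k = 0. -/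
lemma eq_one_of_tangential (h : M.Images Ω F) {k : ℝ} (hk : 0 < k)
    (hF : ∀ A ∈ Ω, ‖F A‖ = k * ‖A‖) {A u : EuclideanSpace ℝ (Fin d)} (hA : A ∈ Ω)
    (hu : ‖u‖ = 1) (hAu : ⟪A, u⟫ = 0) (hray : M.RayJoins A u (F A)) : k = 1 := by
  have hA0 := (h.norm_pos hA).1
  have hray' : M.RayJoins A (Real.cos (Real.pi / 2) • (‖A‖⁻¹ • A) +
      Real.sin (Real.pi / 2) • u) (F A) := by simpa using hray
  obtain ⟨U, x, w, hU, ho, hx0, hw0, hxU, -⟩ := hray'.exists_orbit hu hAu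
  rw [Real.cos_pi_div_two, mul_zero] at hw0
  have hwU : w U = 0 := by
    have := ho.conserved U ⟨hU.le, le_rfl⟩
    rw [hxU, energy_log (h.norm_mem hA).2, ← h.turningParameter_eq hA, Real.sin_pi_div_two,
      mul_one] at this
    exact pow_eq_zero_iff two_ne_zero |>.1 (by linarith)
  have hlog : Real.log ‖F A‖ = Real.log ‖A‖ + Real.log k := by
    rw [hF A hA, Real.log_mul hk.ne' hA0.ne', add_comm]
  have hpD : Real.log ‖A‖ ∈ M.radialPotential.domain := by
    change Real.exp _ ∈ M.region; rw [Real.exp_log hA0]; exact (h.norm_mem hA).1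
  have hqD : Real.log ‖A‖ + Real.log k ∈ M.radialPotential.domain := by
    rw [← hlog]
    change Real.exp _ ∈ M.region; rw [Real.exp_log (h.norm_pos hA).2]; exact (h.norm_mem hA).2
  have hev : ∀ᶠ y in nhds (Real.log ‖A‖), M.radialPotential.energy (y + Real.log k) =
      M.radialPotential.energy y := by
    have hc : ContinuousAt (fun y : ℝ => (Real.exp y * ‖A‖⁻¹) • A) (Real.log ‖A‖) := by fun_prop
    have hm : (fun y : ℝ => (Real.exp y * ‖A‖⁻¹) • A) (Real.log ‖A‖) ∈ Ω := by
      simp only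
      rwa [Real.exp_log hA0, mul_inv_cancel₀ hA0.ne', one_smul]
    filter_upwards [hc.eventually (h.isOpen.eventually_mem hm)] with y hy
    have hn : ‖(Real.exp y * ‖A‖⁻¹) • A‖ = Real.exp y := by
      rw [norm_smul, Real.norm_of_nonneg (by positivity), mul_assoc, inv_mul_cancel₀ hA0.ne',
        mul_one]
    have h1 := h.turningParameter_eq hy
    have h2 := energy_log (h.norm_mem hy).1
    have h3 := energy_log (h.norm_mem hy).2
    rw [← h1, ← h2, hF _ hy, hn, Real.log_mul hk.ne' (Real.exp_pos y).ne', Real.log_exp,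
      add_comm] at h3
    exact h3
  have hforce : M.radialPotential.force (Real.log ‖A‖ + Real.log k) =
      M.radialPotential.force (Real.log ‖A‖) := by
    have e1 := (M.radialPotential.hasDerivAt_energy _ hqD).comp_add_const _ _
    have e2 := (M.radialPotential.hasDerivAt_energy _ hpD).congr_of_eventuallyEq hev
    linarith [e1.unique e2]
  have := ho.eq_of_turning hU.le hw0 hwU (by rw [hxU, hx0, hlog, hforce])
  rw [hxU, hx0, hlog] at this
  have hlk : Real.log k = 0 := by linarith
  rw [← Real.exp_log hk, hlk, Real.exp_zero]

/-- Tracing the rays backwards, a first-branch instrument with ratio `k` also forms images with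
ratio `k⁻¹`. -/
lemma exists_images_inv (h : M.Images Ω F) (hd : 2 ≤ d) {k : ℝ} (hk : 0 < k)
    (hF : ∀ A ∈ Ω, ‖F A‖ = k * ‖A‖) :
    ∃ (Ω' : Set (EuclideanSpace ℝ (Fin d))) (F' : EuclideanSpace ℝ (Fin d) →
      EuclideanSpace ℝ (Fin d)), M.Images Ω' F' ∧ ∀ A ∈ Ω', ‖F' A‖ = k⁻¹ * ‖A‖ := by
  obtain ⟨A₀, hA₀⟩ := h.isConnected.nonempty
  have hA0 := (h.norm_pos hA₀).1
  obtain ⟨c₀, hc₀⟩ := h.exists_inner_eq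
  have hfan : ∀ A ∈ Ω, ∃ θ, Real.cos θ = c₀ ∧
      M.radialPotential.FanJoined (Real.log ‖A‖) (Real.log (k * ‖A‖)) θ := fun A hA => by
    obtain ⟨-, -, θ, hf, b, hb, hAb, hB⟩ := (h.stigmatic A hA).exists_fanJoined
    refine ⟨θ, ?_, by rwa [← hF A hA]⟩
    have e1 := congrArg (fun y => ⟪A, y⟫) hB
    simp only [inner_smul_right, inner_add_right, real_inner_self_eq_norm_sq, hAb] at e1
    have h1 := (h.norm_pos hA).1
    have h2 := (h.norm_pos hA).2
    rw [← hc₀ A hA, e1]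
    field_simp
    ring
  obtain ⟨θ₀, hθ₀, -⟩ := hfan A₀ hA₀
  set s₀ := Real.sin θ₀
  have hcs : c₀ ^ 2 + s₀ ^ 2 = 1 := by rw [← hθ₀]; linarith [Real.sin_sq_add_cos_sq θ₀]
  obtain ⟨e, he1, heA⟩ := exists_norm_eq_one_forall_inner_eq_zero {A₀} (by simpa using by omega)
  replace heA : ⟪A₀, e⟫ = 0 := heA A₀ (by simp)
  -- ‖x‖² times the component of e orthogonal to x: a smooth choice of the plane for the reversed
  -- rays near k A₀. The map F is not inverted; only its radial fans are reversed, and these occur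
  -- in every plane through the centre.
  set p : EuclideanSpace ℝ (Fin d) → EuclideanSpace ℝ (Fin d) :=
    fun x => ‖x‖ ^ 2 • e - ⟪x, e⟫ • x with hp
  have hpx : ∀ x, ⟪x, p x⟫ = 0 := fun x => by
    simp only [hp, inner_sub_right, inner_smul_right, real_inner_self_eq_norm_sq]
    ring
  have hpc : ContDiff ℝ 1 p := ((contDiff_norm_sq ℝ).smul contDiff_const).sub
    ((contDiff_id.inner ℝ contDiff_const).smul contDiff_id)
  set x₀ := k • A₀ with hx₀
  have hx₀n : ‖x₀‖ = k * ‖A₀‖ := by rw [hx₀, norm_smul, Real.norm_of_nonneg hk.le]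
  have hx₀0 : x₀ ≠ 0 := norm_pos_iff.1 (by rw [hx₀n]; positivity)
  have hpx₀ : p x₀ ≠ 0 := by
    simp only [hp, hx₀, inner_smul_left, heA, mul_zero, zero_smul, sub_zero]
    rw [← hx₀]
    refine smul_ne_zero (pow_ne_zero 2 (norm_ne_zero_iff.2 hx₀0)) fun h0 => ?_
    simp [h0] at he1
  have hev : ∀ᶠ x in nhds x₀, (‖x‖ * (k * ‖A₀‖)⁻¹) • A₀ ∈ Ω ∧ x ≠ 0 ∧ p x ≠ 0 := by
    have hc : ContinuousAt (fun x : EuclideanSpace ℝ (Fin d) => (‖x‖ * (k * ‖A₀‖)⁻¹) • A₀) x₀ := by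
      fun_prop
    have hm : (fun x : EuclideanSpace ℝ (Fin d) => (‖x‖ * (k * ‖A₀‖)⁻¹) • A₀) x₀ ∈ Ω := by
      simp only
      rwa [hx₀n, mul_inv_cancel₀ (by positivity), one_smul]
    exact (hc.eventually (h.isOpen.eventually_mem hm)).and
      ((isOpen_ne.eventually_mem hx₀0).and (hpc.continuous.continuousAt.eventually
      (isOpen_ne.eventually_mem hpx₀)))
  obtain ⟨r, hr, hball⟩ := Metric.eventually_nhds_iff_ball.1 hev
  have hnb : ∀ x ∈ Metric.ball x₀ r, ‖‖p x‖⁻¹ • p x‖ = 1 := fun x hx => by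
    rw [norm_smul, norm_inv, norm_norm, inv_mul_cancel₀ (norm_ne_zero_iff.2 (hball x hx).2.2)]
  have hnx : ∀ x ∈ Metric.ball x₀ r, 0 < ‖x‖ := fun x hx => norm_pos_iff.2 (hball x hx).2.1
  set F' : EuclideanSpace ℝ (Fin d) → EuclideanSpace ℝ (Fin d) :=
    fun x => k⁻¹ • (c₀ • x + (s₀ * ‖x‖) • (‖p x‖⁻¹ • p x)) with hF'
  refine ⟨Metric.ball x₀ r, F', ⟨Metric.isOpen_ball, (convex_ball x₀ r).isConnected
    ⟨x₀, Metric.mem_ball_self hr⟩, ?_, fun x hx => ?_⟩, fun x hx => ?_⟩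
  · have hpc' : ContDiffOn ℝ 1 p (Metric.ball x₀ r) := hpc.contDiffOn
    have h1 : ContDiffOn ℝ 1 (fun x : EuclideanSpace ℝ (Fin d) => ‖x‖) (Metric.ball x₀ r) :=
      contDiffOn_id.norm ℝ fun x hx => (hball x hx).2.1
    have h2 : ContDiffOn ℝ 1 (fun x => ‖p x‖⁻¹) (Metric.ball x₀ r) :=
      (hpc'.norm ℝ fun x hx => (hball x hx).2.2).inv fun x hx =>
        norm_ne_zero_iff.2 (hball x hx).2.2
    have h3 : ContDiffOn ℝ 1 (fun x => s₀ * ‖x‖) (Metric.ball x₀ r) := contDiffOn_const.mul h1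
    exact (((contDiffOn_id.const_smul c₀).add (h3.smul (h2.smul hpc'))).const_smul k⁻¹)
  · obtain ⟨hAΩ, hx0, hpx0⟩ := hball x hx
    have hn := hnx x hx
    obtain ⟨θ, hθ, hfanθ⟩ := hfan _ hAΩ
    have hnA : ‖(‖x‖ * (k * ‖A₀‖)⁻¹) • A₀‖ = k⁻¹ * ‖x‖ := by
      rw [norm_smul, Real.norm_of_nonneg (by positivity)]
      field_simp
    rw [hnA, mul_inv_cancel_left₀ hk.ne'] at hfanθ
    have hs : Real.sin θ ^ 2 = s₀ ^ 2 := by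
      have := Real.sin_sq_add_cos_sq θ
      rw [hθ] at this
      linarith
    -- Only cos θ is known to be constant; a change of sign of sin θ is absorbed into b.
    obtain ⟨b, hb1, hxb, hbs⟩ : ∃ b : EuclideanSpace ℝ (Fin d), ‖b‖ = 1 ∧ ⟪x, b⟫ = 0 ∧
        Real.sin θ • b = s₀ • (‖p x‖⁻¹ • p x) := by
      rcases sq_eq_sq_iff_eq_or_eq_neg.1 hs with hs | hs
      · exact ⟨_, hnb x hx, by rw [inner_smul_right, hpx, mul_zero], by rw [hs]⟩
      · exact ⟨-(‖p x‖⁻¹ • p x), by rw [norm_neg, hnb x hx], by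
          rw [inner_neg_right, inner_smul_right, hpx, mul_zero, neg_zero], by
          rw [hs, neg_smul, smul_neg, neg_neg]⟩
    have himg := isStigmaticImage_of_fanJoined hfanθ.symm (a := ‖x‖⁻¹ • x) (b := b)
      (by rw [norm_smul, norm_inv, norm_norm, inv_mul_cancel₀ hn.ne']) hb1
      (by rw [inner_smul_left, hxb, mul_zero])
    rw [Real.exp_log hn, Real.exp_log (by positivity), smul_smul, mul_inv_cancel₀ hn.ne', one_smul,
      hθ, hbs] at himg
    convert himg using 1
    simp only [hF', smul_add, smul_smul]
    congr 2
    · field_simp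
    · ring
  · have hn := hnx x hx
    have h1 : ‖c₀ • x + (s₀ * ‖x‖) • (‖p x‖⁻¹ • p x)‖ ^ 2 = ‖x‖ ^ 2 := by
      have h2 := norm_add_sq_real (c₀ • x) ((s₀ * ‖x‖) • (‖p x‖⁻¹ • p x))
      rw [h2, inner_smul_left, inner_smul_right, inner_smul_right, hpx, norm_smul,
        norm_smul (s₀ * ‖x‖), hnb x hx, Real.norm_eq_abs, Real.norm_eq_abs, mul_pow, sq_abs,
        mul_one, sq_abs]
      linear_combination ‖x‖ ^ 2 * hcs
    simp only [hF']
    rw [norm_smul, (pow_left_inj₀ (norm_nonneg _) hn.le two_ne_zero).1 h1,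
      Real.norm_of_nonneg (inv_pos.2 hk).le]

end Images

end RadialMedium

/-! ### Strong images and the isometry -/

/-- The rotation of the plane by the angle with cosine `c` and sine `s`. -/
noncomputable def planeRotation (c s : ℝ) (h : c ^ 2 + s ^ 2 = 1) :
    EuclideanSpace ℝ (Fin 2) ≃ₗᵢ[ℝ] EuclideanSpace ℝ (Fin 2) :=
  LinearIsometry.toLinearIsometryEquiv
    { toFun := fun x => !₂[c * x 0 - s * x 1, s * x 0 + c * x 1]
      map_add' := fun x y => by ext i; fin_cases i <;> simp <;> ring
      map_smul' := fun r x => by ext i; fin_cases i <;> simp <;> ring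
      norm_map' := fun x => by
        simp only [EuclideanSpace.norm_eq, Fin.sum_univ_two, Real.norm_eq_abs, sq_abs]
        congr 1
        simp
        linear_combination (x 0 ^ 2 + x 1 ^ 2) * h } rfl

lemma planeRotation_apply (c s : ℝ) (h : c ^ 2 + s ^ 2 = 1) (x : EuclideanSpace ℝ (Fin 2)) :
    planeRotation c s h x = !₂[c * x 0 - s * x 1, s * x 0 + c * x 1] := rfl

namespace RadialMedium

variable {M : RadialMedium} {d : ℕ} {Ω : Set (EuclideanSpace ℝ (Fin d))}
  {F : EuclideanSpace ℝ (Fin d) → EuclideanSpace ℝ (Fin d)}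

/-- Only rays in the plane of object and image pass through the image. -/
lemma RayJoins.inner_eq_zero {A B b c u : EuclideanSpace ℝ (Fin d)} {θ : ℝ}
    (h : M.RayJoins A u B) (hu : ‖u‖ = 1) (hAb : ⟪A, b⟫ = 0) (hb : ‖b‖ = 1)
    (hB : B = ‖B‖ • (Real.cos θ • (‖A‖⁻¹ • A) + Real.sin θ • b)) (hθ : Real.sin θ ≠ 0)
    (hcA : ⟪A, c⟫ = 0) (hcb : ⟪b, c⟫ = 0) : ⟪u, c⟫ = 0 := by
  have hA0 : 0 < ‖A‖ := M.region_pos h.norm_mem.1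
  have hB0 : 0 < ‖B‖ := M.region_pos h.norm_mem.2
  set t := ‖A‖⁻¹ * ⟪A, u⟫ with ht
  set y := u - t • (‖A‖⁻¹ • A) with hy
  have huy : u = t • (‖A‖⁻¹ • A) + y := by rw [hy]; abel
  have hAy : ⟪A, y⟫ = 0 := by
    rw [hy, inner_sub_right, inner_smul_right, inner_smul_right, real_inner_self_eq_norm_sq, ht]
    field_simp
    ring
  have huc : ⟪u, c⟫ = ⟪y, c⟫ := by
    rw [huy, inner_add_left, inner_smul_left, inner_smul_left, hcA]
    simp
  by_cases hy0 : y = 0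
  · rw [huc, hy0, inner_zero_left]
  have hyn : 0 < ‖y‖ := norm_pos_iff.2 hy0
  have hty : t ^ 2 + ‖y‖ ^ 2 = 1 := by
    have h1 := norm_add_sq_real (t • (‖A‖⁻¹ • A)) y
    rw [← huy, hu, inner_smul_left, inner_smul_left, hAy, norm_smul, norm_smul, norm_inv, norm_norm,
      inv_mul_cancel₀ hA0.ne', mul_one, Real.norm_eq_abs, sq_abs] at h1
    simp at h1
    linarith
  obtain ⟨ψ, hc, hs⟩ := exists_cos_sin_eq hty
  have huψ : u = Real.cos ψ • (‖A‖⁻¹ • A) + Real.sin ψ • (‖y‖⁻¹ • y) := by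
    rw [hc, hs, smul_smul ‖y‖, mul_inv_cancel₀ hyn.ne', one_smul, ← huy]
  rw [huψ] at h
  obtain ⟨U, x, w, -, -, -, -, -, hB'⟩ := h.exists_orbit
    (by rw [norm_smul, norm_inv, norm_norm, inv_mul_cancel₀ hyn.ne'])
    (by rw [inner_smul_right, hAy, mul_zero])
  set φ := M.turningParameter ‖A‖ * Real.sin ψ * U
  have e1 : ⟪b, B⟫ = ‖B‖ * Real.sin θ := by
    rw [congrArg (fun z => ⟪b, z⟫) hB]
    simp only [inner_smul_right, inner_add_right, real_inner_self_eq_norm_sq, hb,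
      real_inner_comm A b, hAb]
    ring
  have e2 : ⟪b, B⟫ = ‖B‖ * (Real.sin φ * (‖y‖⁻¹ * ⟪b, y⟫)) := by
    rw [congrArg (fun z => ⟪b, z⟫) hB']
    simp only [inner_smul_right, inner_add_right, real_inner_comm A b, hAb]
    ring
  have e3 : ⟪c, B⟫ = 0 := by
    rw [congrArg (fun z => ⟪c, z⟫) hB]
    simp only [inner_smul_right, inner_add_right, real_inner_comm A c, real_inner_comm b c, hcA,
      hcb]
    ring
  have e4 : ⟪c, B⟫ = ‖B‖ * (Real.sin φ * (‖y‖⁻¹ * ⟪c, y⟫)) := by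
    rw [congrArg (fun z => ⟪c, z⟫) hB']
    simp only [inner_smul_right, inner_add_right, real_inner_comm A c, hcA]
    ring
  -- B has a nonzero component along b, so its component along y does not vanish either; as B is
  -- orthogonal to c, so must be y.
  have hφ : Real.sin φ ≠ 0 := fun h0 => by
    rw [e1, h0, zero_mul, mul_zero] at e2
    exact mul_ne_zero hB0.ne' hθ e2
  rw [e3] at e4
  rw [huc, real_inner_comm c y]
  have := (mul_eq_zero.1 e4.symm).resolve_left hB0.ne'
  have := (mul_eq_zero.1 this).resolve_left hφ
  exact (mul_eq_zero.1 this).resolve_left (inv_pos.2 hyn).ne'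

/-- Otherwise all rays through B start in the plane of A and b. For d > 2 some c is orthogonal to
this plane, and tilting an admissible direction slightly towards c leaves the plane but not the open
set. -/
lemma IsStrongImage.sin_eq_zero (hd : 2 < d) {A B b : EuclideanSpace ℝ (Fin d)} {θ : ℝ}
    (h : M.IsStrongImage A B) (hAb : ⟪A, b⟫ = 0) (hb : ‖b‖ = 1)
    (hB : B = ‖B‖ • (Real.cos θ • (‖A‖⁻¹ • A) + Real.sin θ • b)) : Real.sin θ = 0 := by
  classical
  obtain ⟨O, hO, ⟨u, huO, hu⟩, H⟩ := h
  by_contra hθ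
  obtain ⟨c, hc1, hc⟩ := exists_norm_eq_one_forall_inner_eq_zero {A, b}
    ((Finset.card_le_two).trans_lt hd)
  have hcA : ⟪A, c⟫ = 0 := hc A (by simp)
  have hcb : ⟪b, c⟫ = 0 := hc b (by simp)
  have huc := (H u huO hu).inner_eq_zero hu hAb hb hB hθ hcA hcb
  have hcont : ContinuousAt (fun t : ℝ => ‖u + t • c‖⁻¹ • (u + t • c)) 0 := by
    have h1 : ContinuousAt (fun t : ℝ => ‖u + t • c‖) 0 := by fun_prop
    have h2 : ContinuousAt (fun t : ℝ => u + t • c) 0 := by fun_prop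
    exact (h1.inv₀ (by simp [hu])).smul h2
  have hm : (fun t : ℝ => ‖u + t • c‖⁻¹ • (u + t • c)) 0 ∈ O := by simpa [hu] using huO
  have hev : ∀ᶠ t in nhdsWithin (0 : ℝ) (Ioi 0), ‖u + t • c‖⁻¹ • (u + t • c) ∈ O :=
    (hcont.eventually (hO.eventually_mem hm)).filter_mono nhdsWithin_le_nhds
  obtain ⟨t, ht, ht0⟩ := (hev.and self_mem_nhdsWithin).exists
  have ht0' : 0 < t := ht0
  have hinner : ⟪u + t • c, c⟫ = t := by
    rw [inner_add_left, huc, inner_smul_left, real_inner_self_eq_norm_sq, hc1]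
    simp
  have hne : u + t • c ≠ 0 := fun h0 => by
    rw [h0, inner_zero_left] at hinner
    exact ht0'.ne hinner
  have hn : 0 < ‖u + t • c‖ := norm_pos_iff.2 hne
  have h1 : ‖‖u + t • c‖⁻¹ • (u + t • c)‖ = 1 := by
    rw [norm_smul, norm_inv, norm_norm, inv_mul_cancel₀ hn.ne']
  have h2 := (H _ ht h1).inner_eq_zero h1 hAb hb hB hθ hcA hcb
  rw [inner_smul_left, hinner] at h2
  have := (mul_eq_zero.1 h2).resolve_left (inv_pos.2 hn).ne'
  exact ht0'.ne' this

namespace Images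

/-- The cosine c of the angle from A to F A is constant. Its oriented sine is continuous with
constant square 1 − c², hence constant on the connected Ω, so the angle is that of one rotation. -/
lemma exists_isometry_of_two {Ω : Set (EuclideanSpace ℝ (Fin 2))}
    {F : EuclideanSpace ℝ (Fin 2) → EuclideanSpace ℝ (Fin 2)} (h : M.Images Ω F) :
    ∃ Q : EuclideanSpace ℝ (Fin 2) ≃ₗᵢ[ℝ] EuclideanSpace ℝ (Fin 2),
      ∀ A ∈ Ω, F A = (‖F A‖ / ‖A‖) • Q A := by
  obtain ⟨c, hc⟩ := h.exists_inner_eq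
  set f : EuclideanSpace ℝ (Fin 2) → ℝ :=
    fun A => (A 0 * F A 1 - A 1 * F A 0) / (‖A‖ * ‖F A‖) with hf
  have hFc := h.contDiffOn.continuousOn
  have hfc : ContinuousOn f Ω := by
    have h0 : ∀ i, ContinuousOn (fun A => F A i) Ω := fun i =>
      (EuclideanSpace.proj (𝕜 := ℝ) i).continuous.comp_continuousOn hFc
    have h1 : ∀ i, ContinuousOn (fun A : EuclideanSpace ℝ (Fin 2) => A i) Ω := fun i =>
      (EuclideanSpace.proj (𝕜 := ℝ) i).continuous.continuousOn
    exact (((h1 0).mul (h0 1)).sub ((h1 1).mul (h0 0))).div (continuousOn_id.norm.mul hFc.norm)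
      fun z hz => (mul_pos (h.norm_pos hz).1 (h.norm_pos hz).2).ne'
  have hnsq : ∀ A : EuclideanSpace ℝ (Fin 2), ‖A‖ ^ 2 = A 0 ^ 2 + A 1 ^ 2 := fun A => by
    rw [EuclideanSpace.norm_sq_eq, Fin.sum_univ_two, Real.norm_eq_abs, Real.norm_eq_abs, sq_abs,
      sq_abs]
  have hin : ∀ A B : EuclideanSpace ℝ (Fin 2), ⟪A, B⟫ = A 0 * B 0 + A 1 * B 1 := fun A B => by
    rw [PiLp.inner_apply, Fin.sum_univ_two]
    simp [mul_comm]
  have hsq : ∀ A ∈ Ω, c ^ 2 + f A ^ 2 = 1 := fun A hA => by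
    have h1 := (h.norm_pos hA).1
    have h2 := (h.norm_pos hA).2
    rw [← hc A hA, hin, hf]
    field_simp
    rw [hnsq, hnsq]
    ring
  obtain ⟨s, hs⟩ : ∃ s, ∀ A ∈ Ω, f A = s := by
    by_cases hc1 : 1 - c ^ 2 = 0
    · exact ⟨0, fun A hA => pow_eq_zero_iff two_ne_zero |>.1 (by linarith [hsq A hA])⟩
    · obtain ⟨A₁, hA₁⟩ := h.isConnected.nonempty
      have hpos : 0 ≤ 1 - c ^ 2 := by linarith [hsq A₁ hA₁, sq_nonneg (f A₁)]
      rcases h.isConnected.isPreconnected.eq_or_eq_neg_of_sq_eq hfc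
        (continuousOn_const (c := √(1 - c ^ 2))) (fun A hA => by
          simp only [Pi.pow_apply]
          rw [Real.sq_sqrt hpos]; linarith [hsq A hA])
        (fun {A} _ => (Real.sqrt_pos.2 (lt_of_le_of_ne hpos (Ne.symm hc1))).ne') with h1 | h1
      · exact ⟨_, h1⟩
      · exact ⟨_, h1⟩
  obtain ⟨A₁, hA₁⟩ := h.isConnected.nonempty
  have hcs : c ^ 2 + s ^ 2 = 1 := by rw [← hs A₁ hA₁]; exact hsq A₁ hA₁
  refine ⟨planeRotation c s hcs, fun A hA => ?_⟩
  have h1 := (h.norm_pos hA).1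
  have h2 := (h.norm_pos hA).2
  have hcA := hc A hA
  have hsA := hs A hA
  rw [div_eq_iff (by positivity), hin] at hcA
  simp only [hf] at hsA
  rw [div_eq_iff (by positivity)] at hsA
  have hA2 := hnsq A
  rw [planeRotation_apply]
  ext i
  fin_cases i
  · simp
    field_simp
    apply mul_left_cancel₀ h1.ne'
    linear_combination A 0 * hcA - A 1 * hsA + F A 0 * hA2
  · simp
    field_simp
    apply mul_left_cancel₀ h1.ne'
    linear_combination A 1 * hcA + A 0 * hsA + F A 1 * hA2

/-- Strong images are related to their objects by an orthogonal map and a radial scaling. -/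
lemma exists_isometry (h : M.Images Ω F) (hd : 2 ≤ d) (hs : ∀ A ∈ Ω, M.IsStrongImage A (F A)) :
    ∃ Q : EuclideanSpace ℝ (Fin d) ≃ₗᵢ[ℝ] EuclideanSpace ℝ (Fin d),
      ∀ A ∈ Ω, F A = (‖F A‖ / ‖A‖) • Q A := by
  rcases hd.eq_or_lt with rfl | hd
  · exact h.exists_isometry_of_two
  obtain ⟨c, hc⟩ := h.exists_inner_eq
  -- With sin θ = 0 the image lies on the line through A and the centre, so Q is the identity or the
  -- central reflection.
  have key : ∀ A ∈ Ω, F A = (‖F A‖ / ‖A‖) • (c • A) ∧ c ^ 2 = 1 := fun A hA => by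
    obtain ⟨-, -, θ, -, b, hb, hAb, hB⟩ := (h.stigmatic A hA).exists_fanJoined
    have hsin := (hs A hA).sin_eq_zero hd hAb hb hB
    have h1 := (h.norm_pos hA).1
    have h2 := (h.norm_pos hA).2
    have hcos : c = Real.cos θ := by
      rw [← hc A hA, congrArg (fun y => ⟪A, y⟫) hB]
      simp only [inner_smul_right, inner_add_right, real_inner_self_eq_norm_sq, hAb]
      field_simp
      ring
    refine ⟨?_, by rw [hcos]; have := Real.sin_sq_add_cos_sq θ; rw [hsin] at this; linarith⟩
    rw [hsin, zero_smul, add_zero, ← hcos] at hB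
    nth_rewrite 1 [hB]
    simp only [smul_smul]
    congr 1
    ring
  obtain ⟨A₁, hA₁⟩ := h.isConnected.nonempty
  rcases mul_self_eq_one_iff.1 ((sq c).symm.trans (key A₁ hA₁).2) with rfl | rfl
  · exact ⟨LinearIsometryEquiv.refl ℝ _, fun A hA => by simpa using (key A hA).1⟩
  · exact ⟨LinearIsometryEquiv.neg ℝ, fun A hA => by simpa using (key A hA).1⟩

end Images

end RadialMedium

/-! ### Symmetric potentials and the first turning time -/

namespace RadialPotential

variable {P : RadialPotential}

/-- `(x, w)` is a radial motion that starts outwards from `0` and has its first turning point at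
time `S`. -/
structure IsRise (P : RadialPotential) (L S : ℝ) (x w : ℝ → ℝ) : Prop where
  orbit : P.IsOrbit L S x w
  time_pos : 0 < S
  pos_zero : x 0 = 0
  mom_pos : ∀ u ∈ Ico 0 S, 0 < w u
  mom_end : w S = 0

/-- The potential is that of a medium which fills space and is symmetric under the inversion
`x ↦ -x`. -/
structure IsSymm (P : RadialPotential) : Prop where
  domain_eq : P.domain = univ
  energy_neg : ∀ x, P.energy (-x) = P.energy x
  force_neg : ∀ x, P.force (-x) = -P.force x

namespace IsOrbit

variable {L U : ℝ} {x w : ℝ → ℝ}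

lemma neg (hP : P.IsSymm) (h : P.IsOrbit L U x w) :
    P.IsOrbit L U (fun u => -x u) (fun u => -w u) where
  mem_domain u _ := by rw [hP.domain_eq]; trivial
  deriv_pos u hu := (h.deriv_pos u hu).neg
  deriv_mom u hu := by rw [hP.force_neg]; exact (h.deriv_mom u hu).neg
  conserved u hu := by rw [hP.energy_neg, neg_sq]; exact h.conserved u hu

/-- By Rolle's theorem w vanishes somewhere; the least zero is the turning point, as w cannot become
negative without an earlier zero. -/
lemma exists_isRise (h : P.IsOrbit L U x w) (hU : 0 < U) (h0 : x 0 = 0) (hw : 0 < w 0)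
    (hx : x U = 0) : ∃ S, P.IsRise L S x w := by
  obtain ⟨c, hc, hwc⟩ := exists_hasDerivAt_eq_zero hU h.continuousOn_pos (h0.trans hx.symm)
    fun u hu => h.hasDerivAt_pos hu
  have hK : IsCompact (Icc 0 U ∩ w ⁻¹' {0}) :=
    isCompact_Icc.of_isClosed_subset (h.continuousOn_mom.preimage_isClosed_of_isClosed
      isClosed_Icc isClosed_singleton) inter_subset_left
  obtain ⟨S, ⟨hS, hwS⟩, hleast⟩ := hK.exists_isLeast ⟨c, Ioo_subset_Icc_self hc, hwc⟩
  have hS0 : 0 < S := hS.1.lt_of_ne fun e => by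
    rw [← e] at hwS
    exact hw.ne' hwS
  refine ⟨S, h.restrict hS.2, hS0, h0, fun u hu => ?_, hwS⟩
  by_contra! hneg
  obtain ⟨v, hv, hwv⟩ := intermediate_value_Icc' hu.1
    (h.continuousOn_mom.mono (Icc_subset_Icc_right (hu.2.le.trans hS.2))) ⟨hneg, hw.le⟩
  exact (hv.2.trans_lt hu.2).not_ge
    (hleast ⟨⟨hv.1, hv.2.trans (hu.2.le.trans hS.2)⟩, hwv⟩)

end IsOrbit

namespace IsRise

variable {L S U : ℝ} {x w y v : ℝ → ℝ}

lemma strictMonoOn (h : P.IsRise L S x w) : StrictMonoOn x (Icc 0 S) := by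
  refine strictMonoOn_of_deriv_pos (convex_Icc 0 S) h.orbit.continuousOn_pos fun u hu => ?_
  rw [interior_Icc] at hu
  rw [(h.orbit.hasDerivAt_pos hu).deriv]
  exact h.mom_pos u (Ioo_subset_Ico_self hu)

lemma pos (h : P.IsRise L S x w) {u : ℝ} (hu : u ∈ Ioc 0 S) : 0 < x u := by
  have := h.strictMonoOn ⟨le_rfl, h.time_pos.le⟩ (Ioc_subset_Icc_self hu) hu.1
  rwa [h.pos_zero] at this

lemma image_Ioo (h : P.IsRise L S x w) : x '' Ioo 0 S = Ioo 0 (x S) := by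
  refine Subset.antisymm ?_ ?_
  · rintro _ ⟨u, hu, rfl⟩
    exact ⟨h.pos (Ioo_subset_Ioc_self hu), h.strictMonoOn (Ioo_subset_Icc_self hu)
      ⟨h.time_pos.le, le_rfl⟩ hu.2⟩
  · have := intermediate_value_Ioo h.time_pos.le h.orbit.continuousOn_pos
    rwa [h.pos_zero] at this

lemma energy_end (h : P.IsRise L S x w) : P.energy (x S) = L ^ 2 := by
  rw [← h.orbit.conserved S ⟨h.time_pos.le, le_rfl⟩, h.mom_end]
  ring

/-- After the turning point the motion retraces its path. -/
lemma retrace (h : P.IsRise L S y v) (ho : P.IsOrbit L U x w) (hx : x 0 = 0) (hw : w 0 = v 0)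
    (hSU : S ≤ U) {u : ℝ} (hu : u ∈ Icc 0 S) (huU : S + u ≤ U) :
    x (S + u) = y (S - u) ∧ w (S + u) = -v (S - u) := by
  obtain ⟨e1, e2⟩ := (ho.restrict hSU).eqOn h.orbit (hx.trans h.pos_zero.symm) hw S ⟨h.time_pos.le, le_rfl⟩
  refine (ho.sub (s := S) (V := u) h.time_pos.le huU).eqOn (h.orbit.reverse.restrict hu.2)
    ?_ ?_ u ⟨hu.1, le_rfl⟩
  · simpa using e1
  · simpa [h.mom_end] using e2

lemma two_mul_time_le (h : P.IsRise L S y v) (ho : P.IsOrbit L U x w) (hU : 0 < U)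
    (hx : x 0 = 0) (hw : w 0 = v 0) (hxU : x U = 0) : 2 * S ≤ U := by
  have hy := h.pos_zero
  rcases le_or_gt U S with hUS | hUS
  · have := (ho.eqOn (h.orbit.restrict hUS) (hx.trans hy.symm) hw U ⟨hU.le, le_rfl⟩).1
    exact absurd (this.symm.trans hxU) (h.pos ⟨hU, hUS⟩).ne'
  by_contra! hlt
  have := (h.retrace ho hx hw hUS.le (u := U - S)
    ⟨by linarith, by linarith⟩ (by linarith)).1
  rw [show S + (U - S) = U by ring, hxU] at this
  exact (h.pos (u := S - (U - S)) ⟨by linarith, by linarith⟩).ne this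

/-- A motion that starts outwards from `0` returns there at multiples of twice the time it needs
to reach its first turning point. -/
lemma exists_return_eq (hP : P.IsSymm) (h : P.IsRise L S y v) (ho : P.IsOrbit L U x w)
    (hU : 0 < U) (hx : x 0 = 0) (hw : w 0 = v 0) (hxU : x U = 0) :
    ∃ j : ℕ, 0 < j ∧ U = j * (2 * S) := by
  have key : ∀ n : ℕ, ∀ (U : ℝ) (x w : ℝ → ℝ), U ≤ n * (2 * S) → P.IsOrbit L U x w → 0 < U →
      x 0 = 0 → w 0 = v 0 → x U = 0 → ∃ j : ℕ, 0 < j ∧ U = j * (2 * S) := fun n => by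
    induction n with
    | zero =>
      intro U x w hn _ hU
      simp only [CharP.cast_eq_zero, zero_mul] at hn
      exact absurd hU hn.not_gt
    | succ n ih =>
      intro U x w hn ho hU hx hw hxU
      have hS := h.time_pos
      have h2 := h.two_mul_time_le ho hU hx hw hxU
      rcases h2.eq_or_lt with h2 | h2
      · exact ⟨1, one_pos, by simpa using h2.symm⟩
      obtain ⟨e1, e2⟩ := h.retrace ho hx hw (by linarith) (u := S)
        ⟨hS.le, le_rfl⟩ (by linarith)
      rw [sub_self] at e1 e2
      rw [h.pos_zero] at e1
      -- At time 2S the motion is back at 0 with reversed momentum; the reflection x ↦ −x restores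
      -- the initial state, and induction continues.
      obtain ⟨j, hj, hjU⟩ := ih (U - 2 * S) _ _ (by push_cast at hn; linarith)
        ((ho.sub (s := 2 * S) (by linarith) (by linarith)).neg hP) (by linarith)
        (by simp [two_mul, e1]) (by simp [two_mul, e2]) (by simp [hxU])
      exact ⟨j + 1, j.succ_pos, by push_cast; linarith⟩
  obtain ⟨n, hn⟩ := exists_nat_ge (U / (2 * S))
  exact key n U x w ((div_le_iff₀ (by linarith [h.time_pos])).1 hn) ho hU hx hw hxU

lemma mom_zero_sq (h : P.IsRise L S x w) : w 0 ^ 2 + L ^ 2 = P.energy 0 := by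
  rw [h.orbit.conserved 0 ⟨le_rfl, h.time_pos.le⟩, h.pos_zero]

lemma mom_zero_pos (h : P.IsRise L S x w) : 0 < w 0 := h.mom_pos 0 ⟨le_rfl, h.time_pos⟩

lemma mom_zero_eq (h : P.IsRise L S x w) : w 0 = √(P.energy 0 - L ^ 2) := by
  rw [← h.mom_zero_sq, add_sub_cancel_right, Real.sqrt_sq h.mom_zero_pos.le]

/-- The first turning time depends continuously on the initial momentum. -/
lemma exists_abs_time_sub_lt (hP : P.domain = univ) (h : P.IsRise L S x w)
    (ho : P.IsOrbit L (2 * S) x w) {B : ℝ} (hB0 : 0 ≤ B) (hB : ∀ x, P.energy x ≤ B ^ 2) {ε : ℝ}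
    (hε : 0 < ε) :
    ∃ δ > 0, ∀ L' S' x' w', P.IsRise L' S' x' w' → |w' 0 - w 0| < δ → |S' - S| < ε := by
  have hS := h.time_pos
  have hmom : ∀ {L U : ℝ} {x w : ℝ → ℝ}, P.IsOrbit L U x w → ∀ u ∈ Icc 0 U, ‖w u‖ ≤ B := by
    intro L U x w ho u hu
    refine abs_le_of_sq_le_sq ?_ hB0
    nlinarith [ho.conserved u hu, hB (x u), sq_nonneg L]
  have hpos : ∀ {L U : ℝ} {x w : ℝ → ℝ}, P.IsOrbit L U x w → x 0 = 0 → ∀ u ∈ Icc 0 U,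
      u ≤ 2 * S → x u ∈ Icc (-(B * (2 * S))) (B * (2 * S)) := by
    intro L U x w ho hx u hu huS
    have := (convex_Icc 0 U).norm_image_sub_le_of_norm_hasDerivWithin_le
      (fun y hy => ho.deriv_pos y hy) (hmom ho) ⟨le_rfl, hu.1.trans hu.2⟩ hu
    rw [hx, sub_zero, sub_zero, Real.norm_eq_abs, Real.norm_eq_abs, abs_of_nonneg hu.1] at this
    exact abs_le.1 (this.trans (mul_le_mul_of_nonneg_left huS hB0))
  set K := Icc (-(B * (2 * S))) (B * (2 * S)) with hK
  obtain ⟨C, hC⟩ := exists_lipschitzOnWith_force (P := P) (K := K) isCompact_Icc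
    (by rw [hP]; exact subset_univ _)
  have hv : LipschitzOnWith (max 1 C) (fun y : ℝ × ℝ => (y.2, P.force y.1)) (K ×ˢ univ) := by
    refine LipschitzOnWith.prodMk (LipschitzWith.prod_snd.lipschitzOnWith) ?_
    have := hC.comp (LipschitzWith.prod_fst.lipschitzOnWith (s := K ×ˢ (univ : Set ℝ)))
      (fun y hy => hy.1)
    rwa [mul_one] at this
  set G := Real.exp (max 1 C * (2 * S)) with hG
  have hG0 : 0 < G := Real.exp_pos _
  -- Grönwall's inequality: both motions stay in the compact K, where the force is Lipschitz.
  have hcomp : ∀ L' S' x' w', P.IsRise L' S' x' w' → ∀ T ∈ Icc 0 S', T ≤ 2 * S →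
      |w' T - w T| ≤ |w' 0 - w 0| * G := fun L' S' x' w' h' T hT hTS => by
    have o1 := h'.orbit.restrict hT.2
    have o2 := ho.restrict hTS
    have := dist_le_of_trajectories_ODE_of_mem (K := max 1 C) (δ := |w' 0 - w 0|)
      (v := fun _ => fun y : ℝ × ℝ => (y.2, P.force y.1))
      (s := fun _ => K ×ˢ univ) (a := 0) (b := T) (fun t _ => hv)
      (o1.continuousOn_pos.prodMk o1.continuousOn_mom) (fun t ht => o1.hasDerivWithinAt_Ici ht)
      (fun t ht => ⟨hpos o1 h'.pos_zero t (Ico_subset_Icc_self ht) (ht.2.le.trans hTS), trivial⟩)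
      (o2.continuousOn_pos.prodMk o2.continuousOn_mom) (fun t ht => o2.hasDerivWithinAt_Ici ht)
      (fun t ht => ⟨hpos o2 h.pos_zero t (Ico_subset_Icc_self ht) (ht.2.le.trans hTS), trivial⟩)
      (by rw [Prod.dist_eq, h'.pos_zero, h.pos_zero, dist_self, Real.dist_eq]
          exact max_le (abs_nonneg _) le_rfl) T ⟨hT.1, le_rfl⟩
    rw [Prod.dist_eq, sub_zero] at this
    refine ((le_max_right _ _).trans this).trans ?_
    refine mul_le_mul_of_nonneg_left (Real.exp_le_exp.2 ?_) (abs_nonneg _)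
    exact mul_le_mul_of_nonneg_left hTS (NNReal.coe_nonneg _)
  set η := min ε (S / 2) with hη
  have hη0 : 0 < η := lt_min hε (by linarith)
  have hηS : η ≤ S / 2 := min_le_right _ _
  -- The reference momentum is at least w u₀ > 0 up to S − η and, by retracing, at most −w u₀ at S +
  -- η. A motion whose momentum differs by less than w u₀ can turn neither earlier nor later.
  obtain ⟨u₀, hu₀, hmin⟩ := isCompact_Icc.exists_isMinOn (nonempty_Icc.2 (by linarith :
    (0 : ℝ) ≤ S - η)) (h.orbit.continuousOn_mom.mono (Icc_subset_Icc_right (by linarith)))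
  have hc0 : 0 < w u₀ := h.mom_pos _ ⟨hu₀.1, by linarith [hu₀.2]⟩
  refine ⟨w u₀ / G, by positivity, fun L' S' x' w' h' hδ => ?_⟩
  rw [lt_div_iff₀ hG0] at hδ
  have hηε : η ≤ ε := min_le_left _ _
  rw [abs_lt]
  constructor
  · by_contra! hle
    have h1 := hcomp L' S' x' w' h' S' ⟨h'.time_pos.le, le_rfl⟩ (by linarith)
    have h2 : w u₀ ≤ w S' := hmin ⟨h'.time_pos.le, by linarith⟩
    rw [h'.mom_end, zero_sub, abs_neg] at h1
    linarith [le_abs_self (w S')]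
  · by_contra! hle
    have h1 := hcomp L' S' x' w' h' (S + η) ⟨by linarith, by linarith⟩ (by linarith)
    have h2 : w u₀ ≤ w (S - η) := hmin ⟨by linarith, le_rfl⟩
    have h3 := (h.retrace ho h.pos_zero rfl (by linarith) (u := η) ⟨hη0.le, by linarith⟩
      (by linarith)).2
    have h4 : 0 ≤ w' (S + η) := by
      rcases (show S + η ≤ S' by linarith).eq_or_lt with e | e
      · rw [e, h'.mom_end]
      · exact (h'.mom_pos _ ⟨by linarith, e⟩).le
    linarith [le_abs_self (w' (S + η) - w (S + η))]

end IsRise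

end RadialPotential

lemma IsPreconnected.subsingleton_of_countable {s : Set ℝ} (hs : IsPreconnected s)
    (hc : s.Countable) : s.Subsingleton := by
  intro a ha b hb
  by_contra hne
  wlog hab : a < b generalizing a b
  · exact this hb ha (Ne.symm hne) (lt_of_le_of_ne (not_lt.1 hab) (Ne.symm hne))
  have h1 : Ioo a b ⊆ s := Ioo_subset_Icc_self.trans (hs.ordConnected.out ha hb)
  have h2 := (hc.mono h1).to_subtype
  exact (Cardinal.mk_Ioo_real hab ▸ Cardinal.mk_le_aleph0 (α := Ioo a b)).not_gt
    Cardinal.aleph0_lt_continuum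

namespace RadialPotential

variable {P : RadialPotential}

/-- The potential fills space, and all motions which start outwards from any point `p` arrive
at `-p`, with the same polar angle up to full turns. -/
structure IsReflecting (P : RadialPotential) : Prop where
  domain_eq : P.domain = univ
  energy_pos : ∀ x, 0 < P.energy x
  joins : ∀ p, ∃ θ, ∀ L, 0 < L → L ^ 2 < P.energy p → ∃ U x w, 0 < U ∧ P.IsOrbit L U x w ∧
    x 0 = p ∧ 0 < w 0 ∧ x U = -p ∧ ∃ j : ℤ, L * U = θ + 2 * Real.pi * j

namespace IsReflecting

/-- If E(y) < L² < E(p), the motion with momentum L from p to −p would have to cross y, where it has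
too little energy. This makes E even and antitone on [0, ∞). -/
lemma energy_le (h : P.IsReflecting) {p y : ℝ} (hy : y ∈ uIcc p (-p)) :
    P.energy p ≤ P.energy y := by
  by_contra! hlt
  obtain ⟨e, he1, he2⟩ := exists_between hlt
  have he0 : 0 < e := (h.energy_pos y).trans he1
  obtain ⟨θ, hθ⟩ := h.joins p
  obtain ⟨U, x, w, hU, ho, hx0, -, hxU, -⟩ := hθ (√e) (Real.sqrt_pos.2 he0)
    (by rwa [Real.sq_sqrt he0.le])
  rw [← hx0, ← hxU.trans (congrArg Neg.neg hx0.symm)] at hy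
  obtain ⟨u, hu, rfl⟩ := intermediate_value_uIcc (a := 0) (b := U)
    (by rw [uIcc_of_le hU.le]; exact ho.continuousOn_pos) (by rwa [hx0] at hy ⊢)
  rw [uIcc_of_le hU.le] at hu
  have := ho.conserved u hu
  rw [Real.sq_sqrt he0.le] at this
  nlinarith [sq_nonneg (w u)]

lemma isSymm (h : P.IsReflecting) : P.IsSymm := by
  have he : ∀ x, P.energy (-x) = P.energy x := fun x =>
    le_antisymm (by simpa using h.energy_le (p := -x) (y := x) (by simp))
      (h.energy_le right_mem_uIcc)
  refine ⟨h.domain_eq, he, fun x => ?_⟩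
  have hd : ∀ x, HasDerivAt P.energy (2 * P.force x) x := fun x =>
    P.hasDerivAt_energy x (by rw [h.domain_eq]; trivial)
  have h1 : HasDerivAt P.energy (2 * P.force (-x) * -1) x :=
    ((hd (-x)).comp x (hasDerivAt_neg x)).congr_of_eventuallyEq (by
      filter_upwards with y using (he y).symm)
  linarith [h1.unique (hd x)]

lemma antitoneOn (h : P.IsReflecting) : AntitoneOn P.energy (Ici 0) := fun y hy p _ hyp =>
  h.energy_le (by
    rw [mem_Ici] at hy
    rw [uIcc_of_ge (by linarith)]
    exact ⟨by linarith, hyp⟩)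

lemma energy_le_zero (h : P.IsReflecting) (x : ℝ) : P.energy x ≤ P.energy 0 :=
  h.energy_le (by rcases le_total 0 x with hx | hx
                  · rw [uIcc_of_ge (by linarith)]; exact ⟨by linarith, hx⟩
                  · rw [uIcc_of_le (by linarith)]; exact ⟨hx, by linarith⟩)

/-- The motion from 0 returns there at U = 2jS with L U = θ + 2πk, so L S = (θ + 2πk)/(2j), one of
countably many values. -/
lemma exists_isRise (h : P.IsReflecting) : ∃ D : Set ℝ, D.Countable ∧
    ∀ L, 0 < L → L ^ 2 < P.energy 0 →
      ∃ S x w, P.IsRise L S x w ∧ P.IsOrbit L (2 * S) x w ∧ L * S ∈ D := by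
  obtain ⟨θ, hθ⟩ := h.joins 0
  refine ⟨range fun q : ℤ × ℕ => (θ + 2 * Real.pi * q.1) / (2 * q.2), countable_range _,
    fun L hL hLE => ?_⟩
  obtain ⟨U, x, w, hU, ho, hx0, hw0, hxU, k, hk⟩ := hθ L hL hLE
  rw [neg_zero] at hxU
  obtain ⟨S, hS⟩ := ho.exists_isRise hU hx0 hw0 hxU
  obtain ⟨j, hj, hjU⟩ := hS.exists_return_eq h.isSymm ho hU hx0 rfl hxU
  have hj' : (0 : ℝ) < j := by exact_mod_cast hj
  refine ⟨S, x, w, hS, ho.restrict (hS.two_mul_time_le ho hU hx0 rfl hxU), (k, j), ?_⟩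
  simp only
  rw [← hk, hjU]
  field_simp

/-- The polar angle swept between the centre of symmetry and the turning point is the same for
all motions. -/
lemma exists_mul_time_eq (h : P.IsReflecting) : ∃ c > 0, ∀ L, 0 < L → L ^ 2 < P.energy 0 →
    ∃ S x w, P.IsRise L S x w ∧ L * S = c := by
  obtain ⟨D, hD, H⟩ := h.exists_isRise
  set E₀ := P.energy 0 with hE₀
  have hE0 : 0 < E₀ := h.energy_pos 0
  have hm : ∀ L, L ∈ Ioo 0 (√E₀) → 0 < L ∧ L ^ 2 < E₀ := fun L hL =>
    ⟨hL.1, (Real.lt_sqrt hL.1.le).1 hL.2⟩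
  choose! S x w hrise ho hSD using H
  have hcont : ContinuousOn (fun L => L * S L) (Ioo 0 (√E₀)) := by
    refine continuousOn_id.mul (Metric.continuousOn_iff.2 fun L hL ε hε => ?_)
    obtain ⟨hL0, hLE⟩ := hm L hL
    obtain ⟨δ, hδ, hS⟩ := (hrise L hL0 hLE).exists_abs_time_sub_lt h.domain_eq (ho L hL0 hLE)
      (B := √E₀) (Real.sqrt_nonneg _)
      (fun y => by rw [Real.sq_sqrt hE0.le]; exact h.energy_le_zero y) hε
    have hs : Continuous fun L : ℝ => √(E₀ - L ^ 2) := by fun_prop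
    obtain ⟨r, hr, hrδ⟩ := Metric.continuous_iff.1 hs L δ hδ
    refine ⟨r, hr, fun L' hL' hd => ?_⟩
    obtain ⟨hL0', hLE'⟩ := hm L' hL'
    refine hS _ _ _ _ (hrise L' hL0' hLE') ?_
    rw [(hrise L' hL0' hLE').mom_zero_eq, (hrise L hL0 hLE).mom_zero_eq]
    exact hrδ L' hd
  -- L S is continuous on an interval of momenta with values in a countable set, hence constant.
  have hsub := (isPreconnected_Ioo.image _ hcont).subsingleton_of_countable
    (hD.mono (by
      rintro _ ⟨L, hL, rfl⟩
      exact hSD L (hm L hL).1 (hm L hL).2))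
  obtain ⟨L₁, hL₁⟩ := nonempty_Ioo.2 (Real.sqrt_pos.2 hE0)
  refine ⟨L₁ * S L₁, mul_pos hL₁.1 (hrise L₁ (hm L₁ hL₁).1 (hm L₁ hL₁).2).time_pos,
    fun L hL hLE => ⟨S L, x L, w L, hrise L hL hLE, ?_⟩⟩
  exact hsub ⟨L, ⟨hL, (Real.lt_sqrt hL.le).2 hLE⟩, rfl⟩ ⟨L₁, hL₁, rfl⟩

end IsReflecting

end RadialPotential

/-! ### Abel inversion and the law of the potential -/

open MeasureTheory in
lemma lintegral_ofReal_deriv_of_nonneg {g g' : ℝ → ℝ} {a b : ℝ} (hab : a ≤ b)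
    (hg : ContinuousOn g (Icc a b)) (hd : ∀ x ∈ Ioo a b, HasDerivAt g (g' x) x)
    (h0 : ∀ x ∈ Ioo a b, 0 ≤ g' x) :
    ∫⁻ x in Ioo a b, ENNReal.ofReal (g' x) = ENNReal.ofReal (g b - g a) := by
  have hi := intervalIntegral.integrableOn_deriv_of_nonneg hg hd h0
  have hint := intervalIntegral.integral_eq_sub_of_hasDerivAt_of_le hab hg hd
    ((intervalIntegrable_iff_integrableOn_Ioc_of_le hab).2 hi)
  rw [intervalIntegral.integral_of_le hab, integral_Ioc_eq_integral_Ioo] at hint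
  rw [← hint, ofReal_integral_eq_lintegral_ofReal (hi.mono_set Ioo_subset_Ioc_self)
    ((ae_restrict_iff' measurableSet_Ioo).2 (Filter.Eventually.of_forall h0))]

open MeasureTheory in
lemma setLIntegral_eq_of_subset_of_forall_diff {α : Type*} [MeasurableSpace α] {μ : Measure α}
    {s t : Set α} (hs : MeasurableSet s) (ht : MeasurableSet t) (hst : s ⊆ t)
    {f : α → ENNReal} (hf : ∀ x ∈ t \ s, f x = 0) :
    ∫⁻ x in t, f x ∂μ = ∫⁻ x in s, f x ∂μ := by
  rw [← lintegral_indicator ht, ← lintegral_indicator hs]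
  congr 1
  ext x
  by_cases hxs : x ∈ s
  · simp [hxs, hst hxs]
  · by_cases hxt : x ∈ t
    · simp [hxs, hxt, hf x ⟨hxt, hxs⟩]
    · simp [hxs, hxt]

lemma lintegral_inv_sqrt_sq_sub_sq {a b : ℝ} (ha : 0 < a) (hab : a ≤ b) :
    ∫⁻ x in Ioo a b, ENNReal.ofReal (√(x ^ 2 - a ^ 2))⁻¹ =
      ENNReal.ofReal (Real.arcosh (b / a)) := by
  have h := lintegral_ofReal_deriv_of_nonneg (g := fun x => Real.arcosh (x / a))
    (g' := fun x => (√(x ^ 2 - a ^ 2))⁻¹) hab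
    (Real.continuousOn_arcosh.comp (by fun_prop) fun x hx => (one_le_div ha).2 hx.1)
    (fun x hx => by
      refine ((Real.hasDerivAt_arcosh ((one_lt_div ha).2 hx.1)).comp x
        ((hasDerivAt_id x).div_const a)).congr_deriv ?_
      rw [show x ^ 2 - a ^ 2 = a ^ 2 * ((x / a) ^ 2 - 1) by field_simp,
        Real.sqrt_mul (sq_nonneg a), Real.sqrt_sq ha.le, mul_inv]
      ring)
    (fun x _ => inv_nonneg.2 (Real.sqrt_nonneg _))
  rw [h, div_self ha.ne', Real.arcosh_zero, sub_zero]

/-- A primitive is half the arcsine of the affine function of x² that takes a², b² to −1, 1. -/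
lemma lintegral_abel_kernel {a b : ℝ} (ha : 0 < a) (hab : a < b) :
    ∫⁻ x in Ioo a b, ENNReal.ofReal (x * (√(x ^ 2 - a ^ 2))⁻¹ * (√(b ^ 2 - x ^ 2))⁻¹) =
      ENNReal.ofReal (Real.pi / 2) := by
  have hba : 0 < b ^ 2 - a ^ 2 := by nlinarith
  have h := lintegral_ofReal_deriv_of_nonneg
    (g := fun x => Real.arcsin ((2 * x ^ 2 - a ^ 2 - b ^ 2) / (b ^ 2 - a ^ 2)) / 2)
    (g' := fun x => x * (√(x ^ 2 - a ^ 2))⁻¹ * (√(b ^ 2 - x ^ 2))⁻¹) hab.le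
    ((Real.continuous_arcsin.comp (by fun_prop)).div_const 2).continuousOn
    (fun x hx => by
      have hx1 : 0 < x ^ 2 - a ^ 2 := by nlinarith [hx.1]
      have hx2 : 0 < b ^ 2 - x ^ 2 := by nlinarith [hx.1, hx.2]
      have hd : HasDerivAt (fun x : ℝ => (2 * x ^ 2 - a ^ 2 - b ^ 2) / (b ^ 2 - a ^ 2))
          (4 * x / (b ^ 2 - a ^ 2)) x := by
        refine (((((hasDerivAt_id x).pow 2).const_mul 2).sub_const _).sub_const _).div_const _
          |>.congr_deriv ?_
        simp
        ring
      refine (((Real.hasDerivAt_arcsin ?_ ?_).comp x hd).div_const 2).congr_deriv ?_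
      · rw [ne_eq, div_eq_iff hba.ne']
        intro h
        linarith
      · rw [ne_eq, div_eq_iff hba.ne']
        intro h
        linarith
      · rw [show 1 - ((2 * x ^ 2 - a ^ 2 - b ^ 2) / (b ^ 2 - a ^ 2)) ^ 2 =
          (2 / (b ^ 2 - a ^ 2)) ^ 2 * ((x ^ 2 - a ^ 2) * (b ^ 2 - x ^ 2)) by
            field_simp
            ring,
          Real.sqrt_mul (sq_nonneg _), Real.sqrt_sq (by positivity), Real.sqrt_mul hx1.le]
        have := (Real.sqrt_pos.2 hx1).ne'
        have := (Real.sqrt_pos.2 hx2).ne'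
        field_simp
        ring)
    (fun x hx => by
      have : 0 < x := ha.trans hx.1
      positivity)
  rw [h]
  congr 1
  rw [show (2 * b ^ 2 - a ^ 2 - b ^ 2) / (b ^ 2 - a ^ 2) = 1 by
      rw [div_eq_one_iff_eq hba.ne']; ring,
    show (2 * a ^ 2 - a ^ 2 - b ^ 2) / (b ^ 2 - a ^ 2) = -1 by
      rw [div_eq_iff hba.ne']; ring, Real.arcsin_one, Real.arcsin_neg_one]
  ring

namespace RadialPotential

variable {P : RadialPotential}

/-- Change of variables y = x u with √(E − L²) = w. The integrand is singular at the turning point;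
the Lebesgue integral of a nonnegative function raises no question of integrability. -/
lemma IsRise.lintegral_inv_sqrt {L S : ℝ} {x w : ℝ → ℝ} (h : P.IsRise L S x w) :
    ∫⁻ y in Ioo 0 (x S), ENNReal.ofReal (√(P.energy y - L ^ 2))⁻¹ = ENNReal.ofReal S := by
  rw [← h.image_Ioo, MeasureTheory.lintegral_image_eq_lintegral_abs_deriv_mul measurableSet_Ioo
    (fun u hu => (h.orbit.hasDerivAt_pos hu).hasDerivWithinAt)
    (h.strictMonoOn.injOn.mono Ioo_subset_Icc_self),
    MeasureTheory.setLIntegral_congr_fun (g := fun _ => 1) measurableSet_Ioo fun u hu => ?_]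
  · simp
  · have hw := h.mom_pos u (Ioo_subset_Ico_self hu)
    simp only
    rw [← h.orbit.conserved u (Ioo_subset_Icc_self hu), add_sub_cancel_right,
      Real.sqrt_sq hw.le, abs_of_pos hw, ← ENNReal.ofReal_mul hw.le, mul_inv_cancel₀ hw.ne',
      ENNReal.ofReal_one]

lemma IsReflecting.lt_energy_iff (h : P.IsReflecting) {L S : ℝ} {x w : ℝ → ℝ}
    (hr : P.IsRise L S x w) {y : ℝ} (hy : 0 < y) : L ^ 2 < P.energy y ↔ y < x S := by
  constructor
  · intro hlt
    by_contra! hle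
    have := h.antitoneOn (hr.pos ⟨hr.time_pos, le_rfl⟩).le hy.le hle
    rw [hr.energy_end] at this
    linarith
  · intro hlt
    have : y ∈ x '' Ioo 0 S := hr.image_Ioo ▸ ⟨hy, hlt⟩
    obtain ⟨u, hu, rfl⟩ := this
    have h1 := hr.orbit.conserved u (Ioo_subset_Icc_self hu)
    have h2 := hr.mom_pos u (Ioo_subset_Ico_self hu)
    nlinarith

open MeasureTheory in
/-- Abel's inversion: the law of the turning points follows from the constancy of the angle. -/
lemma IsReflecting.mul_arcosh_eq (h : P.IsReflecting) {c : ℝ} (hc : 0 < c)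
    (H : ∀ L, 0 < L → L ^ 2 < P.energy 0 → ∃ S x w, P.IsRise L S x w ∧ L * S = c)
    {L S : ℝ} {x w : ℝ → ℝ} (hL : 0 < L) (hr : P.IsRise L S x w) :
    c * Real.arcosh (√(P.energy 0) / L) = Real.pi / 2 * x S := by
  set N := √(P.energy 0) with hN
  have hX : 0 < x S := hr.pos ⟨hr.time_pos, le_rfl⟩
  have hLN : L < N := Real.lt_sqrt_of_sq_lt (by nlinarith [hr.mom_zero_sq, hr.mom_zero_pos])
  have hEc : Continuous P.energy := by
    rw [← continuousOn_univ, ← h.domain_eq]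
    exact P.continuousOn_energy
  -- Abel's kernel. As √ of a nonpositive number and 0⁻¹ are both 0, f vanishes where E y ≤ l², so
  -- the curved region becomes the rectangle (L, N) × (0, ∞) and Tonelli applies. Integrating over y
  -- first gives c arcosh(N/L), over l first gives (π/2) x S.
  set f : ℝ → ℝ → ENNReal := fun l y =>
    ENNReal.ofReal (l * (√(l ^ 2 - L ^ 2))⁻¹ * (√(P.energy y - l ^ 2))⁻¹) with hf
  have hfm : Measurable (Function.uncurry f) := by
    refine ENNReal.measurable_ofReal.comp ?_
    refine (Measurable.mul measurable_fst ?_).mul ?_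
    · exact (Continuous.measurable (by fun_prop)).inv
    · exact (Continuous.measurable (by fun_prop)).inv
  have e1 : ∀ l ∈ Ioo L N, ∫⁻ y in Ioi 0, f l y =
      ENNReal.ofReal c * ENNReal.ofReal (√(l ^ 2 - L ^ 2))⁻¹ := fun l hl => by
    have hl0 : 0 < l := hL.trans hl.1
    obtain ⟨S', x', w', hr', hc'⟩ := H l hl0 ((Real.lt_sqrt hl0.le).1 hl.2)
    have hp : 0 ≤ l * (√(l ^ 2 - L ^ 2))⁻¹ := by positivity
    simp only [hf, ENNReal.ofReal_mul hp]
    rw [lintegral_const_mul' _ _ ENNReal.ofReal_ne_top,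
      setLIntegral_eq_of_subset_of_forall_diff (s := Ioo 0 (x' S')) measurableSet_Ioo
        measurableSet_Ioi Ioo_subset_Ioi_self fun y hy => ?_, hr'.lintegral_inv_sqrt,
      ← ENNReal.ofReal_mul hp, ← ENNReal.ofReal_mul hc.le, ← hc']
    · congr 1
      ring
    · have : ¬ l ^ 2 < P.energy y := fun h' => hy.2 ⟨hy.1, (h.lt_energy_iff hr' hy.1).1 h'⟩
      rw [Real.sqrt_eq_zero_of_nonpos (by linarith), inv_zero, ENNReal.ofReal_zero]
  have e2 : ∀ y ∈ Ioi (0 : ℝ), ∫⁻ l in Ioo L N, f l y =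
      (Ioo 0 (x S)).indicator (fun _ => ENNReal.ofReal (Real.pi / 2)) y := fun y hy => by
    by_cases hyX : y < x S
    · have hmem : y ∈ Ioo 0 (x S) := ⟨hy, hyX⟩
      rw [indicator_of_mem hmem]
      have hE0 := h.energy_pos y
      have hLE : L < √(P.energy y) := Real.lt_sqrt_of_sq_lt ((h.lt_energy_iff hr hy).2 hyX)
      rw [setLIntegral_eq_of_subset_of_forall_diff (s := Ioo L (√(P.energy y)))
        measurableSet_Ioo measurableSet_Ioo (Ioo_subset_Ioo_right
          (Real.sqrt_le_sqrt (h.energy_le_zero y))) fun l hl => ?_,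
        ← lintegral_abel_kernel hL hLE, Real.sq_sqrt hE0.le]
      have hle : √(P.energy y) ≤ l := by
        by_contra! hlt
        exact hl.2 ⟨hl.1.1, hlt⟩
      rw [Real.sqrt_le_left (hL.trans hl.1.1).le] at hle
      simp only [hf]
      rw [Real.sqrt_eq_zero_of_nonpos (by linarith : P.energy y - l ^ 2 ≤ 0), inv_zero, mul_zero,
        ENNReal.ofReal_zero]
    · rw [indicator_of_notMem fun h' => hyX h'.2]
      have hle : P.energy y ≤ L ^ 2 := by
        by_contra! hlt
        exact hyX ((h.lt_energy_iff hr hy).1 hlt)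
      rw [setLIntegral_congr_fun (g := fun _ => 0) measurableSet_Ioo fun l hl => ?_]
      · simp
      · simp only [hf]
        rw [Real.sqrt_eq_zero_of_nonpos (by nlinarith [hl.1] : P.energy y - l ^ 2 ≤ 0), inv_zero,
          mul_zero, ENNReal.ofReal_zero]
  have e3 := lintegral_lintegral_swap (μ := volume.restrict (Ioo L N))
    (ν := volume.restrict (Ioi (0 : ℝ))) (f := f) hfm.aemeasurable
  rw [setLIntegral_congr_fun measurableSet_Ioo e1, setLIntegral_congr_fun measurableSet_Ioi e2,
    lintegral_const_mul' _ _ ENNReal.ofReal_ne_top, lintegral_inv_sqrt_sq_sub_sq hL hLN.le,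
    setLIntegral_indicator measurableSet_Ioo, inter_eq_left.2 Ioo_subset_Ioi_self,
    setLIntegral_const, Real.volume_Ioo, sub_zero, ← ENNReal.ofReal_mul hc.le,
    ← ENNReal.ofReal_mul (by positivity)] at e3
  have h1 : 0 ≤ Real.arcosh (N / L) := Real.arcosh_nonneg ((one_le_div hL).2 hLN.le)
  exact (ENNReal.ofReal_eq_ofReal_iff (by positivity) (by positivity)).1 e3

/-- A potential that reflects all motions is that of a generalised fish eye. -/
lemma IsReflecting.exists_energy_eq (h : P.IsReflecting) : ∃ m L₀ : ℝ, 0 < m ∧ 0 < L₀ ∧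
    ∀ x, P.energy x = (L₀ / Real.cosh (m * x)) ^ 2 := by
  obtain ⟨c, hc, H⟩ := h.exists_mul_time_eq
  have hE := h.energy_pos 0
  set N := √(P.energy 0) with hN
  have hN0 : 0 < N := Real.sqrt_pos.2 hE
  have hNsq : N ^ 2 = P.energy 0 := Real.sq_sqrt hE.le
  have hm : 0 < Real.pi / (2 * c) := by positivity
  -- Solving c arcosh(N/L) = (π/2) x for L gives the momentum whose turning point is x; hence m =
  -- π/(2c).
  have key : ∀ x, 0 < x → P.energy x = (N / Real.cosh (Real.pi / (2 * c) * x)) ^ 2 :=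
    fun x hx => by
      have hmx : 0 < Real.pi / (2 * c) * x := mul_pos hm hx
      have hcosh : 1 < Real.cosh (Real.pi / (2 * c) * x) := Real.one_lt_cosh.2 hmx.ne'
      have hL : 0 < N / Real.cosh (Real.pi / (2 * c) * x) := by positivity
      have hLN : N / Real.cosh (Real.pi / (2 * c) * x) < N := div_lt_self hN0 hcosh
      obtain ⟨S, y, w, hr, -⟩ := H _ hL (by rw [← hNsq]; gcongr)
      have h1 := h.mul_arcosh_eq hc H hL hr
      rw [← hN, div_div_cancel₀ hN0.ne', Real.arcosh_cosh hmx.le] at h1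
      have h2 : x = y S := by
        field_simp at h1
        linarith
      rw [h2, hr.energy_end, ← h2]
  refine ⟨_, N, hm, hN0, fun x => ?_⟩
  rcases lt_trichotomy x 0 with hx | rfl | hx
  · rw [← h.isSymm.energy_neg, key (-x) (by linarith), mul_neg, Real.cosh_neg]
  · rw [mul_zero, Real.cosh_zero, div_one, hNsq]
  · exact key x hx

end RadialPotential

/-! ### The generalised fish eye -/

namespace RadialPotential

/-- The potential seen from the point `κ`. -/
def translate (P : RadialPotential) (κ : ℝ) : RadialPotential where
  domain := (fun x => κ + x) ⁻¹' P.domain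
  energy x := P.energy (κ + x)
  force x := P.force (κ + x)
  isOpen_domain := P.isOpen_domain.preimage (continuous_const_add κ)
  hasDerivAt_energy x hx :=
    ((P.hasDerivAt_energy (κ + x) hx).comp x
      ((hasDerivAt_id x).const_add κ)).congr_deriv (mul_one _)
  contDiffOn_force := P.contDiffOn_force.comp (by fun_prop) fun _ hx => hx

lemma IsOrbit.translate {P : RadialPotential} {L U : ℝ} {x w : ℝ → ℝ} (h : P.IsOrbit L U x w)
    (κ : ℝ) : (P.translate κ).IsOrbit L U (fun u => x u - κ) w where
  mem_domain u hu := by simpa [RadialPotential.translate] using h.mem_domain u hu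
  deriv_pos u hu := (h.deriv_pos u hu).sub_const κ
  deriv_mom u hu := by simpa [RadialPotential.translate] using h.deriv_mom u hu
  conserved u hu := by simpa [RadialPotential.translate] using h.conserved u hu

end RadialPotential

lemma exists_norm_eq_of_pos {d : ℕ} (hd : 0 < d) {r : ℝ} (hr : 0 ≤ r) :
    ∃ A : EuclideanSpace ℝ (Fin d), ‖A‖ = r :=
  ⟨EuclideanSpace.single ⟨0, hd⟩ r, by simp [abs_of_nonneg hr]⟩

namespace RadialMedium

variable {M : RadialMedium} {d : ℕ}

/-- In logarithmic radius, r ↦ k/r is the reflection in log √k, which translation moves to 0. The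
outward ray of momentum L is the one launched at ψ = arcsin(L/N). -/
lemma isReflecting_radialPotential (hd : 0 < d) {k : ℝ} (hk : 0 < k) (hM : M.region = Ioi 0)
    (H : ∀ A : EuclideanSpace ℝ (Fin d), A ≠ 0 →
      ∃ B, ‖B‖ = k / ‖A‖ ∧ M.IsFanImage 0 Real.pi A B) :
    (M.radialPotential.translate (Real.log √k)).IsReflecting := by
  have hreg : ∀ x, Real.exp x ∈ M.region := fun x => hM ▸ Real.exp_pos x
  set κ := Real.log √k with hκ
  have hκ2 : Real.log k = 2 * κ := by rw [hκ, Real.log_sqrt hk.le]; ring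
  refine ⟨eq_univ_of_forall fun x => hreg (κ + x), fun x => ?_, fun p => ?_⟩
  · exact pow_pos (turningParameter_pos (hreg (κ + x))) 2
  obtain ⟨A, hA⟩ := exists_norm_eq_of_pos hd (Real.exp_pos (κ + p)).le
  have hA0 : 0 < ‖A‖ := hA ▸ Real.exp_pos _
  have hlogA : Real.log ‖A‖ = κ + p := by rw [hA, Real.log_exp]
  obtain ⟨B, hB, b, hb, hAb, hray⟩ := H A (norm_pos_iff.1 hA0)
  have hB0 : 0 < ‖B‖ := by rw [hB]; positivity
  have hlogB : Real.log ‖B‖ = κ - p := by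
    rw [hB, Real.log_div hk.ne' hA0.ne', hlogA, hκ2]; ring
  have hN := turningParameter_pos (hA ▸ hreg (κ + p) : ‖A‖ ∈ M.region)
  set N := M.turningParameter ‖A‖ with hNdef
  have hE : (M.radialPotential.translate κ).energy p = N ^ 2 := by
    rw [hNdef, hA]; rfl
  have key : ∀ L, 0 < L → L ^ 2 < N ^ 2 → ∃ U x w, 0 < U ∧
      (M.radialPotential.translate κ).IsOrbit L U x w ∧ x 0 = p ∧ 0 < w 0 ∧ x U = -p ∧
      B = ‖B‖ • (Real.cos (L * U) • (‖A‖⁻¹ • A) + Real.sin (L * U) • b) := fun L hL hLN => by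
    have hLN' : L / N < 1 := (div_lt_one hN).2 (lt_of_pow_lt_pow_left₀ 2 hN.le hLN)
    have hLN0 : 0 < L / N := div_pos hL hN
    have hψ0 : 0 < Real.arcsin (L / N) := Real.arcsin_pos.2 hLN0
    have hψ1 : Real.arcsin (L / N) < Real.pi / 2 := Real.arcsin_lt_pi_div_two.2 hLN'
    obtain ⟨U, x, w, hU, ho, hx0, hw0, hxU, hBU⟩ :=
      (hray _ ⟨hψ0, by linarith [Real.pi_pos]⟩).exists_orbit hb hAb
    rw [← hNdef, Real.sin_arcsin (by linarith) hLN'.le, mul_div_cancel₀ _ hN.ne'] at ho hBU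
    refine ⟨U, _, w, hU, ho.translate κ, by linarith, ?_, by linarith, hBU⟩
    rw [hw0]
    exact mul_pos hN (Real.cos_pos_of_mem_Ioo ⟨by linarith, hψ1⟩)
  rw [hE]
  obtain ⟨U₀, -, -, -, -, -, -, -, hB₀⟩ := key (N / 2) (by linarith) (by nlinarith)
  refine ⟨N / 2 * U₀, fun L hL hLN => ?_⟩
  obtain ⟨U, x, w, hU, ho, hx0, hw0, hxU, hBU⟩ := key L hL hLN
  exact ⟨U, x, w, hU, ho, hx0, hw0, hxU,
    exists_eq_add_two_pi_mul_of_polar hA0.ne' hB0.ne' hb hAb hBU hB₀⟩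

/-- The law N(r) = L₀ / cosh(m log(r/√k)), with the hyperbolic cosine written in powers of r/√k. -/
lemma exists_index_eq_fishEyeIndex (hd : 0 < d) {k : ℝ} (hk : 0 < k) (hM : M.region = Ioi 0)
    (H : ∀ A : EuclideanSpace ℝ (Fin d), A ≠ 0 →
      ∃ B, ‖B‖ = k / ‖A‖ ∧ M.IsFanImage 0 Real.pi A B) :
    ∃ m L₀ : ℝ, 0 < m ∧ 0 < L₀ ∧ ∀ r : ℝ, 0 < r → M.index r = fishEyeIndex m L₀ (√k) r := by
  obtain ⟨m, L₀, hm, hL₀, h⟩ := (isReflecting_radialPotential hd hk hM H).exists_energy_eq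
  refine ⟨m, L₀, hm, hL₀, fun r hr => ?_⟩
  have hk' : 0 < √k := Real.sqrt_pos.2 hk
  have hreg : r ∈ M.region := hM ▸ hr
  have hlog : Real.log r - Real.log √k = Real.log (r / √k) :=
    (Real.log_div hr.ne' hk'.ne').symm
  have e1 : M.turningParameter r ^ 2 = (L₀ / Real.cosh (m * Real.log (r / √k))) ^ 2 := by
    rw [← energy_log hreg, ← hlog, ← h]
    simp [RadialPotential.translate]
  have e2 := (pow_left_inj₀ (turningParameter_pos hreg).le (by positivity) two_ne_zero).1 e1
  have e3 : √k / r = (r / √k)⁻¹ := (inv_div r √k).symm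
  rw [fishEyeIndex, e3, Real.inv_rpow (by positivity), ← Real.rpow_neg (by positivity),
    Real.rpow_def_of_pos (by positivity), Real.rpow_def_of_pos (by positivity)]
  rw [Real.cosh_eq, turningParameter, ← mul_neg_one (m * _)] at e2
  rw [mul_comm (Real.log (r / √k)) m, mul_comm (Real.log (r / √k)) (-m), neg_mul,
    ← mul_neg_one (m * _)]
  have hpos : 0 < Real.exp (m * Real.log (r / √k)) + Real.exp (m * Real.log (r / √k) * -1) := by
    positivity
  rw [eq_div_iff (by positivity)] at e2 ⊢
  linear_combination 2 * e2

end RadialMedium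

theorem mainTheorem1 {d : ℕ} (hd : 2 ≤ d) (M : RadialMedium) :
    (∀ (Ω : Set (EuclideanSpace ℝ (Fin d)))
        (F : EuclideanSpace ℝ (Fin d) → EuclideanSpace ℝ (Fin d)), M.Images Ω F →
      -- equality of the turning parameters at object and image
      (∀ A ∈ Ω, M.turningParameter ‖A‖ = M.turningParameter ‖F A‖) ∧
      -- the two branches, one of which holds on the whole domain
      (∃ k : ℝ, 0 < k ∧
        ((∀ A ∈ Ω, ‖F A‖ = k * ‖A‖) ∨ (∀ A ∈ Ω, ‖F A‖ = k / ‖A‖))) ∧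
      -- first branch: `k = 1` if all first-branch images formed by the instrument have the same `k`
      (∀ k : ℝ, 0 < k → (∀ A ∈ Ω, ‖F A‖ = k * ‖A‖) →
        (∀ (Ω' : Set (EuclideanSpace ℝ (Fin d)))
            (F' : EuclideanSpace ℝ (Fin d) → EuclideanSpace ℝ (Fin d)) (k' : ℝ),
          M.Images Ω' F' → (∀ A ∈ Ω', ‖F' A‖ = k' * ‖A‖) → k' = k) →
        k = 1) ∧
      -- first branch: `k = 1` if a ray launched tangentially contributes to the image of a point
      (∀ k : ℝ, 0 < k → (∀ A ∈ Ω, ‖F A‖ = k * ‖A‖) →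
        (∃ A ∈ Ω, ∃ u : EuclideanSpace ℝ (Fin d),
          ‖u‖ = 1 ∧ ⟪A, u⟫ = 0 ∧ M.RayJoins A u (F A)) →
        k = 1) ∧
      -- strong images: up to one orthogonal map, the image is a scaled copy of the object (a
      -- congruent one if `k = 1`) on the first branch and its spherical inversion on the second
      ((∀ A ∈ Ω, M.IsStrongImage A (F A)) →
        ∃ Q : EuclideanSpace ℝ (Fin d) ≃ₗᵢ[ℝ] EuclideanSpace ℝ (Fin d),
          (∀ k : ℝ, 0 < k → (∀ A ∈ Ω, ‖F A‖ = k * ‖A‖) → ∀ A ∈ Ω, F A = k • Q A) ∧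
          (∀ k : ℝ, 0 < k → (∀ A ∈ Ω, ‖F A‖ = k / ‖A‖) →
            ∀ A ∈ Ω, F A = (k / ‖A‖ ^ 2) • Q A))) ∧
    -- second branch for all points and all rays of a half-plane: the generalised fish eye
    (∀ k : ℝ, 0 < k → M.region = Ioi 0 →
      (∀ A : EuclideanSpace ℝ (Fin d), A ≠ 0 →
        ∃ B, ‖B‖ = k / ‖A‖ ∧ M.IsFanImage 0 Real.pi A B) →
      ∃ m L₀ : ℝ, 0 < m ∧ 0 < L₀ ∧
        ∀ r : ℝ, 0 < r → M.index r = fishEyeIndex m L₀ (√k) r) := by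
  refine ⟨fun Ω F h => ⟨fun A hA => h.turningParameter_eq hA, h.exists_norm_eq,
    fun k hk hF hall => ?_, fun k hk hF ⟨A, hA, u, hu, hAu, hray⟩ =>
      h.eq_one_of_tangential hk hF hA hu hAu hray, fun hs => ?_⟩,
    fun k hk hM H => M.exists_index_eq_fishEyeIndex (by omega) hk hM H⟩
  -- The reversed rays form a first-branch image with ratio k⁻¹, so uniqueness of the ratio gives
  -- k⁻¹ = k.
  · obtain ⟨Ω', F', h', hF'⟩ := h.exists_images_inv hd hk hF
    have hkk := hall Ω' F' k⁻¹ h' hF'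
    have h1 := mul_inv_cancel₀ hk.ne'
    rw [hkk, ← sq] at h1
    exact (pow_eq_one_iff_of_nonneg hk.le two_ne_zero).1 h1
  · obtain ⟨Q, hQ⟩ := h.exists_isometry hd hs
    refine ⟨Q, fun k hk hF A hA => ?_, fun k hk hF A hA => ?_⟩
    · rw [hQ A hA, hF A hA, mul_div_cancel_right₀ _ (h.norm_pos hA).1.ne']
    · rw [hQ A hA, hF A hA, div_div, sq]
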